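/- Let $q=e^{2\pi\sqrt{-1}\,\tau}$ with $\mathrm{Im}\,\tau>0$, $q^a:=e^{2\pi\sqrt{-1}\,\tau a}$, $(x)_\infty=\prod_{\nu\ge0}(1-q^\nu x)$ and $(x;c)_m=\prod_{i=0}^{m-1}(1-c^ix)$. Let $n\ge 0$, $\tilde\alpha,\beta_1,\beta_2,\gamma\in\mathbb C$, $x_1,x_2\in\mathbb C^*$, $x=x_2/x_1$. Put $\alpha_j=\tilde\alpha-n+j-2(j-1)\gamma$, $$\Phi(t)=\prod_{j=1}^n t_j^{\alpha_j}\frac{(t_j/x_1)_\infty}{(t_jq^{\beta_1}/x_1)_\infty}\frac{(t_j/x_2)_\infty}{(t_jq^{\beta_2}/x_2)_\infty}\prod_{1\le i<j\le n}\frac{(q^{1-\gamma}t_j/t_i)_\infty}{(q^{\gamma}t_j/t_i)_\infty},$$ $$\varphi_s(t)=\sum_{\sigma\in\mathfrak S_n}\mathrm{sgn}\,\sigma\cdot\sigma\Big[\prod_{k=1}^n\frac1{1-t_k/x_2}\prod_{k=1}^{n-s}\frac{1-q^{\beta_2}t_k/x_2}{1-t_k/x_1}\prod_{1\le i<j\le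 n}(t_i-q^{-\gamma}t_j)\Big]\qquad(0\le s\le n),$$ and $\tilde\varphi_s=\tilde\varphi_s(\xi)=(1-q)^n\sum_{\nu\in\mathbb Z^n}(\Phi\varphi_s)(q^{\nu_1}\xi_1,\dots,q^{\nu_n}\xi_n)$ for $\xi\in(\mathbb C^*)^n$; here the removable singularities of $\Phi\varphi_s$ at $t_k=x_1,x_2$ are filled in, and a branch of the powers is fixed by choosing $u_j$ with $\xi_j=q^{u_j}$ and setting $(q^{\nu_j}\xi_j)^{\alpha_j}=q^{\alpha_j(u_j+\nu_j)}$. Let $T_2$ denote the shift $x_2\mapsto qx_2$. Say that a matrix $K$ represents the system $$T_2(\tilde\varphi_0,\dots,\tilde\varphi_n)=(\tilde\varphi_0,\dots,\tilde\varphi_n)\,K$$ at $(x_1,x_2)$ if this holds for every $\xi$ whose lattice avoids the poles of $\Phi$ (that is, $q^{\beta_1}\xi_k/x_1,\ q^{\beta_2}\xi_k/x_2\notin q^{\mathbb Z}$ for all $k$, and $q^\gamma\xi_j/\xi_i\notin q^{\mathbb Z}$ for $i<j$) and for which the Jackson integrals at $(x_1,x_2)$ and at $(x_1,qx_2)$ converge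 absolutely, term by term in the alternating sums. Let $U_R,U'_R$ be the upper triangular, $L_R,L'_R$ the lower triangular and $D_R,D'_R$ the diagonal matrices, with rows and columns indexed by $0,\dots,n$, with entries ($r\le s$ for $u,u'$; $s\le r$ for $l,l'$) $$u_{rs}=(-1)^{s-r}(xq^{-\beta_2})^{s-r}q^{-(s-r)(s+r-1)\gamma/2}\frac{(q^\gamma;q^\gamma)_s}{(q^\gamma;q^\gamma)_{s-r}(q^\gamma;q^\gamma)_r}\frac{(q^{\beta_1+(n-s)\gamma};q^\gamma)_{s-r}}{(xq^{\beta_1-\beta_2+(n-2s+1)\gamma};q^\gamma)_{s-r}},$$ $$d_r=q^{-(n-r)\beta_2-r(n-r)\gamma}\frac{(xq^{\beta_1};q^\gamma)_{n-r}}{(xq^{-\beta_2-(r-1)\gamma};q^\gamma)_r}\frac{(xq^{\beta_1-\beta_2+(n-2r+1)\gamma};q^\gamma)_r}{(xq^{\beta_1-\beta_2-r\gamma};q^\gamma)_{n-r}},$$ $$l_{rs}=(-1)^{r-s}q^{\beta_2(s-r)}q^{-(r-s)(r+s-1)\gamma/2}\frac{(q^\gamma;q^\gamma)_{n-s}}{(q^\gamma;q^\gamma)_{r-s}(q^\gamma;q^\gamma)_{n-r}}\frac{(q^{\beta_2+s\gamma};q^\gamma)_{r-s}}{(xq^{\beta_1-\beta_2+(n-2r+1)\gamma};q^\gamma)_{r-s}},$$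 $$l'_{rs}=(-1)^{r-s}q^{-(r-s)(2n-r-s-1)\gamma/2}\frac{(q^\gamma;q^\gamma)_{n-s}}{(q^\gamma;q^\gamma)_{r-s}(q^\gamma;q^\gamma)_{n-r}}\frac{(q^{\beta_2+s\gamma};q^\gamma)_{r-s}}{(xq^{-(n-2s-1)\gamma};q^\gamma)_{r-s}},$$ $$d'_r=q^{-(n-r)(\beta_2+r\gamma)}\frac{(xq^{\beta_1};q^\gamma)_r}{(xq^{-\beta_2-(n-r-1)\gamma};q^\gamma)_{n-r}}\frac{(xq^{-(n-2r-1)\gamma};q^\gamma)_{n-r}}{(xq^{-(n-r)\gamma};q^\gamma)_r},$$ $$u'_{rs}=q^{-(s-r)r\gamma}\frac{(q^\gamma;q^\gamma)_s}{(q^\gamma;q^\gamma)_{s-r}(q^\gamma;q^\gamma)_r}\frac{(q^{\beta_1+(n-s)\gamma};q^\gamma)_{s-r}}{(x^{-1}q^{(n-r-s)\gamma};q^\gamma)_{s-r}}.$$ Assume that no denominator vanishes: $q^{k\gamma}\ne1$ for $1\le k\le n$, $xq^{-\beta_2-k\gamma}\ne1$ for $0\le k\le n-1$, and $xq^{\beta_1-\beta_2+k\gamma}\ne1$,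 $xq^{k\gamma}\ne1$ for $|k|\le n-1$. Then the matrix $K(x_1,x_2)$ of the system is $$K(x_1,x_2)=U_RD_RL_R\cdot\mathrm{diag}\big[q^{(\tilde\alpha-(n-1)\gamma)s}\big]_{s=0}^n=L'_RD'_RU'_R\cdot\mathrm{diag}\big[q^{(\tilde\alpha-(n-1)\gamma)s}\big]_{s=0}^n .$$ That is: (1) for every $\tilde\alpha$ the matrix $U_RD_RL_R\cdot\mathrm{diag}[q^{(\tilde\alpha-(n-1)\gamma)s}]$ represents the system; (2) the two products are equal; (3) if moreover $q^{k\gamma}\notin q^{\mathbb Z}$ for $1\le k\le n$ and none of $q^{\beta_1+k\gamma}$, $q^{\beta_2+k\gamma}$, $xq^{k\gamma}$, $xq^{\beta_1+k\gamma}$, $xq^{-\beta_2+k\gamma}$, for integers $|k|\le n$, lies in $q^{\mathbb Z}$, then there is $\varepsilon>0$ such that for all $\tilde\alpha$ with $|q^{\tilde\alpha}|<\varepsilon$ it is the only matrix that represents the system. -/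

import Mathlib

open Finset Matrix

noncomputable section

namespace QKZ

/-- `q ^ a` for `q = exp (2 π i τ)`. -/
def qpow (τ a : ℂ) : ℂ := Complex.exp (2 * (Real.pi : ℂ) * Complex.I * τ * a)

/-- `(x; c)_∞ = ∏_{ν ≥ 0} (1 - c ^ ν x)`. -/
def pochInf (x c : ℂ) : ℂ := ∏' ν : ℕ, (1 - c ^ ν * x)

/-- `(x; c)_m = (1 - x) (1 - c x) ⋯ (1 - c ^ (m - 1) x)`. -/
def poch (x c : ℂ) (m : ℕ) : ℂ := ∏ i ∈ range m, (1 - c ^ i * x)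

theorem multipliable_pochInf (x c : ℂ) (hc : ‖c‖ < 1) :
    Multipliable fun ν : ℕ => (1 - c ^ ν * x) := by
  have h : Multipliable fun ν : ℕ => (1 + -(c ^ ν * x)) := by
    apply multipliable_one_add_of_summable
    simp only [norm_neg, norm_mul, norm_pow]
    exact (summable_geometric_of_lt_one (norm_nonneg c) hc).mul_right _
  simpa [sub_eq_add_neg] using h

/-- The finite symbol is the quotient of infinite ones: `(x; c)_∞ = (x; c)_m (c ^ m x; c)_∞`. -/
theorem pochInf_eq_poch_mul (x c : ℂ) (hc : ‖c‖ < 1) (m : ℕ) :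
    pochInf x c = poch x c m * pochInf (c ^ m * x) c := by
  have e : (fun ν : ℕ => 1 - c ^ ν * (c ^ m * x)) = fun ν : ℕ => 1 - c ^ (ν + m) * x := by
    funext ν
    rw [pow_add, mul_assoc]
  have h := multipliable_pochInf (c ^ m * x) c hc
  rw [e] at h
  have k := Multipliable.prod_mul_tprod_nat_mul' (f := fun ν : ℕ => 1 - c ^ ν * x) (k := m) h
  unfold pochInf poch
  rw [e]
  exact k.symm

theorem norm_qpow_one_lt (τ : ℂ) (hτ : 0 < τ.im) : ‖qpow τ 1‖ < 1 := by
  unfold qpow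
  rw [Complex.norm_exp, Real.exp_lt_one_iff]
  simp
  positivity

/-! ### The multiplicative function, the basis and the Jackson integral

A point `t` of the torus is given by logarithmic coordinates `u`, with `t_k = q ^ (u_k)`; this
fixes the branch of the powers `t_k ^ α_k = q ^ (α_k u_k)` consistently along the lattice
`{(q ^ (u_1 + ν_1), …, q ^ (u_n + ν_n))}`.  Indices are zero-based: `k : Fin n` stands for the
coordinate number `k + 1`. -/

/-- The point of the torus with logarithmic coordinates `u`. -/
def point {n : ℕ} (τ : ℂ) (u : Fin n → ℂ) : Fin n → ℂ := fun k => qpow τ (u k)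

/-- `α_j = α - n + j - 2 (j - 1) γ`, with `j = k + 1`. -/
def expo {n : ℕ} (α γ : ℂ) (k : Fin n) : ℂ :=
  α - (n : ℂ) + ((k : ℕ) + 1 : ℂ) - 2 * ((k : ℕ) : ℂ) * γ

/-- `∏_j t_j ^ α_j`. -/
def powerPart {n : ℕ} (τ α γ : ℂ) (u : Fin n → ℂ) : ℂ :=
  ∏ k, qpow τ (expo α γ k * u k)

/-- `∏_{i < j} (q ^ (1 - γ) t_j / t_i)_∞ / (q ^ γ t_j / t_i)_∞`. -/
def pairPart {n : ℕ} (τ γ : ℂ) (t : Fin n → ℂ) : ℂ :=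
  ∏ i, ∏ j ∈ Ioi i, pochInf (qpow τ (1 - γ) * t j / t i) (qpow τ 1) /
    pochInf (qpow τ γ * t j / t i) (qpow τ 1)

/-- The function `Φ`. -/
def Phi {n : ℕ} (τ α β₁ β₂ γ x₁ x₂ : ℂ) (u : Fin n → ℂ) : ℂ :=
  powerPart τ α γ u *
  (∏ k, (pochInf (point τ u k / x₁) (qpow τ 1) /
      pochInf (point τ u k * qpow τ β₁ / x₁) (qpow τ 1) *
    (pochInf (point τ u k / x₂) (qpow τ 1) /
      pochInf (point τ u k * qpow τ β₂ / x₂) (qpow τ 1)))) *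
  pairPart τ γ (point τ u)

/-- The alternating sum `∑_σ sgn σ · σ g`. -/
def altSum {n : ℕ} (g : (Fin n → ℂ) → ℂ) (t : Fin n → ℂ) : ℂ :=
  ∑ σ : Equiv.Perm (Fin n), ((Equiv.Perm.sign σ : ℤ) : ℂ) * g (fun k => t (σ k))

/-- `∏_{i < j} (t_i - q ^ (-γ) t_j)`. -/
def deltaGamma {n : ℕ} (τ γ : ℂ) (t : Fin n → ℂ) : ℂ :=
  ∏ i, ∏ j ∈ Ioi i, (t i - qpow τ (-γ) * t j)

/-- The function under the alternating sum in `φ_s`. -/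
def phiTerm {n : ℕ} (τ β₂ γ x₁ x₂ : ℂ) (s : Fin (n + 1)) (t : Fin n → ℂ) : ℂ :=
  (∏ k, 1 / (1 - t k / x₂)) *
  (∏ k ∈ univ.filter (fun k : Fin n => (k : ℕ) < n - (s : ℕ)), (1 - qpow τ β₂ * t k / x₂) / (1 - t k / x₁)) *
  deltaGamma τ γ t

/-- The rational function `φ_s`, `0 ≤ s ≤ n`. -/
def phi {n : ℕ} (τ β₂ γ x₁ x₂ : ℂ) (s : Fin (n + 1)) (t : Fin n → ℂ) : ℂ :=
  altSum (phiTerm τ β₂ γ x₁ x₂ s) t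

/-- `Φ(t) ∏_k 1 / ((1 - t_k / x₁) (1 - t_k / x₂))`, with the simple poles at `t_k = x₁, x₂`
cancelled against zeros of `Φ`. -/
def PhiReg {n : ℕ} (τ α β₁ β₂ γ x₁ x₂ : ℂ) (u : Fin n → ℂ) : ℂ :=
  powerPart τ α γ u *
  (∏ k, (pochInf (qpow τ 1 * (point τ u k / x₁)) (qpow τ 1) /
      pochInf (point τ u k * qpow τ β₁ / x₁) (qpow τ 1) *
    (pochInf (qpow τ 1 * (point τ u k / x₂)) (qpow τ 1) /
      pochInf (point τ u k * qpow τ β₂ / x₂) (qpow τ 1)))) *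
  pairPart τ γ (point τ u)

/-- `∏_k (1 - t_k / x₁) (1 - t_k / x₂)` times `phiTerm`: a polynomial. -/
def numTerm {n : ℕ} (τ β₂ γ x₁ x₂ : ℂ) (s : Fin (n + 1)) (t : Fin n → ℂ) : ℂ :=
  (∏ k : Fin n, if (k : ℕ) < n - (s : ℕ) then 1 - qpow τ β₂ * t k / x₂ else 1 - t k / x₁) *
  deltaGamma τ γ t

/-- The integrand `Φ φ_s`, with its removable singularities at `t_k = x₁` and `t_k = x₂` filled
in (see `integrand_eq`). -/
def integrand {n : ℕ} (τ α β₁ β₂ γ x₁ x₂ : ℂ) (s : Fin (n + 1)) (u : Fin n → ℂ) : ℂ :=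
  PhiReg τ α β₁ β₂ γ x₁ x₂ u * altSum (numTerm τ β₂ γ x₁ x₂ s) (point τ u)

theorem phiTerm_mul {n : ℕ} (τ β₂ γ x₁ x₂ : ℂ) (s : Fin (n + 1)) (t : Fin n → ℂ)
    (h₁ : ∀ k, 1 - t k / x₁ ≠ 0) (h₂ : ∀ k, 1 - t k / x₂ ≠ 0) :
    (∏ k, (1 - t k / x₁) * (1 - t k / x₂)) * phiTerm τ β₂ γ x₁ x₂ s t
      = numTerm τ β₂ γ x₁ x₂ s t := by
  unfold phiTerm numTerm
  rw [← mul_assoc, prod_filter, ← prod_mul_distrib, ← prod_mul_distrib]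
  congr 1
  refine prod_congr rfl fun k _ => ?_
  have a := h₁ k
  have b := h₂ k
  split_ifs
  · rw [div_eq_mul_inv (1 - qpow τ β₂ * t k / x₂)]
    have e : (1 - t k / x₁) * (1 - t k / x₁)⁻¹ = 1 := mul_inv_cancel₀ a
    have f : (1 - t k / x₂) * (1 - t k / x₂)⁻¹ = 1 := mul_inv_cancel₀ b
    rw [one_div]
    linear_combination (1 - qpow τ β₂ * t k / x₂) *
      ((1 - t k / x₂) * (1 - t k / x₂)⁻¹ * e + f)
  · have f : (1 - t k / x₂) * (1 - t k / x₂)⁻¹ = 1 := mul_inv_cancel₀ b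
    rw [one_div]
    linear_combination (1 - t k / x₁) * f

theorem pochInf_step (x c : ℂ) (hc : ‖c‖ < 1) :
    pochInf x c = (1 - x) * pochInf (c * x) c := by
  simpa [poch] using pochInf_eq_poch_mul x c hc 1

theorem integrand_eq {n : ℕ} (τ α β₁ β₂ γ x₁ x₂ : ℂ) (hτ : 0 < τ.im) (hx₁ : x₁ ≠ 0)
    (hx₂ : x₂ ≠ 0) (s : Fin (n + 1)) (u : Fin n → ℂ)
    (h₁ : ∀ k, point τ u k ≠ x₁) (h₂ : ∀ k, point τ u k ≠ x₂) :
    integrand τ α β₁ β₂ γ x₁ x₂ s u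
      = Phi τ α β₁ β₂ γ x₁ x₂ u * phi τ β₂ γ x₁ x₂ s (point τ u) := by
  have a : ∀ k, 1 - point τ u k / x₁ ≠ 0 := fun k e =>
    h₁ k ((div_eq_one_iff_eq hx₁).1 (sub_eq_zero.1 e).symm)
  have b : ∀ k, 1 - point τ u k / x₂ ≠ 0 := fun k e =>
    h₂ k ((div_eq_one_iff_eq hx₂).1 (sub_eq_zero.1 e).symm)
  have hPhi : Phi τ α β₁ β₂ γ x₁ x₂ u = PhiReg τ α β₁ β₂ γ x₁ x₂ u *
      ∏ k, (1 - point τ u k / x₁) * (1 - point τ u k / x₂) := by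
    unfold Phi PhiReg
    rw [mul_right_comm _ (pairPart τ γ (point τ u)), mul_assoc (powerPart τ α γ u) (∏ k, _) (∏ k, _),
      ← prod_mul_distrib]
    congr 2
    refine prod_congr rfl fun k _ => ?_
    rw [pochInf_step (point τ u k / x₁) _ (norm_qpow_one_lt τ hτ),
      pochInf_step (point τ u k / x₂) _ (norm_qpow_one_lt τ hτ)]
    ring
  rw [hPhi, integrand, mul_assoc]
  congr 1
  unfold phi altSum
  rw [mul_sum]
  refine sum_congr rfl fun σ _ => ?_
  rw [← phiTerm_mul τ β₂ γ x₁ x₂ s (fun k => point τ u (σ k)) (fun k => a _) (fun k => b _),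
    Equiv.prod_comp σ (fun k => (1 - point τ u k / x₁) * (1 - point τ u k / x₂))]
  ring

/-- The Jackson integral of `f` over the lattice through the point with logarithmic
coordinates `u`, with respect to `(d_q t_1 / t_1) ∧ ⋯ ∧ (d_q t_n / t_n)`. -/
def jackson {n : ℕ} (τ : ℂ) (f : (Fin n → ℂ) → ℂ) (u : Fin n → ℂ) : ℂ :=
  (1 - qpow τ 1) ^ n * ∑' ν : Fin n → ℤ, f (fun k => u k + (ν k : ℂ))

/-- The row vector `(φ̃_0, …, φ̃_n)` of Jackson integrals of `Φ φ_s` over the lattice through the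
point with logarithmic coordinates `u`, as a function of `x₁` and `x₂`. -/
def phiTilde {n : ℕ} (τ α β₁ β₂ γ : ℂ) (u : Fin n → ℂ) (x₁ x₂ : ℂ) : Fin (n + 1) → ℂ :=
  fun s => jackson τ (integrand τ α β₁ β₂ γ x₁ x₂ s) u

/-- The `q`-shift operator `T₂`. -/
def shiftTwo {X : Type*} (τ : ℂ) (F : ℂ → ℂ → X) : ℂ → ℂ → X :=
  fun x₁ x₂ => F x₁ (qpow τ 1 * x₂)

/-- The lattice through the point `t` stays away from the poles of `Φ`. -/
def AvoidsPoles {n : ℕ} (τ β₁ β₂ γ x₁ x₂ : ℂ) (t : Fin n → ℂ) : Prop :=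
  (∀ k, ∀ m : ℤ, qpow τ β₁ * t k / x₁ ≠ qpow τ m ∧ qpow τ β₂ * t k / x₂ ≠ qpow τ m) ∧
  ∀ i j, i < j → ∀ m : ℤ, qpow τ γ * t j / t i ≠ qpow τ m

/-- Absolute convergence of the Jackson integrals `φ̃_0, …, φ̃_n`, for every one of the `n!` terms
of the alternating sums defining the `φ_s`. -/
def AbsConverges {n : ℕ} (τ α β₁ β₂ γ x₁ x₂ : ℂ) (u : Fin n → ℂ) : Prop :=
  ∀ (s : Fin (n + 1)) (σ : Equiv.Perm (Fin n)), Summable fun ν : Fin n → ℤ =>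
    PhiReg τ α β₁ β₂ γ x₁ x₂ (fun k => u k + (ν k : ℂ)) *
      numTerm τ β₂ γ x₁ x₂ s (fun k => point τ (fun i => u i + (ν i : ℂ)) (σ k))

/-- The lattices over which both sides of the `q`-difference system are defined. -/
def Admissible {n : ℕ} (τ α β₁ β₂ γ x₁ x₂ : ℂ) (u : Fin n → ℂ) : Prop :=
  AvoidsPoles τ β₁ β₂ γ x₁ x₂ (point τ u) ∧
  AbsConverges τ α β₁ β₂ γ x₁ x₂ u ∧ AbsConverges τ α β₁ β₂ γ x₁ (qpow τ 1 * x₂) u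

/-- `K` represents the `q`-difference system at `(x₁, x₂)`:
`T₂ (φ̃_0, …, φ̃_n) = (φ̃_0, …, φ̃_n) K`, on all lattices. -/
def IsQKZMatrix {n : ℕ} (τ α β₁ β₂ γ x₁ x₂ : ℂ)
    (K : Matrix (Fin (n + 1)) (Fin (n + 1)) ℂ) : Prop :=
  ∀ u : Fin n → ℂ, Admissible τ α β₁ β₂ γ x₁ x₂ u →
    shiftTwo τ (phiTilde τ α β₁ β₂ γ u) x₁ x₂ = phiTilde τ α β₁ β₂ γ u x₁ x₂ ᵥ* K

/-! ### The explicit factors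

Throughout `x = x₂ / x₁` and rows and columns are numbered `0, …, n`. -/

/-- `(q ^ γ; q ^ γ)_a / ((q ^ γ; q ^ γ)_{a - b} (q ^ γ; q ^ γ)_b)`. -/
def qbinom (τ γ : ℂ) (a b : ℕ) : ℂ :=
  poch (qpow τ γ) (qpow τ γ) a /
    (poch (qpow τ γ) (qpow τ γ) (a - b) * poch (qpow τ γ) (qpow τ γ) b)

/-- Entries of `U_R`, `r ≤ s`. -/
def uR (n : ℕ) (τ β₁ β₂ γ x : ℂ) (r s : ℕ) : ℂ :=
  (-1) ^ (s - r) * (x * qpow τ (-β₂)) ^ (s - r) *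
    qpow τ (-((s - r : ℂ) * (s + r - 1) * γ / 2)) * qbinom τ γ s r *
    (poch (qpow τ (β₁ + (n - s) * γ)) (qpow τ γ) (s - r) /
      poch (x * qpow τ (β₁ - β₂ + (n - 2 * s + 1) * γ)) (qpow τ γ) (s - r))

/-- Diagonal entries of `D_R`. -/
def dR (n : ℕ) (τ β₁ β₂ γ x : ℂ) (r : ℕ) : ℂ :=
  qpow τ (-((n - r : ℂ) * β₂) - r * (n - r) * γ) *
    (poch (x * qpow τ β₁) (qpow τ γ) (n - r) /
      poch (x * qpow τ (-β₂ - (r - 1) * γ)) (qpow τ γ) r) *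
    (poch (x * qpow τ (β₁ - β₂ + (n - 2 * r + 1) * γ)) (qpow τ γ) r /
      poch (x * qpow τ (β₁ - β₂ - r * γ)) (qpow τ γ) (n - r))

/-- Entries of `L_R`, `s ≤ r`. -/
def lR (n : ℕ) (τ β₁ β₂ γ x : ℂ) (r s : ℕ) : ℂ :=
  (-1) ^ (r - s) * qpow τ (β₂ * (s - r)) *
    qpow τ (-((r - s : ℂ) * (r + s - 1) * γ / 2)) * qbinom τ γ (n - s) (n - r) *
    (poch (qpow τ (β₂ + s * γ)) (qpow τ γ) (r - s) /
      poch (x * qpow τ (β₁ - β₂ + (n - 2 * r + 1) * γ)) (qpow τ γ) (r - s))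

/-- Entries of `L'_R`, `s ≤ r`. -/
def lR' (n : ℕ) (τ β₂ γ x : ℂ) (r s : ℕ) : ℂ :=
  (-1) ^ (r - s) * qpow τ (-((r - s : ℂ) * (2 * n - r - s - 1) * γ / 2)) *
    qbinom τ γ (n - s) (n - r) *
    (poch (qpow τ (β₂ + s * γ)) (qpow τ γ) (r - s) /
      poch (x * qpow τ (-((n - 2 * s - 1) * γ))) (qpow τ γ) (r - s))

/-- Diagonal entries of `D'_R`. -/
def dR' (n : ℕ) (τ β₁ β₂ γ x : ℂ) (r : ℕ) : ℂ :=
  qpow τ (-((n - r : ℂ) * (β₂ + r * γ))) *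
    (poch (x * qpow τ β₁) (qpow τ γ) r /
      poch (x * qpow τ (-β₂ - (n - r - 1) * γ)) (qpow τ γ) (n - r)) *
    (poch (x * qpow τ (-((n - 2 * r - 1) * γ))) (qpow τ γ) (n - r) /
      poch (x * qpow τ (-((n - r) * γ))) (qpow τ γ) r)

/-- Entries of `U'_R`, `r ≤ s`; the last denominator contains `x₁ / x₂ = x⁻¹`. -/
def uR' (n : ℕ) (τ β₁ γ x : ℂ) (r s : ℕ) : ℂ :=
  qpow τ (-((s - r : ℂ) * r * γ)) * qbinom τ γ s r *
    (poch (qpow τ (β₁ + (n - s) * γ)) (qpow τ γ) (s - r) /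
      poch (x⁻¹ * qpow τ ((n - r - s) * γ)) (qpow τ γ) (s - r))

/-- The upper triangular matrix with entries `f r s`, `r ≤ s`. -/
def upper (n : ℕ) (f : ℕ → ℕ → ℂ) : Matrix (Fin (n + 1)) (Fin (n + 1)) ℂ :=
  Matrix.of fun r s => if r ≤ s then f r s else 0

/-- The lower triangular matrix with entries `f r s`, `s ≤ r`. -/
def lower (n : ℕ) (f : ℕ → ℕ → ℂ) : Matrix (Fin (n + 1)) (Fin (n + 1)) ℂ :=
  Matrix.of fun r s => if s ≤ r then f r s else 0

/-- The diagonal matrix with entries `f 0, …, f n`. -/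
def diag (n : ℕ) (f : ℕ → ℂ) : Matrix (Fin (n + 1)) (Fin (n + 1)) ℂ :=
  Matrix.diagonal fun r => f r

def UR (n : ℕ) (τ β₁ β₂ γ x₁ x₂ : ℂ) := upper n (uR n τ β₁ β₂ γ (x₂ / x₁))

def DR (n : ℕ) (τ β₁ β₂ γ x₁ x₂ : ℂ) := diag n (dR n τ β₁ β₂ γ (x₂ / x₁))

def LR (n : ℕ) (τ β₁ β₂ γ x₁ x₂ : ℂ) := lower n (lR n τ β₁ β₂ γ (x₂ / x₁))

def LR' (n : ℕ) (τ β₂ γ x₁ x₂ : ℂ) := lower n (lR' n τ β₂ γ (x₂ / x₁))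

def DR' (n : ℕ) (τ β₁ β₂ γ x₁ x₂ : ℂ) := diag n (dR' n τ β₁ β₂ γ (x₂ / x₁))

def UR' (n : ℕ) (τ β₁ γ x₁ x₂ : ℂ) := upper n (uR' n τ β₁ γ (x₂ / x₁))

/-- `diag [q ^ ((α - (n - 1) γ) s)]_{s = 0}^n`. -/
def diagAlpha (n : ℕ) (τ α γ : ℂ) := diag n fun s => qpow τ ((α - (n - 1) * γ) * s)

/-- No denominator of the explicit factors vanishes. -/
def DenominatorsNonzero (n : ℕ) (τ β₁ β₂ γ x₁ x₂ : ℂ) : Prop :=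
  (∀ k : ℕ, 1 ≤ k → k ≤ n → qpow τ (k * γ) ≠ 1) ∧
  (∀ k : ℕ, k < n → x₂ / x₁ * qpow τ (-β₂ - k * γ) ≠ 1) ∧
  (∀ k : ℤ, |k| < n → x₂ / x₁ * qpow τ (β₁ - β₂ + k * γ) ≠ 1) ∧
  (∀ k : ℤ, |k| < n → x₂ / x₁ * qpow τ (k * γ) ≠ 1)

/-- Generic position of `γ`, `β₁`, `β₂`, `x₁`, `x₂` modulo powers of `q`. -/
def IsGeneric (n : ℕ) (τ β₁ β₂ γ x₁ x₂ : ℂ) : Prop :=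
  (∀ k : ℕ, 1 ≤ k → k ≤ n → ∀ m : ℤ, qpow τ (k * γ) ≠ qpow τ m) ∧
  ∀ k : ℤ, |k| ≤ n → ∀ m : ℤ,
    qpow τ (β₁ + k * γ) ≠ qpow τ m ∧ qpow τ (β₂ + k * γ) ≠ qpow τ m ∧
    x₂ / x₁ * qpow τ (k * γ) ≠ qpow τ m ∧
    x₂ / x₁ * qpow τ (β₁ + k * γ) ≠ qpow τ m ∧
    x₂ / x₁ * qpow τ (-β₂ + k * γ) ≠ qpow τ m

end QKZ

end

noncomputable section

namespace QKZ

/-! Write p = q^{-γ} and Δ(t) = ∏_{i<j} (t_i - p t_j).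

The shift. Under x₂ ↦ q x₂ the change of Φ turns each of the first n - s linear factors of the
summand of φ_s into 1 - t/x₂ (`varFactor_shift_mul`). The remaining s factors 1 - t/x₁ occupy the
last places. A Jackson sum does not change when one variable is multiplied by q; doing this to the
variable in the last place and moving it to the front costs exactly q^{α-(n-1)γ}, because the
exponents α_j and Δ are adapted to each other (`altJackson_rotate`). Together with x₂ ↦ q x₂ it
turns 1 - t/x₁ into 1 - q^{β₁} t/x₁ (`varFactor_shift_qmul`). After s rotations, T₂ φ̃_s is
q^{(α-(n-1)γ)s} times the integral with numerator the alternating sum of ∏_{k≤s} (1 - q^{β₁} t_k/x₁)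
∏_{k>s} (1 - t_k/x₂) Δ(t).

Reduction to one variable. Exchanging neighbouring variables shows that the alternating sum of
∏_{k∈S} t_k · Δ depends, up to an explicit power of p, only on the size of S. Hence the alternating
sum of ∏_k (1 - y_k t_k) · Δ is a linear functional of the polynomial ∏_k (1 - y_k p^k z), with k
counted from 0 (`altSum_of_linear_relation`). What remains is to expand one family of products of n
linear factors in z in another (`psiPoly` in `phiPoly`).

The Gauss decompositions. The products (cz;p)_{n-k} (dz;p)_k share a factor with the members of
either family. Passing through them writes the transition matrix as upper times lower triangular,
with q-binomial connection coefficients `connA` and `connB` (`psiPoly_eq_sum`); this is U_R D_R L_R.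
Reading every product backwards replaces p by p⁻¹ and reverses the indices; the same argument then
passes through products built on 1/x₁ and 1/x₂ and yields L'_R D'_R U'_R. The two agree because the
`phiPoly` are linearly independent.

Uniqueness. For 0 ≤ r ≤ n consider the lattice through (x₁, x₁q^γ, …, x₁q^{(r-1)γ}, x₂, x₂q^γ, …,
x₂q^{(n-r-1)γ}). The regularised Φ vanishes on it outside the cone ν ∈ ℕ^n, so the integrals are, up
to a nonzero factor depending on r, power series in q^α converging near 0, whose constant terms are
the values at ν = 0. These values vanish for r + s > n and not for r + s = n. The matrix of the n +
1 row vectors is therefore invertible for small q^α (`eventually_det_seriesMatrix_ne_zero`), which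
determines K. -/

/-! ### Finite q-shifted factorials and Gaussian binomial coefficients -/

theorem poch_zero (x c : ℂ) : poch x c 0 = 1 := by simp [poch]

theorem poch_succ (x c : ℂ) (m : ℕ) : poch x c (m + 1) = poch x c m * (1 - c ^ m * x) := by
  simp [poch, prod_range_succ]

theorem poch_succ_left (x c : ℂ) (m : ℕ) : poch x c (m + 1) = (1 - x) * poch (c * x) c m := by
  rw [poch, prod_range_succ', mul_comm]
  simp [poch, pow_succ, mul_assoc]

theorem poch_add (x c : ℂ) (m k : ℕ) :
    poch x c (m + k) = poch x c m * poch (c ^ m * x) c k := by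
  rw [poch, prod_range_add]
  simp [poch, pow_add, mul_assoc, mul_left_comm]

theorem poch_ne_zero {x c : ℂ} {m : ℕ} (h : ∀ i < m, c ^ i * x ≠ 1) : poch x c m ≠ 0 :=
  prod_ne_zero_iff.2 fun i hi => sub_ne_zero.2 (h i (mem_range.1 hi)).symm

/-- The Gaussian binomial coefficients. -/
def gauss (p : ℂ) : ℕ → ℕ → ℂ
  | _, 0 => 1
  | 0, _ + 1 => 0
  | s + 1, k + 1 => p ^ (k + 1) * gauss p s (k + 1) + gauss p s k

@[simp] theorem gauss_zero_right (p : ℂ) (s : ℕ) : gauss p s 0 = 1 := by cases s <;> rfl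

theorem gauss_succ_succ (p : ℂ) (s k : ℕ) :
    gauss p (s + 1) (k + 1) = p ^ (k + 1) * gauss p s (k + 1) + gauss p s k := rfl

theorem gauss_eq_zero (p : ℂ) : ∀ {s k : ℕ}, s < k → gauss p s k = 0
  | 0, k + 1, _ => rfl
  | s + 1, k + 1, h => by
    rw [gauss_succ_succ, gauss_eq_zero p (by omega), gauss_eq_zero p (by omega)]
    simp

theorem gauss_self (p : ℂ) : ∀ s : ℕ, gauss p s s = 1
  | 0 => rfl
  | s + 1 => by
    rw [gauss_succ_succ, gauss_eq_zero p (Nat.lt_succ_self s), gauss_self p s]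
    simp

theorem gauss_absorb (p : ℂ) (s : ℕ) : ∀ k m : ℕ, s = k + m →
    (1 - p ^ (k + 1)) * gauss p s (k + 1) = (1 - p ^ m) * gauss p s k := by
  induction s with
  | zero =>
    intro k m h
    obtain ⟨rfl, rfl⟩ : k = 0 ∧ m = 0 := by omega
    simp [gauss]
  | succ s ih =>
    intro k m h
    rcases k with _ | k
    · have e := ih 0 s (by omega)
      obtain rfl : m = s + 1 := by omega
      rw [gauss_succ_succ]
      simp only [gauss_zero_right, zero_add, pow_one, mul_one] at e ⊢
      rw [pow_succ]
      linear_combination p * e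
    · rcases m with _ | m
      · rw [gauss_eq_zero p (by omega)]
        simp
      · have e₁ := ih (k + 1) m (by omega)
        have e₂ := ih k (m + 1) (by omega)
        rw [gauss_succ_succ, gauss_succ_succ]
        simp only [pow_succ] at e₁ e₂ ⊢
        linear_combination p ^ k * p * p * e₁ + e₂

theorem gauss_succ_succ' (p : ℂ) (k m : ℕ) :
    gauss p (k + m + 1) (k + 1) = gauss p (k + m) (k + 1) + p ^ m * gauss p (k + m) k := by
  rw [gauss_succ_succ]
  linear_combination - gauss_absorb p (k + m) k m rfl

theorem gauss_mul_poch (p : ℂ) (k : ℕ) : ∀ m : ℕ,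
    gauss p (k + m) k * (poch p p k * poch p p m) = poch p p (k + m) := by
  induction k with
  | zero => intro m; simp [poch_zero]
  | succ k ih =>
    intro m
    have e := gauss_absorb p (k + (m + 1)) k (m + 1) rfl
    have f := ih (m + 1)
    rw [poch_succ] at f
    rw [poch_succ p p k, show k + 1 + m = k + (m + 1) by omega, ← f]
    simp only [pow_succ] at e ⊢
    linear_combination poch p p k * poch p p m * e

/-! ### Connection coefficients between products of linear factors -/

/-- The summation step of both expansions below: in passing from s to s + 1, each term splits into
one that keeps its index (C₁) and one that raises it (C₂). -/
theorem sum_range_of_recurrence {s : ℕ} {C' C₁ C₂ : ℕ → ℂ} (B : ℕ → ℂ) (h₀ : C' 0 = C₁ 0)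
    (h : ∀ r ≤ s, C' (r + 1) = C₁ (r + 1) + C₂ r) (hs : C₁ (s + 1) = 0) :
    ∑ r ∈ range (s + 2), C' r * B r
      = ∑ r ∈ range (s + 1), C₁ r * B r + ∑ r ∈ range (s + 1), C₂ r * B (r + 1) := by
  have e : ∑ r ∈ range (s + 1), C₁ r * B r = ∑ r ∈ range (s + 2), C₁ r * B r := by
    rw [sum_range_succ _ (s + 1), hs]; simp
  rw [e, sum_range_succ', sum_range_succ' _ (s + 1), h₀, add_right_comm, ← sum_add_distrib]
  congr 1
  refine sum_congr rfl fun r hr => ?_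
  rw [h r (by have := mem_range.1 hr; omega)]
  ring

/-- Coefficients of `∏_{i < s} (1 - δ p^i z)` in the basis
`∏_{i < s - r} (1 - p^i z) ∏_{s - r ≤ i < s} (1 - α p^i z)`. -/
def connA (p α : ℂ) (s r : ℕ) (δ : ℂ) : ℂ :=
  gauss p s r * poch δ p r * poch (δ / α) p⁻¹ (s - r) * (-α) ^ (s - r) * p ^ (s - r).choose 2 /
    poch α p s

theorem choose_succ_two (m : ℕ) : (m + 1).choose 2 = m + m.choose 2 := by
  rw [Nat.choose_succ_succ' m 1, Nat.choose_one_right]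

theorem connA_succ_zero {p α : ℂ} (hp : p ≠ 0) (hα : α ≠ 0) (s : ℕ) (δ : ℂ)
    (h : poch α p (s + 1) ≠ 0) :
    connA p α (s + 1) 0 δ = (δ - α * p ^ s) / (1 - α * p ^ s) * connA p α s 0 δ := by
  rw [poch_succ] at h
  have h₁ := left_ne_zero_of_mul h
  have h₂ := right_ne_zero_of_mul h
  have h₃ : 1 - α * p ^ s ≠ 0 := by rwa [mul_comm]
  unfold connA
  simp only [gauss_zero_right, poch_zero, Nat.sub_zero, choose_succ_two, poch_succ, pow_add, inv_pow]
  have hps : p ^ s ≠ 0 := pow_ne_zero _ hp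
  field_simp
  ring

theorem connA_succ_succ {p α : ℂ} (hp : p ≠ 0) (hα : α ≠ 0) (s r : ℕ) (hr : r ≤ s) (δ : ℂ)
    (h : poch α p (s + 1) ≠ 0) :
    connA p α (s + 1) (r + 1) δ = (δ - α * p ^ s) / (1 - α * p ^ s) * connA p α s (r + 1) δ +
      (1 - δ) / (1 - α * p ^ s) * connA p α s r (p * δ) := by
  rw [poch_succ] at h
  have h₁ := left_ne_zero_of_mul h
  have h₂ := right_ne_zero_of_mul h
  have h₃ : 1 - α * p ^ s ≠ 0 := by rwa [mul_comm]
  rcases hr.lt_or_eq with hr | rfl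
  · obtain ⟨m, rfl⟩ : ∃ m, s = r + 1 + m := ⟨s - (r + 1), by omega⟩
    have e₁ := gauss_succ_succ p (r + 1 + m) r
    have e₂ := gauss_succ_succ' p r (m + 1)
    rw [show r + (m + 1) = r + 1 + m by omega] at e₂
    unfold connA
    rw [show r + 1 + m + 1 - (r + 1) = m + 1 by omega, show r + 1 + m - (r + 1) = m by omega,
      show r + 1 + m - r = m + 1 by omega, poch_succ α, poch_succ_left δ,
      poch_succ (δ / α), poch_succ_left (p * δ / α),
      show p⁻¹ * (p * δ / α) = δ / α by field_simp, choose_succ_two]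
    have hpm : p ^ m ≠ 0 := pow_ne_zero _ hp
    have hpr : p ^ r ≠ 0 := pow_ne_zero _ hp
    simp only [pow_add, pow_one, inv_pow] at e₁ e₂ h₁ h₂ h₃ ⊢
    generalize gauss p (r + 1 + m + 1) (r + 1) = G at *
    generalize gauss p (r + 1 + m) (r + 1) = G₁ at *
    generalize gauss p (r + 1 + m) r = G₂ at *
    generalize poch α p (r + 1 + m) = D at *
    generalize poch (p * δ) p r = E at *
    generalize poch (δ / α) p⁻¹ m = F at *
    generalize p ^ m.choose 2 = Q at *
    generalize p ^ m = M at *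
    generalize p ^ r = R at *
    -- The two Pascal rules enter separately: one for the part with α, the other for the part with
    -- δ.
    have key : G * (α * M - δ) = α * M * (R * p * G₁ + G₂) - δ * (G₁ + M * p * G₂) := by
      linear_combination α * M * e₁ - δ * e₂
    rw [show 1 - R * p * M * α = 1 - α * (R * p * M) by ring]
    generalize hT : 1 - α * (R * p * M) = T at *
    field_simp
    linear_combination (δ - 1) * E * F * α ^ m * Q * (-1) ^ m * key
  · unfold connA
    rw [gauss_self, gauss_self, gauss_eq_zero p (Nat.lt_succ_self r), Nat.sub_self, Nat.sub_self,
      poch_succ α, poch_succ_left δ]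
    simp only [poch_zero]
    field_simp
    simp

/-- Induction on s: split off the factor 1 - δz and write it, with a = αp^s, as ((δ - a)(1 - z) + (1
- δ)(1 - az)) / (1 - a). The first part multiplies the expansion at (δ, pz), the second the one at
(pδ, z), so δ and z have to vary in the induction. -/
theorem poch_eq_sum_connA {p α : ℂ} (hp : p ≠ 0) (hα : α ≠ 0) (s : ℕ) (h : poch α p s ≠ 0) :
    ∀ δ z : ℂ, poch (δ * z) p s = ∑ r ∈ range (s + 1),
      connA p α s r δ * (poch z p (s - r) * poch (α * p ^ (s - r) * z) p r) := by
  induction s with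
  | zero => intro δ z; simp [connA, poch_zero]
  | succ s ih =>
    intro δ z
    have h' := h
    rw [poch_succ] at h'
    have ih := ih (left_ne_zero_of_mul h')
    have h₃ : 1 - α * p ^ s ≠ 0 := by rw [mul_comm]; exact right_ne_zero_of_mul h'
    rw [sum_range_of_recurrence
      (C₁ := fun r => (δ - α * p ^ s) / (1 - α * p ^ s) * connA p α s r δ)
      (C₂ := fun r => (1 - δ) / (1 - α * p ^ s) * connA p α s r (p * δ))
      (fun r => poch z p (s + 1 - r) * poch (α * p ^ (s + 1 - r) * z) p r)
      (connA_succ_zero hp hα s δ h) (fun r hr => connA_succ_succ hp hα s r hr δ h)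
      (by simp [connA, gauss_eq_zero p (Nat.lt_succ_self s)])]
    have e₁ : ∑ r ∈ range (s + 1), (δ - α * p ^ s) / (1 - α * p ^ s) * connA p α s r δ *
        (poch z p (s + 1 - r) * poch (α * p ^ (s + 1 - r) * z) p r)
        = (δ - α * p ^ s) / (1 - α * p ^ s) * (1 - z) * poch (δ * (p * z)) p s := by
      rw [ih, mul_sum]
      refine sum_congr rfl fun r hr => ?_
      have := mem_range.1 hr
      rw [show s + 1 - r = s - r + 1 by omega, poch_succ_left,
        show α * p ^ (s - r + 1) * z = α * p ^ (s - r) * (p * z) by ring]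
      ring
    have e₂ : ∑ r ∈ range (s + 1), (1 - δ) / (1 - α * p ^ s) * connA p α s r (p * δ) *
        (poch z p (s + 1 - (r + 1)) * poch (α * p ^ (s + 1 - (r + 1)) * z) p (r + 1))
        = (1 - δ) / (1 - α * p ^ s) * (1 - α * p ^ s * z) * poch (p * δ * z) p s := by
      rw [ih, mul_sum]
      refine sum_congr rfl fun r hr => ?_
      have := mem_range.1 hr
      rw [Nat.add_sub_add_right, poch_succ]
      have : p ^ r * (α * p ^ (s - r) * z) = α * p ^ s * z := by
        rw [show s = r + (s - r) by omega, Nat.add_sub_cancel_left, pow_add]; ring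
      rw [this]
      ring
    rw [e₁, e₂, poch_succ_left, show δ * (p * z) = p * (δ * z) by ring,
      show p * δ * z = p * (δ * z) by ring]
    field_simp
    ring

/-- Coefficients of `∏_{i < N} (1 - β p^i z)` in the basis
`∏_{i < N - j} (1 - p^i z) ∏_{i < j} (1 - δ p^i z)`. -/
def connB (p β δ : ℂ) (N j : ℕ) : ℂ :=
  gauss p N j * (-1) ^ j * β ^ N * p ^ j.choose 2 * poch (δ / β) p⁻¹ (N - j) * poch (1 / β) p⁻¹ j /
    (poch (δ * p ^ j) p⁻¹ (N - j) * poch (δ * p⁻¹ ^ (N - j)) p j)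

theorem connB_succ_zero {p β δ : ℂ} (hp : p ≠ 0) (hβ : β ≠ 0) (N : ℕ)
    (h : ∀ i j : ℕ, i + j ≤ N → p ^ i ≠ δ * p ^ j) :
    connB p β δ (N + 1) 0 = (β * p ^ N - δ) / (p ^ N - δ) * connB p β δ N 0 := by
  have hpN : p ^ N ≠ 0 := pow_ne_zero _ hp
  have h₁ : poch δ p⁻¹ N ≠ 0 := poch_ne_zero fun i hi e => h i 0 (by omega) (by
    rw [inv_pow, inv_mul_eq_iff_eq_mul₀ (pow_ne_zero _ hp)] at e; simp [e])
  have h₂ : p ^ N - δ ≠ 0 := sub_ne_zero.2 (by simpa using h N 0 (by omega))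
  unfold connB
  simp only [gauss_zero_right, poch_zero, Nat.sub_zero, poch_succ, pow_zero, mul_one, inv_pow]
  have h₃ : 1 - (p ^ N)⁻¹ * δ ≠ 0 := by
    intro e; apply h₂; field_simp at e; simpa using e
  have e₃ : 1 - (p ^ N)⁻¹ * δ = (p ^ N - δ) / p ^ N := by field_simp
  rw [e₃]
  simp
  field_simp
  ring

theorem connB_succ_succ {p β δ : ℂ} (hp : p ≠ 0) (hβ : β ≠ 0) (N j : ℕ) (hj : j ≤ N)
    (h : ∀ i j : ℕ, i + j ≤ N → p ^ i ≠ δ * p ^ j) :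
    connB p β δ (N + 1) (j + 1) =
      (β * p ^ N - δ * p ^ (j + 1)) / (p ^ (N - (j + 1)) - δ * p ^ (j + 1)) *
        connB p β δ N (j + 1) +
      (p ^ (N - j) - β * p ^ N) / (p ^ (N - j) - δ * p ^ j) * connB p β δ N j := by
  have hz : ∀ i j : ℕ, i + j ≤ N → p ^ i - δ * p ^ j ≠ 0 := fun i j e => sub_ne_zero.2 (h i j e)
  have hi : ∀ i : ℕ, p ^ i ≠ 0 := fun i => pow_ne_zero _ hp
  rcases hj.lt_or_eq with hj | rfl
  · obtain ⟨m, rfl⟩ : ∃ m, N = j + 1 + m := ⟨N - (j + 1), by omega⟩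
    have e₁ := gauss_succ_succ p (j + 1 + m) j
    have e₂ := gauss_succ_succ' p j (m + 1)
    rw [show j + (m + 1) = j + 1 + m by omega] at e₂
    have hY : poch (δ * p ^ j) p⁻¹ m ≠ 0 := poch_ne_zero fun i hi' e => h i j (by omega) (by
      rw [inv_pow, inv_mul_eq_iff_eq_mul₀ (hi i)] at e; rw [e]; ring)
    have hV : poch (δ * p⁻¹ ^ m) p j ≠ 0 := poch_ne_zero fun i hi' e => h m i (by omega) (by
      have := hi m
      rw [inv_pow] at e; field_simp at e; rw [← e]; ring)
    have hW : poch (δ * p⁻¹ ^ (m + 1)) p j ≠ 0 :=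
      poch_ne_zero fun i hi' e => h (m + 1) i (by omega) (by
        have := hi (m + 1)
        rw [inv_pow] at e; field_simp at e; rw [← e]; ring)
    have d₁ : poch (δ * p ^ (j + 1)) p⁻¹ (m + 1) =
        (1 - δ * p ^ (j + 1)) * poch (δ * p ^ j) p⁻¹ m := by
      rw [poch_succ_left]; congr 2; rw [pow_succ]; field_simp
    have d₁' : poch (δ * p ^ (j + 1)) p⁻¹ m * (1 - p⁻¹ ^ m * (δ * p ^ (j + 1))) =
        (1 - δ * p ^ (j + 1)) * poch (δ * p ^ j) p⁻¹ m := by rw [← poch_succ, d₁]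
    have d₂ : poch (δ * p⁻¹ ^ (m + 1)) p (j + 1) =
        (1 - δ * p⁻¹ ^ (m + 1)) * poch (δ * p⁻¹ ^ m) p j := by
      rw [poch_succ_left]; congr 2; rw [pow_succ]; field_simp
    have d₂' : poch (δ * p⁻¹ ^ (m + 1)) p j * (1 - p ^ j * (δ * p⁻¹ ^ (m + 1))) =
        (1 - δ * p⁻¹ ^ (m + 1)) * poch (δ * p⁻¹ ^ m) p j := by rw [← poch_succ, d₂]
    have n₁ := hz 0 (j + 1) (by omega)
    have n₂ := hz m (j + 1) (by omega)
    have n₃ := hz (m + 1) 0 (by omega)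
    have n₄ := hz (m + 1) j (by omega)
    have n₅ := hz m j (by omega)
    have hU : poch (δ * p ^ (j + 1)) p⁻¹ m ≠ 0 := by
      intro e
      rw [e, zero_mul] at d₁'
      exact mul_ne_zero (by simpa using n₁) hY d₁'.symm
    have hM := hi m
    have hJ := hi j
    have E₁ : poch (δ * p ^ (j + 1)) p⁻¹ m =
        (1 - δ * p ^ (j + 1)) * poch (δ * p ^ j) p⁻¹ m * p ^ m / (p ^ m - δ * p ^ (j + 1)) := by
      rw [← d₁', inv_pow]; field_simp
    have E₂ : poch (δ * p⁻¹ ^ (m + 1)) p j =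
        (1 - δ * p⁻¹ ^ (m + 1)) * poch (δ * p⁻¹ ^ m) p j * p ^ (m + 1) /
          (p ^ (m + 1) - δ * p ^ j) := by
      rw [← d₂', inv_pow]; field_simp
    unfold connB
    rw [show j + 1 + m + 1 - (j + 1) = m + 1 by omega, show j + 1 + m - (j + 1) = m by omega,
      show j + 1 + m - j = m + 1 by omega, d₁, d₂, poch_succ (δ * p ^ j), E₁, E₂,
      poch_succ (δ * p⁻¹ ^ m), poch_succ (δ / β), poch_succ (1 / β), choose_succ_two]
    simp only [pow_add, pow_one, inv_pow, pow_zero, mul_one] at e₁ e₂ n₁ n₂ n₃ n₄ n₅ ⊢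
    generalize gauss p (j + 1 + m + 1) (j + 1) = G at *
    generalize gauss p (j + 1 + m) (j + 1) = G₁ at *
    generalize gauss p (j + 1 + m) j = G₂ at *
    generalize poch (δ * p ^ j) p⁻¹ m = Y at *
    rw [inv_pow] at hV
    generalize poch (δ * (p ^ m)⁻¹) p j = V at *
    clear d₁ d₁' d₂ d₂' E₁ E₂ hW hU hz h hi
    generalize poch (δ / β) p⁻¹ m = F at *
    generalize poch (1 / β) p⁻¹ j = H at *
    generalize p ^ j.choose 2 = Q at *
    generalize p ^ m = M at *
    generalize p ^ j = J at *
    have m₃ : 1 - δ * (M⁻¹ * p⁻¹) ≠ 0 := by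
      intro e; apply n₃; field_simp at e; linear_combination e
    have m₅ : 1 - M⁻¹ * (δ * J) ≠ 0 := by
      intro e; apply n₅; field_simp at e; linear_combination e
    have m₅' : 1 - J * (δ * M⁻¹) ≠ 0 := by
      intro e; apply n₅; field_simp at e; linear_combination e
    have key : G * (M - δ * J) = J * G₁ * (M * p - δ) + M * G₂ * (1 - δ * (J * p)) := by
      linear_combination M * e₁ - δ * J * e₂
    have r₃ : 1 - δ * (M⁻¹ * p⁻¹) = (M * p - δ) / (M * p) := by field_simp
    have r₅ : 1 - M⁻¹ * (δ * J) = (M - δ * J) / M := by field_simp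
    have r₅' : 1 - J * (δ * M⁻¹) = (M - δ * J) / M := by field_simp
    rw [r₃, r₅, r₅']
    generalize hT₁ : 1 - δ * (J * p) = T₁ at *
    generalize hT₂ : M - δ * (J * p) = T₂ at *
    generalize hT₃ : M * p - δ = T₃ at *
    generalize hT₄ : M * p - δ * J = T₄ at *
    generalize hT₅ : M - δ * J = T₅ at *
    field_simp
    linear_combination Q * F * H * (β * M + β * δ * J - β ^ 2 * M * J - δ) * key
  · have h₁ : poch δ p j ≠ 0 := poch_ne_zero fun i hi' e => h 0 i (by omega) (by
      rw [pow_zero, ← e]; ring)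
    have h₂ := hz 0 j (by omega)
    unfold connB
    rw [gauss_self, gauss_self, gauss_eq_zero p (Nat.lt_succ_self j), Nat.sub_self, Nat.sub_self,
      choose_succ_two]
    simp only [poch_zero, poch_succ, pow_zero, pow_add, inv_pow, one_mul, mul_one, pow_one] at h₂ ⊢
    have hJ := hi j
    have h₃ : 1 - p ^ j * δ ≠ 0 := by rwa [mul_comm]
    simp only [zero_mul, mul_zero, zero_div, zero_add]
    rw [mul_comm (p ^ j) δ] at *
    field_simp
    ring

/-- Here the last factor 1 - βp^N z is split off. In the j-th term it is written as a combination of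
1 - p^{N-j} z and 1 - δp^j z, the next factors of the two products; `h` says that these are never
proportional. -/
theorem poch_eq_sum_connB {p β δ : ℂ} (hp : p ≠ 0) (hβ : β ≠ 0) (z : ℂ) (N : ℕ)
    (h : ∀ i j : ℕ, i + j < N → p ^ i ≠ δ * p ^ j) :
    poch (β * z) p N = ∑ j ∈ range (N + 1),
      connB p β δ N j * (poch z p (N - j) * poch (δ * z) p j) := by
  induction N with
  | zero => simp [connB, poch_zero]
  | succ N ih =>
    have ih := ih fun i j e => h i j (by omega)
    have h' : ∀ i j : ℕ, i + j ≤ N → p ^ i ≠ δ * p ^ j := fun i j e => h i j (by omega)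
    rw [sum_range_of_recurrence
      (C₁ := fun j => (β * p ^ N - δ * p ^ j) / (p ^ (N - j) - δ * p ^ j) * connB p β δ N j)
      (C₂ := fun j => (p ^ (N - j) - β * p ^ N) / (p ^ (N - j) - δ * p ^ j) * connB p β δ N j)
      (fun j => poch z p (N + 1 - j) * poch (δ * z) p j)
      (by simpa using connB_succ_zero hp hβ N h')
      (fun j hj => connB_succ_succ hp hβ N j hj h')
      (by simp [connB, gauss_eq_zero p (Nat.lt_succ_self N)]), ← sum_add_distrib, poch_succ, ih,
      sum_mul]
    refine sum_congr rfl fun j hj => ?_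
    have hj' := mem_range.1 hj
    have n := sub_ne_zero.2 (h' (N - j) j (by omega))
    rw [show N + 1 - j = N - j + 1 by omega, Nat.add_sub_add_right, poch_succ z, poch_succ (δ * z)]
    field_simp
    ring

/-! ### Powers of q, and the explicit matrix entries as connection coefficients -/

theorem qpow_zero (τ : ℂ) : qpow τ 0 = 1 := by simp [qpow]

theorem qpow_add (τ a b : ℂ) : qpow τ (a + b) = qpow τ a * qpow τ b := by
  simp [qpow, mul_add, Complex.exp_add]

theorem qpow_ne_zero (τ a : ℂ) : qpow τ a ≠ 0 := Complex.exp_ne_zero _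

theorem qpow_neg (τ a : ℂ) : qpow τ (-a) = (qpow τ a)⁻¹ := by
  simp [qpow, Complex.exp_neg]

theorem qpow_sub (τ a b : ℂ) : qpow τ (a - b) = qpow τ a / qpow τ b := by
  rw [sub_eq_add_neg, qpow_add, qpow_neg, div_eq_mul_inv]

theorem qpow_nat_mul (τ a : ℂ) (n : ℕ) : qpow τ (n * a) = qpow τ a ^ n := by
  rw [qpow, qpow, ← Complex.exp_nat_mul]
  ring_nf

theorem qpow_mul_nat (τ a : ℂ) (n : ℕ) : qpow τ (a * n) = qpow τ a ^ n := by
  rw [mul_comm, qpow_nat_mul]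

theorem qpow_int_mul (τ a : ℂ) (n : ℤ) : qpow τ (n * a) = qpow τ a ^ n := by
  rw [qpow, qpow, ← Complex.exp_int_mul]
  ring_nf

/-- The same product read backwards: its last factor is the first one for the base c. -/
theorem poch_inv_base {c : ℂ} (hc : c ≠ 0) (x : ℂ) (m : ℕ) :
    poch x c⁻¹ m = poch (x * c / c ^ m) c m := by
  rcases m with _ | m
  · simp [poch_zero]
  unfold poch
  rw [← prod_range_reflect]
  refine prod_congr rfl fun i hi => ?_
  have := mem_range.1 hi
  rw [show m + 1 - 1 - i = m - i by omega]
  congr 1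
  have e : c ^ (m + 1) = c ^ i * c ^ (m - i) * c := by
    rw [← pow_add, ← pow_succ]; congr 1; omega
  rw [e, inv_pow]
  have := pow_ne_zero i hc
  have := pow_ne_zero (m - i) hc
  field_simp

theorem poch_inv {c x : ℂ} (hc : c ≠ 0) (hx : x ≠ 0) (m : ℕ) :
    poch x⁻¹ c⁻¹ m = (-1) ^ m * (x ^ m)⁻¹ * (c ^ m.choose 2)⁻¹ * poch x c m := by
  induction m with
  | zero => simp [poch_zero]
  | succ m ih =>
    rw [poch_succ, poch_succ, ih, choose_succ_two, pow_add, inv_pow]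
    have := pow_ne_zero m hc
    have := pow_ne_zero (m.choose 2) hc
    field_simp
    ring

theorem gauss_inv {p : ℂ} (hp : p ≠ 0) (s : ℕ) : ∀ k m : ℕ, s = k + m →
    gauss p⁻¹ s k * p ^ (k * m) = gauss p s k := by
  induction s with
  | zero =>
    intro k m h
    obtain ⟨rfl, rfl⟩ : k = 0 ∧ m = 0 := by omega
    simp
  | succ s ih =>
    intro k m h
    rcases k with _ | k
    · simp
    · rcases m with _ | m
      · obtain rfl : k = s := by omega
        simp [gauss_self]
      · have e₁ := ih (k + 1) m (by omega)
        have e₂ := ih k (m + 1) (by omega)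
        have e₃ := gauss_succ_succ' p k (m + 1)
        rw [← Nat.add_assoc k m 1, show k + m + 1 = s by omega, ← e₁, ← e₂] at e₃
        rw [gauss_succ_succ, e₃]
        have := pow_ne_zero k hp
        rw [inv_pow, show (k + 1) * (m + 1) = (k + 1) * m + (k + 1) by ring,
          show (k + 1) * m = k * m + m by ring, show k * (m + 1) = k * m + k by ring]
        simp only [pow_add, pow_one]
        field_simp

variable {n : ℕ} {τ β₁ β₂ γ x x₁ x₂ : ℂ}

theorem poch_self_ne_zero (h : ∀ k : ℕ, 1 ≤ k → k ≤ n → qpow τ (k * γ) ≠ 1) {m : ℕ} (hm : m ≤ n) :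
    poch (qpow τ γ) (qpow τ γ) m ≠ 0 :=
  poch_ne_zero fun i hi e => h (i + 1) (by omega) (by omega) (by
    rw [qpow_nat_mul, pow_succ, e])

theorem qbinom_left (h : ∀ k : ℕ, 1 ≤ k → k ≤ n → qpow τ (k * γ) ≠ 1) {k m : ℕ} (hm : k + m ≤ n) :
    qbinom τ γ (k + m) k = gauss (qpow τ γ) (k + m) k := by
  have h₁ := poch_self_ne_zero h (m := k) (by omega)
  have h₂ := poch_self_ne_zero h (m := m) (by omega)
  rw [qbinom, ← gauss_mul_poch, Nat.add_sub_cancel_left]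
  field_simp

theorem qbinom_right (h : ∀ k : ℕ, 1 ≤ k → k ≤ n → qpow τ (k * γ) ≠ 1) {k m : ℕ} (hm : k + m ≤ n) :
    qbinom τ γ (k + m) m = gauss (qpow τ γ) (k + m) k := by
  have h₁ := poch_self_ne_zero h (m := k) (by omega)
  have h₂ := poch_self_ne_zero h (m := m) (by omega)
  rw [qbinom, ← gauss_mul_poch, Nat.add_sub_cancel]
  field_simp

/-- The half in the exponents of the entries is harmless: (2r + j - 1)j/2 is the integer rj +
j(j-1)/2. -/
theorem qpow_half (τ γ : ℂ) (r j : ℕ) :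
    qpow τ (-((j : ℂ) * (2 * r + j - 1) * γ / 2)) =
      (qpow τ γ ^ (r * j) * qpow τ γ ^ j.choose 2)⁻¹ := by
  rw [← pow_add, ← qpow_nat_mul, ← qpow_neg]
  congr 1
  push_cast [Nat.cast_choose_two]
  ring

/-- The factor in front of `connA` depends on the column r + j only, since i = n - (r + j). It is a
diagonal rescaling, cancelled in the product by the one in `dR_mul_lR_eq`. Writing the indices as r,
r + j, r + j + i removes truncated subtraction. -/
theorem uR_eq (h : ∀ k : ℕ, 1 ≤ k → k ≤ n → qpow τ (k * γ) ≠ 1) (hx : x ≠ 0) {i r j : ℕ}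
    (hn : n = r + j + i)
    (hα : poch (x / qpow τ β₂) (qpow τ γ)⁻¹ (r + j) ≠ 0)
    (hδ : poch (x * qpow τ β₁ / qpow τ β₂ * qpow τ γ ^ i) (qpow τ γ)⁻¹ (r + j) ≠ 0) :
    uR n τ β₁ β₂ γ x r (r + j) =
      poch (x / qpow τ β₂) (qpow τ γ)⁻¹ (r + j) /
        poch (x * qpow τ β₁ / qpow τ β₂ * qpow τ γ ^ i) (qpow τ γ)⁻¹ (r + j) *
      connA (qpow τ γ)⁻¹ (x / qpow τ β₂) (r + j) r
        (x * qpow τ β₁ / qpow τ β₂ * qpow τ γ ^ i) := by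
  have hg := qpow_ne_zero τ γ
  have hb₁ := qpow_ne_zero τ β₁
  have hb₂ := qpow_ne_zero τ β₂
  subst hn
  have a₁ : qpow τ (-((((r + j : ℕ) : ℂ) - r) * (((r + j : ℕ) : ℂ) + r - 1) * γ / 2)) =
      (qpow τ γ ^ (r * j) * qpow τ γ ^ j.choose 2)⁻¹ := by
    rw [← qpow_half]; congr 1; push_cast; ring
  have a₂ : qpow τ (β₁ + (((r + j + i : ℕ) : ℂ) - ((r + j : ℕ) : ℂ)) * γ) =
      qpow τ β₁ * qpow τ γ ^ i := by
    rw [← qpow_nat_mul, ← qpow_add]; congr 1; push_cast; ring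
  have a₃ : x * qpow τ (β₁ - β₂ + (((r + j + i : ℕ) : ℂ) - 2 * ((r + j : ℕ) : ℂ) + 1) * γ) =
      (qpow τ γ)⁻¹ ^ r * (x * qpow τ β₁ / qpow τ β₂ * qpow τ γ ^ i) * qpow τ γ / qpow τ γ ^ j := by
    rw [show β₁ - β₂ + (((r + j + i : ℕ) : ℂ) - 2 * ((r + j : ℕ) : ℂ) + 1) * γ =
      β₁ - β₂ + i * γ + γ - r * γ - j * γ by push_cast; ring]
    simp only [qpow_add, qpow_sub, qpow_nat_mul, inv_pow]
    field_simp
  unfold uR connA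
  rw [a₁, a₂, a₃, Nat.add_sub_cancel_left, qbinom_left h (by omega), ← gauss_inv hg _ r j rfl,
    ← poch_inv_base hg, qpow_neg, inv_inv]
  rw [poch_add (_ * qpow τ γ ^ i)] at hδ ⊢
  have hd₁ := left_ne_zero_of_mul hδ
  have hd₂ := right_ne_zero_of_mul hδ
  have e : x * qpow τ β₁ / qpow τ β₂ * qpow τ γ ^ i / (x / qpow τ β₂) =
      qpow τ β₁ * qpow τ γ ^ i := by field_simp
  rw [e]
  simp only [inv_pow] at *
  generalize poch (x / qpow τ β₂) (qpow τ γ)⁻¹ (r + j) = A₁ at *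
  generalize poch (x * qpow τ β₁ / qpow τ β₂ * qpow τ γ ^ i) (qpow τ γ)⁻¹ r = A₂ at *
  generalize poch ((qpow τ γ ^ r)⁻¹ * (x * qpow τ β₁ / qpow τ β₂ * qpow τ γ ^ i))
    (qpow τ γ)⁻¹ j = A₃ at *
  have := pow_ne_zero (r * j) hg
  have := pow_ne_zero (j.choose 2) hg
  have := pow_ne_zero j hb₂
  field_simp
  rw [neg_pow (x / qpow τ β₂)]
  ring

/-- The left factor is the column rescaling of `uR_eq` for the middle index k = s + j, so the k-th
term of U_R D_R L_R is a product of a `connA` and a `connB`. -/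
theorem dR_mul_lR_eq (h : ∀ k : ℕ, 1 ≤ k → k ≤ n → qpow τ (k * γ) ≠ 1) (hx : x ≠ 0) {i s j : ℕ}
    (hn : n = s + j + i)
    (hα : poch (x / qpow τ β₂) (qpow τ γ)⁻¹ (s + j) ≠ 0)
    (hδ : poch (x * qpow τ β₁ / qpow τ β₂ * qpow τ γ ^ i) (qpow τ γ)⁻¹ (s + j) ≠ 0) :
    poch (x / qpow τ β₂) (qpow τ γ)⁻¹ (s + j) /
        poch (x * qpow τ β₁ / qpow τ β₂ * qpow τ γ ^ i) (qpow τ γ)⁻¹ (s + j) *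
      (dR n τ β₁ β₂ γ x (s + j) * lR n τ β₁ β₂ γ x (s + j) s) =
      connB (qpow τ γ)⁻¹ ((qpow τ γ)⁻¹ ^ s / qpow τ β₂)
        (x * qpow τ β₁ / qpow τ β₂ * (qpow τ γ)⁻¹ ^ s) (i + j) j := by
  have hg := qpow_ne_zero τ γ
  have hb₁ := qpow_ne_zero τ β₁
  have hb₂ := qpow_ne_zero τ β₂
  subst hn
  have a₁ : qpow τ (-((((s + j : ℕ) : ℂ) - s) * (((s + j : ℕ) : ℂ) + s - 1) * γ / 2)) =
      (qpow τ γ ^ (s * j) * qpow τ γ ^ j.choose 2)⁻¹ := by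
    rw [← qpow_half]; congr 1; push_cast; ring
  have a₂ : qpow τ (-((((s + j + i : ℕ) : ℂ) - ((s + j : ℕ) : ℂ)) * β₂) -
      ((s + j : ℕ) : ℂ) * (((s + j + i : ℕ) : ℂ) - ((s + j : ℕ) : ℂ)) * γ) =
      (qpow τ β₂ ^ i)⁻¹ * (qpow τ γ ^ (s * i) * qpow τ γ ^ (j * i))⁻¹ := by
    rw [← pow_add, ← qpow_nat_mul, ← qpow_nat_mul, ← qpow_neg, ← qpow_neg, ← qpow_add]
    congr 1; push_cast; ring
  have a₃ : x * qpow τ (β₁ - β₂ + (((s + j + i : ℕ) : ℂ) - 2 * ((s + j : ℕ) : ℂ) + 1) * γ) =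
      (x * qpow τ β₁ / qpow τ β₂ * qpow τ γ ^ i) * qpow τ γ / qpow τ γ ^ (s + j) := by
    rw [show β₁ - β₂ + (((s + j + i : ℕ) : ℂ) - 2 * ((s + j : ℕ) : ℂ) + 1) * γ =
      β₁ - β₂ + i * γ + γ - (s + j : ℕ) * γ by push_cast; ring]
    simp only [qpow_add, qpow_sub, qpow_nat_mul]
    field_simp
  have a₄ : x * qpow τ (-β₂ - (((s + j : ℕ) : ℂ) - 1) * γ) =
      (x / qpow τ β₂) * qpow τ γ / qpow τ γ ^ (s + j) := by
    rw [show -β₂ - (((s + j : ℕ) : ℂ) - 1) * γ = γ - β₂ - (s + j : ℕ) * γ by ring]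
    simp only [qpow_sub, qpow_nat_mul]
    field_simp
  have a₅ : x * qpow τ (β₁ - β₂ - ((s + j : ℕ) : ℂ) * γ) =
      x * qpow τ β₁ / qpow τ β₂ * (qpow τ γ)⁻¹ ^ s * (qpow τ γ)⁻¹ ^ j := by
    simp only [qpow_sub, qpow_nat_mul, inv_pow, pow_add]
    field_simp
  have a₆ : qpow τ (β₂ * ((s : ℂ) - ((s + j : ℕ) : ℂ))) = (qpow τ β₂ ^ j)⁻¹ := by
    rw [← qpow_nat_mul, ← qpow_neg]; congr 1; push_cast; ring
  have a₇ : qpow τ (β₂ + s * γ) = qpow τ β₂ * qpow τ γ ^ s := by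
    rw [qpow_add, qpow_nat_mul]
  have e₁ : x * qpow τ β₁ / qpow τ β₂ * qpow τ γ ^ i * qpow τ γ / qpow τ γ ^ (s + j) =
      x * qpow τ β₁ / qpow τ β₂ * (qpow τ γ)⁻¹ ^ s * qpow τ γ ^ i * qpow τ γ / qpow τ γ ^ j := by
    rw [inv_pow, pow_add]; field_simp
  have b₁ : x * qpow τ β₁ / qpow τ β₂ * (qpow τ γ)⁻¹ ^ s / ((qpow τ γ)⁻¹ ^ s / qpow τ β₂) =
      x * qpow τ β₁ := by field_simp
  have b₂ : 1 / ((qpow τ γ)⁻¹ ^ s / qpow τ β₂) = qpow τ β₂ * qpow τ γ ^ s := by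
    rw [inv_pow]; field_simp
  rw [poch_inv_base hg] at hα hδ
  rw [poch_inv_base hg (x / qpow τ β₂), poch_inv_base hg (_ * qpow τ γ ^ i)]
  unfold dR lR connB
  rw [a₁, a₂, a₃, a₄, a₅, a₆, a₇, b₁, b₂, Nat.add_sub_cancel_left, Nat.add_sub_cancel_left,
    Nat.add_sub_cancel, inv_inv,
    show s + j + i - s = j + i by omega, qbinom_right h (by omega), ← gauss_inv hg _ j i rfl,
    poch_inv_base hg (_ * qpow τ γ ^ i) j, add_comm i j]
  generalize hA₁ : poch (x / qpow τ β₂ * qpow τ γ / qpow τ γ ^ (s + j)) (qpow τ γ) (s + j) = A₁ at *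
  generalize hA₂ : poch (x * qpow τ β₁ / qpow τ β₂ * qpow τ γ ^ i * qpow τ γ / qpow τ γ ^ (s + j))
    (qpow τ γ) (s + j) = A₂ at *
  rw [e₁]
  generalize poch (x * qpow τ β₁ / qpow τ β₂ * (qpow τ γ)⁻¹ ^ s * qpow τ γ ^ i * qpow τ γ /
    qpow τ γ ^ j) (qpow τ γ) j = A₃ at *
  generalize poch (x * qpow τ β₁ / qpow τ β₂ * (qpow τ γ)⁻¹ ^ s * (qpow τ γ)⁻¹ ^ j)
    (qpow τ γ) i = A₄ at *
  have f₁ : A₁ / A₂ * (A₂ / A₁) = 1 := by field_simp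
  have := pow_ne_zero (s * j) hg
  have := pow_ne_zero (s * i) hg
  have := pow_ne_zero (j * i) hg
  have := pow_ne_zero (j.choose 2) hg
  have := pow_ne_zero j hb₂
  have e₃ : ((qpow τ γ)⁻¹ ^ s / qpow τ β₂) ^ (j + i) =
      (qpow τ γ ^ (s * j))⁻¹ * (qpow τ γ ^ (s * i))⁻¹ * (qpow τ β₂ ^ j)⁻¹ * (qpow τ β₂ ^ i)⁻¹ := by
    rw [div_pow, ← pow_mul, mul_add, pow_add, pow_add, inv_pow, inv_pow]
    field_simp
  rw [e₃]
  simp only [inv_pow]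
  field_simp

/-- Counterpart of `uR_eq` for the base q^γ. The indices of `connA` are the reversed ones, n - k = i
+ j and n - (k + j) = i, which is why a lower triangular matrix results. -/
theorem lR'_eq (h : ∀ k : ℕ, 1 ≤ k → k ≤ n → qpow τ (k * γ) ≠ 1) (hx : x ≠ 0) {i k j : ℕ}
    (hn : n = k + j + i)
    (hα : poch (qpow τ β₂ / x) (qpow τ γ) (i + j) ≠ 0)
    (hδ : poch ((qpow τ γ)⁻¹ ^ k / x) (qpow τ γ) (i + j) ≠ 0) :
    lR' n τ β₂ γ x (k + j) k =
      poch (qpow τ β₂ / x) (qpow τ γ) (i + j) / poch ((qpow τ γ)⁻¹ ^ k / x) (qpow τ γ) (i + j) *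
      connA (qpow τ γ) (qpow τ β₂ / x) (i + j) i ((qpow τ γ)⁻¹ ^ k / x) := by
  have hg := qpow_ne_zero τ γ
  have hb₂ := qpow_ne_zero τ β₂
  subst hn
  have a₁ : qpow τ (-((((k + j : ℕ) : ℂ) - k) *
      (2 * ((k + j + i : ℕ) : ℂ) - ((k + j : ℕ) : ℂ) - k - 1) * γ / 2)) =
      (qpow τ γ ^ (i * j) * qpow τ γ ^ j.choose 2)⁻¹ := by
    rw [← qpow_half]; congr 1; push_cast; ring
  have a₂ : qpow τ (β₂ + k * γ) = qpow τ β₂ * qpow τ γ ^ k := by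
    rw [qpow_add, qpow_nat_mul]
  have a₃ : x * qpow τ (-((((k + j + i : ℕ) : ℂ) - 2 * k - 1) * γ)) =
      x * qpow τ γ ^ k / qpow τ γ ^ i * qpow τ γ / qpow τ γ ^ j := by
    rw [show -((((k + j + i : ℕ) : ℂ) - 2 * k - 1) * γ) = k * γ - i * γ + γ - j * γ by
      push_cast; ring]
    simp only [qpow_add, qpow_sub, qpow_nat_mul]
    field_simp
  have b₁ : (qpow τ γ)⁻¹ ^ k / x / (qpow τ β₂ / x) = (qpow τ β₂ * qpow τ γ ^ k)⁻¹ := by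
    rw [inv_pow]; field_simp
  have b₂ : qpow τ γ ^ i * ((qpow τ γ)⁻¹ ^ k / x) = (x * qpow τ γ ^ k / qpow τ γ ^ i)⁻¹ := by
    rw [inv_pow]; field_simp
  have hgk := pow_ne_zero k hg
  have hgi := pow_ne_zero i hg
  unfold lR' connA
  rw [a₁, a₂, a₃, b₁, Nat.add_sub_cancel_left, Nat.add_sub_cancel_left,
    Nat.add_sub_cancel_left, show k + j + i - k = i + j by omega,
    qbinom_left h (by omega), ← poch_inv_base hg, poch_inv hg (mul_ne_zero hb₂ hgk)]
  rw [poch_add (_ ^ k / x) _ i j, b₂] at hδ ⊢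
  have c₁ := poch_inv (c := (qpow τ γ)⁻¹) (inv_ne_zero hg)
    (x := x * qpow τ γ ^ k / qpow τ γ ^ i) (by positivity) j
  rw [inv_inv] at c₁
  have hd₁ := left_ne_zero_of_mul hδ
  have hd₂ := right_ne_zero_of_mul hδ
  rw [c₁] at hd₂ ⊢
  have hd₃ := right_ne_zero_of_mul hd₂
  simp only [inv_pow] at *
  generalize poch (qpow τ β₂ / x) (qpow τ γ) (i + j) = A₁ at *
  generalize poch ((qpow τ γ ^ k)⁻¹ / x) (qpow τ γ) i = A₂ at *
  generalize poch (x * qpow τ γ ^ k / qpow τ γ ^ i) (qpow τ γ)⁻¹ j = A₃ at *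
  have := pow_ne_zero (i * j) hg
  have := pow_ne_zero (j.choose 2) hg
  have := pow_ne_zero j hb₂
  have := pow_ne_zero j hx
  rw [← neg_div, div_pow, neg_pow, div_pow, mul_pow, mul_pow, ← pow_mul, ← pow_mul]
  have m₁ : ((-1 : ℂ) ^ j) * (-1) ^ j = 1 := by rw [← mul_pow]; simp
  have m₂ : ((-1 : ℂ) ^ j) ≠ 0 := pow_ne_zero _ (by norm_num)
  field_simp
  rw [one_pow, neg_pow (qpow τ β₂)]
  ring

/-- Counterpart of `dR_mul_lR_eq`; its left factor is the rescaling of the column k in `lR'_eq`. -/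
theorem dR'_mul_uR'_eq (h : ∀ k : ℕ, 1 ≤ k → k ≤ n → qpow τ (k * γ) ≠ 1) (hx : x ≠ 0) {i k j : ℕ}
    (hn : n = k + j + i)
    (hα : poch (qpow τ β₂ / x) (qpow τ γ) (i + j) ≠ 0)
    (hδ : poch ((qpow τ γ)⁻¹ ^ k / x) (qpow τ γ) (i + j) ≠ 0) :
    poch (qpow τ β₂ / x) (qpow τ γ) (i + j) / poch ((qpow τ γ)⁻¹ ^ k / x) (qpow τ γ) (i + j) *
      (dR' n τ β₁ β₂ γ x k * uR' n τ β₁ γ x k (k + j)) =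
      connB (qpow τ γ) (qpow τ β₁ * qpow τ γ ^ i) (qpow τ γ ^ i / x) (k + j) j := by
  have hg := qpow_ne_zero τ γ
  have hb₁ := qpow_ne_zero τ β₁
  have hb₂ := qpow_ne_zero τ β₂
  subst hn
  have hgk := pow_ne_zero k hg
  have hgi := pow_ne_zero i hg
  have hgj := pow_ne_zero j hg
  have hgij := pow_ne_zero (i + j) hg
  have a₁ : qpow τ (-((((k + j : ℕ) : ℂ) - k) * k * γ)) = (qpow τ γ ^ (k * j))⁻¹ := by
    rw [← qpow_nat_mul, ← qpow_neg]; congr 1; push_cast; ring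
  have a₂ : qpow τ (-((((k + j + i : ℕ) : ℂ) - k) * (β₂ + k * γ))) =
      (qpow τ β₂ ^ (i + j))⁻¹ * (qpow τ γ ^ (k * (i + j)))⁻¹ := by
    rw [← qpow_nat_mul, ← qpow_nat_mul, ← qpow_neg, ← qpow_neg, ← qpow_add]
    congr 1; push_cast; ring
  have a₃ : x * qpow τ (-β₂ - (((k + j + i : ℕ) : ℂ) - k - 1) * γ) =
      (x / qpow τ β₂) * qpow τ γ / qpow τ γ ^ (i + j) := by
    rw [show -β₂ - (((k + j + i : ℕ) : ℂ) - k - 1) * γ = γ - β₂ - (i + j : ℕ) * γ by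
      push_cast; ring]
    simp only [qpow_sub, qpow_nat_mul]
    field_simp
  have a₄ : x * qpow τ (-((((k + j + i : ℕ) : ℂ) - 2 * k - 1) * γ)) =
      x * qpow τ γ ^ k * qpow τ γ / qpow τ γ ^ (i + j) := by
    rw [show -((((k + j + i : ℕ) : ℂ) - 2 * k - 1) * γ) = k * γ + γ - (i + j : ℕ) * γ by
      push_cast; ring]
    simp only [qpow_add, qpow_sub, qpow_nat_mul]
    field_simp
  have a₅ : x * qpow τ (-((((k + j + i : ℕ) : ℂ) - k) * γ)) = x / qpow τ γ ^ (i + j) := by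
    rw [show -((((k + j + i : ℕ) : ℂ) - k) * γ) = -((i + j : ℕ) * γ) by push_cast; ring]
    rw [qpow_neg, qpow_nat_mul, div_eq_mul_inv]
  have a₆ : qpow τ (β₁ + (((k + j + i : ℕ) : ℂ) - ((k + j : ℕ) : ℂ)) * γ) =
      qpow τ β₁ * qpow τ γ ^ i := by
    rw [← qpow_nat_mul, ← qpow_add]; congr 1; push_cast; ring
  have a₇ : x⁻¹ * qpow τ ((((k + j + i : ℕ) : ℂ) - k - ((k + j : ℕ) : ℂ)) * γ) =
      qpow τ γ ^ i / x * (qpow τ γ)⁻¹ ^ k := by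
    rw [show (((k + j + i : ℕ) : ℂ) - k - ((k + j : ℕ) : ℂ)) * γ = i * γ - k * γ by push_cast; ring]
    simp only [qpow_sub, qpow_nat_mul, inv_pow]
    field_simp
  have b₁ : qpow τ γ ^ i / x / (qpow τ β₁ * qpow τ γ ^ i) = (x * qpow τ β₁)⁻¹ := by
    field_simp
  have b₂ : qpow τ γ ^ i / x * qpow τ γ ^ j = (x / qpow τ γ ^ (i + j))⁻¹ := by
    rw [pow_add]; field_simp
  have c₁ := poch_inv (c := (qpow τ γ)⁻¹) (inv_ne_zero hg) (x := x / qpow τ β₂)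
    (div_ne_zero hx hb₂) (i + j)
  have c₂ := poch_inv (c := (qpow τ γ)⁻¹) (inv_ne_zero hg) (x := x * qpow τ γ ^ k)
    (mul_ne_zero hx hgk) (i + j)
  rw [inv_inv, inv_div] at c₁
  rw [inv_inv, show (x * qpow τ γ ^ k)⁻¹ = (qpow τ γ)⁻¹ ^ k / x by
    rw [inv_pow]; field_simp] at c₂
  rw [c₁] at hα
  rw [c₂] at hδ
  have hα' := right_ne_zero_of_mul hα
  have hδ' := right_ne_zero_of_mul hδ
  rw [c₁, c₂]
  unfold dR' uR' connB
  rw [a₁, a₂, a₃, a₄, a₅, a₆, a₇, b₁, b₂, Nat.add_sub_cancel_left,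
    Nat.add_sub_cancel, show k + j + i - k = i + j by omega, add_comm k j,
    qbinom_right h (by omega), poch_inv hg (mul_ne_zero hx hb₁),
    one_div (qpow τ β₁ * qpow τ γ ^ i), poch_inv hg (mul_ne_zero hb₁ hgi),
    poch_inv hg (div_ne_zero hx hgij), ← poch_inv_base hg, ← poch_inv_base hg]
  simp only [inv_pow] at *
  generalize poch (x / qpow τ β₂) (qpow τ γ)⁻¹ (i + j) = A₁ at *
  generalize poch (x * qpow τ γ ^ k) (qpow τ γ)⁻¹ (i + j) = A₂ at *
  generalize poch (x / qpow τ γ ^ (i + j)) (qpow τ γ) k = A₃ at *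
  generalize poch (qpow τ γ ^ i / x * (qpow τ γ ^ k)⁻¹) (qpow τ γ) j = A₄ at *
  have := pow_ne_zero (k * j) hg
  have := pow_ne_zero (k * i) hg
  have := pow_ne_zero (j.choose 2) hg
  have := pow_ne_zero (k.choose 2) hg
  have := pow_ne_zero ((i + j).choose 2) hg
  have := pow_ne_zero j hb₂
  have m₁ : ((-1 : ℂ) ^ j) * (-1) ^ j = 1 := by rw [← mul_pow]; simp
  have m₂ : ((-1 : ℂ) ^ j) ≠ 0 := pow_ne_zero _ (by norm_num)
  have m₃ : ((-1 : ℂ) ^ k) ≠ 0 := pow_ne_zero _ (by norm_num)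
  have m₄ : ((-1 : ℂ) ^ (i + j)) ≠ 0 := pow_ne_zero _ (by norm_num)
  rw [div_pow, div_pow, mul_pow, mul_pow, mul_pow, mul_pow, pow_add (qpow τ β₁),
    pow_add (qpow τ γ ^ i)]
  simp only [← pow_mul]
  rw [show (i + j) * k = k * i + k * j by ring, show k * (i + j) = k * i + k * j by ring,
    mul_comm i k, pow_add (qpow τ γ) (k * i)]
  have := pow_ne_zero (i * j) hg
  field_simp
  rw [pow_two, m₁, mul_one]

/-! ### The two families of polynomials in one variable and the transition between them -/

/-- `∏_{i < n - s} (1 - c p^i z) ∏_{n - s ≤ i < n} (1 - a p^i z)`. -/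
def phiPoly (p a c : ℂ) (n s : ℕ) (z : ℂ) : ℂ :=
  poch (c * z) p (n - s) * poch (a * p ^ (n - s) * z) p s

/-- `∏_{i < s} (1 - d p^i z) ∏_{s ≤ i < n} (1 - b p^i z)`. -/
def psiPoly (p b d : ℂ) (n s : ℕ) (z : ℂ) : ℂ :=
  poch (d * z) p s * poch (b * p ^ s * z) p (n - s)

section connection

variable {p a b c d : ℂ} {n : ℕ}

/-- The factor (cz;p)_{n-k} is common to both sides; the other one is expanded by
`poch_eq_sum_connA` in the variable cp^{n-k}z. -/
theorem mul_poch_eq_sum_phiPoly (hp : p ≠ 0) (ha : a ≠ 0) (hc : c ≠ 0)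
    (hA : poch (a / c) p n ≠ 0) {k : ℕ} (hk : k ≤ n) (z : ℂ) :
    poch (c * z) p (n - k) * poch (d * z) p k = ∑ r ∈ range (n + 1),
      (if r ≤ k then connA p (a / c) k r (d / c * p⁻¹ ^ (n - k)) else 0) * phiPoly p a c n r z := by
  have hA' : poch (a / c) p k ≠ 0 := by
    obtain ⟨m, rfl⟩ := Nat.exists_eq_add_of_le hk
    rw [poch_add] at hA
    exact left_ne_zero_of_mul hA
  have hpn := pow_ne_zero (n - k) hp
  have e := poch_eq_sum_connA hp (div_ne_zero ha hc) k hA' (d / c * p⁻¹ ^ (n - k))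
    (c * p ^ (n - k) * z)
  rw [show d / c * p⁻¹ ^ (n - k) * (c * p ^ (n - k) * z) = d * z by
    rw [inv_pow]; field_simp] at e
  rw [e, mul_sum]
  simp only [ite_mul, zero_mul]
  rw [← sum_filter]
  have hf : (range (n + 1)).filter (fun r => r ≤ k) = range (k + 1) := by
    ext r; simp only [mem_filter, mem_range]; omega
  rw [hf]
  refine sum_congr rfl fun r hr => ?_
  have hr' := mem_range.1 hr
  rw [phiPoly, show n - r = n - k + (k - r) by omega, poch_add,
    show a / c * p ^ (k - r) * (c * p ^ (n - k) * z) = a * p ^ (n - k + (k - r)) * z by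
      rw [pow_add]; field_simp,
    show c * p ^ (n - k) * z = p ^ (n - k) * (c * z) by ring]
  ring

/-- The factor (dz;p)_s is common to both sides; the other one is expanded by `poch_eq_sum_connB` in
the variable cz. -/
theorem psiPoly_eq_sum_mul_poch (hp : p ≠ 0) (hb : b ≠ 0) (hc : c ≠ 0)
    {s : ℕ}
    (hBs : ∀ i j : ℕ, i + j < n - s → p ^ i ≠ d / c * p ^ s * p ^ j) (hs : s ≤ n) (z : ℂ) :
    psiPoly p b d n s z = ∑ k ∈ range (n + 1),
      (if s ≤ k then connB p (b / c * p ^ s) (d / c * p ^ s) (n - s) (k - s) else 0) *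
        (poch (c * z) p (n - k) * poch (d * z) p k) := by
  have e := poch_eq_sum_connB hp (β := b / c * p ^ s) (δ := d / c * p ^ s)
    (mul_ne_zero (div_ne_zero hb hc) (pow_ne_zero _ hp)) (c * z) (n - s) hBs
  rw [psiPoly, show b * p ^ s * z = b / c * p ^ s * (c * z) by field_simp, e, mul_sum]
  simp only [ite_mul, zero_mul]
  rw [← sum_filter]
  have hf : (range (n + 1)).filter (fun k => s ≤ k) = Ico s (n + 1) := by
    ext r; simp only [mem_filter, mem_range, mem_Ico]; omega
  rw [hf, sum_Ico_eq_sum_range, show n + 1 - s = n - s + 1 by omega]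
  refine sum_congr rfl fun j hj => ?_
  have hj' := mem_range.1 hj
  rw [Nat.add_sub_cancel_left, show n - (s + j) = n - s - j by omega, poch_add,
    show d / c * p ^ s * (c * z) = p ^ s * (d * z) by field_simp]
  ring

theorem psiPoly_eq_sum (hp : p ≠ 0) (ha : a ≠ 0) (hb : b ≠ 0) (hc : c ≠ 0)
    (hA : poch (a / c) p n ≠ 0) {s : ℕ}
    (hBs : ∀ i j : ℕ, i + j < n - s → p ^ i ≠ d / c * p ^ s * p ^ j) (hs : s ≤ n) (z : ℂ) :
    psiPoly p b d n s z = ∑ r ∈ range (n + 1), phiPoly p a c n r z * ∑ k ∈ range (n + 1),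
      (if r ≤ k then connA p (a / c) k r (d / c * p⁻¹ ^ (n - k)) else 0) *
      (if s ≤ k then connB p (b / c * p ^ s) (d / c * p ^ s) (n - s) (k - s) else 0) := by
  rw [psiPoly_eq_sum_mul_poch hp hb hc hBs hs z]
  simp only [mul_sum]
  rw [sum_comm]
  refine sum_congr rfl fun k hk => ?_
  rw [mul_poch_eq_sum_phiPoly hp ha hc hA (by have := mem_range.1 hk; omega) z, mul_sum]
  refine sum_congr rfl fun r _ => ?_
  ring

/-- Reading the linear factors backwards exchanges the two blocks, hence a with c and s with n - s.
This is what makes the second Gauss decomposition an instance of the first. -/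
theorem phiPoly_inv (hp : p ≠ 0) {s : ℕ} (hs : s ≤ n) (z : ℂ) :
    phiPoly p⁻¹ a c n s z = phiPoly p (c * p / p ^ n) (a * p / p ^ n) n (n - s) z := by
  obtain ⟨m, rfl⟩ := Nat.exists_eq_add_of_le hs
  have := pow_ne_zero s hp
  have := pow_ne_zero m hp
  rw [phiPoly, phiPoly, poch_inv_base hp, poch_inv_base hp, mul_comm,
    Nat.add_sub_cancel_left, Nat.add_sub_cancel]
  congr 2
  · rw [pow_add, inv_pow]; field_simp
  · rw [pow_add]; field_simp

theorem psiPoly_inv (hp : p ≠ 0) {s : ℕ} (hs : s ≤ n) (z : ℂ) :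
    psiPoly p⁻¹ b d n s z = psiPoly p (d * p / p ^ n) (b * p / p ^ n) n (n - s) z := by
  obtain ⟨m, rfl⟩ := Nat.exists_eq_add_of_le hs
  have := pow_ne_zero s hp
  have := pow_ne_zero m hp
  rw [psiPoly, psiPoly, poch_inv_base hp, poch_inv_base hp, mul_comm,
    Nat.add_sub_cancel_left, Nat.add_sub_cancel]
  congr 2
  · rw [pow_add, inv_pow]; field_simp
  · rw [pow_add]; field_simp

/-- Triangularity of evaluations: z = p^{-i}/c is a root of every member with r < n - i but not of
the one with r = n - i, while the coefficients with r > n - i are already known to vanish. -/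
theorem phiPoly_linearIndependent (hp : p ≠ 0) (hp' : ∀ k : ℕ, 1 ≤ k → k ≤ n → p ^ k ≠ 1)
    (hc : c ≠ 0) (hA : poch (a / c) p n ≠ 0) (v : ℕ → ℂ)
    (h : ∀ z, ∑ r ∈ range (n + 1), phiPoly p a c n r z * v r = 0) :
    ∀ i ≤ n, v (n - i) = 0 := by
  intro i
  induction i using Nat.strong_induction_on with
  | _ i ih =>
    intro hi
    have hpi := pow_ne_zero i hp
    have e := h ((p ^ i)⁻¹ / c)
    rw [sum_eq_single (n - i)] at e
    · refine (mul_eq_zero.1 e).resolve_left ?_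
      rw [phiPoly, Nat.sub_sub_self hi, show c * ((p ^ i)⁻¹ / c) = (p ^ i)⁻¹ by field_simp,
        show a * p ^ i * ((p ^ i)⁻¹ / c) = a / c by field_simp]
      refine mul_ne_zero (poch_ne_zero fun l hl e => ?_) ?_
      · refine hp' (i - l) (by omega) (by omega) ?_
        have : p ^ i = p ^ (i - l) * p ^ l := by rw [← pow_add]; congr 1; omega
        rw [this] at e
        have := pow_ne_zero l hp
        have := pow_ne_zero (i - l) hp
        field_simp at e
        exact e.symm
      · rw [show n = (n - i) + i by omega, poch_add] at hA
        exact left_ne_zero_of_mul hA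
    · intro r hr hne
      have hr' := mem_range.1 hr
      rcases lt_or_gt_of_ne hne with hlt | hgt
      · have : poch (c * ((p ^ i)⁻¹ / c)) p (n - r) = 0 := by
          refine prod_eq_zero (mem_range.2 (show i < n - r by omega)) ?_
          field_simp
          simp
        rw [phiPoly, this]
        simp
      · have := ih (n - r) (by omega) (by omega)
        rw [Nat.sub_sub_self (by omega)] at this
        rw [this, mul_zero]
    · intro hne
      exact absurd (mem_range.2 (by omega)) hne

end connection

/-! ### The two Gauss decompositions of the transition matrix -/

section decomposition

variable {n : ℕ} {τ β₁ β₂ γ x₁ x₂ : ℂ}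

theorem poch_alpha_ne_zero (hden : DenominatorsNonzero n τ β₁ β₂ γ x₁ x₂) {m : ℕ} (hm : m ≤ n) :
    poch (x₂ / x₁ / qpow τ β₂) (qpow τ γ)⁻¹ m ≠ 0 :=
  poch_ne_zero fun i hi e => hden.2.1 i (by omega) (by
    rw [qpow_sub, qpow_neg, qpow_nat_mul, ← e, inv_pow]
    ring)

theorem poch_alpha_inv_ne_zero (hden : DenominatorsNonzero n τ β₁ β₂ γ x₁ x₂) (hx₁ : x₁ ≠ 0)
    (hx₂ : x₂ ≠ 0) {m : ℕ} (hm : m ≤ n) :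
    poch (qpow τ β₂ / (x₂ / x₁)) (qpow τ γ) m ≠ 0 :=
  poch_ne_zero fun i hi e => hden.2.1 i (by omega) (by
    have := pow_ne_zero i (qpow_ne_zero τ γ)
    have := qpow_ne_zero τ β₂
    rw [qpow_sub, qpow_neg, qpow_nat_mul]
    field_simp at e ⊢
    linear_combination -e)

theorem poch_delta_ne_zero (hden : DenominatorsNonzero n τ β₁ β₂ γ x₁ x₂) {k i : ℕ}
    (hn : n = k + i) :
    poch (x₂ / x₁ * qpow τ β₁ / qpow τ β₂ * qpow τ γ ^ i) (qpow τ γ)⁻¹ k ≠ 0 :=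
  poch_ne_zero fun l hl e => hden.2.2.1 (i - l) (by rw [abs_lt]; omega) (by
    rw [qpow_add, qpow_sub, qpow_int_mul, zpow_sub₀ (qpow_ne_zero _ _), zpow_natCast, zpow_natCast,
      ← e, inv_pow]
    ring)

theorem poch_delta_inv_ne_zero (hden : DenominatorsNonzero n τ β₁ β₂ γ x₁ x₂) (hx₁ : x₁ ≠ 0)
    (hx₂ : x₂ ≠ 0) {k m : ℕ} (hn : n = k + m) :
    poch ((qpow τ γ)⁻¹ ^ k / (x₂ / x₁)) (qpow τ γ) m ≠ 0 :=
  poch_ne_zero fun l hl e => hden.2.2.2 (k - l) (by rw [abs_lt]; omega) (by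
    rw [qpow_int_mul, zpow_sub₀ (qpow_ne_zero _ _), zpow_natCast, zpow_natCast]
    have := pow_ne_zero k (qpow_ne_zero τ γ)
    have := pow_ne_zero l (qpow_ne_zero τ γ)
    rw [inv_pow] at e
    field_simp at e ⊢
    linear_combination -e)

/-- `psiPoly_eq_sum` for the base q^{-γ}; the intermediate products are built on c = q^{β₂}/x₂ and d
= q^{β₁}/x₁, whose ratio produces xq^{β₁-β₂} in the denominators. -/
theorem psiPoly_eq_sum_URDRLR (hx₁ : x₁ ≠ 0) (hx₂ : x₂ ≠ 0)
    (hden : DenominatorsNonzero n τ β₁ β₂ γ x₁ x₂) (s : Fin (n + 1)) (z : ℂ) :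
    psiPoly (qpow τ γ)⁻¹ (1 / x₂) (qpow τ β₁ / x₁) n s z =
      ∑ r : Fin (n + 1), phiPoly (qpow τ γ)⁻¹ (1 / x₁) (qpow τ β₂ / x₂) n r z *
        (UR n τ β₁ β₂ γ x₁ x₂ * DR n τ β₁ β₂ γ x₁ x₂ * LR n τ β₁ β₂ γ x₁ x₂) r s := by
  have hg := qpow_ne_zero τ γ
  have hb₁ := qpow_ne_zero τ β₁
  have hb₂ := qpow_ne_zero τ β₂
  have hx : x₂ / x₁ ≠ 0 := div_ne_zero hx₂ hx₁
  have ea : 1 / x₁ / (qpow τ β₂ / x₂) = x₂ / x₁ / qpow τ β₂ := by field_simp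
  have ed : qpow τ β₁ / x₁ / (qpow τ β₂ / x₂) = x₂ / x₁ * qpow τ β₁ / qpow τ β₂ := by field_simp
  have eb : ∀ s : ℕ, 1 / x₂ / (qpow τ β₂ / x₂) * (qpow τ γ)⁻¹ ^ s =
      (qpow τ γ)⁻¹ ^ s / qpow τ β₂ := by intro s; field_simp
  have hs := s.2
  rw [psiPoly_eq_sum (a := 1 / x₁) (c := qpow τ β₂ / x₂) (inv_ne_zero hg) (by simpa using hx₁)
    (by simpa using hx₂) (div_ne_zero hb₂ hx₂) (by rw [ea]; exact poch_alpha_ne_zero hden le_rfl)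
    ?_ (by omega) z, ← Fin.sum_univ_eq_sum_range (fun r => phiPoly (qpow τ γ)⁻¹ (1 / x₁)
      (qpow τ β₂ / x₂) n r z * ∑ k ∈ range (n + 1),
      (if r ≤ k then connA (qpow τ γ)⁻¹ (1 / x₁ / (qpow τ β₂ / x₂)) k r
        (qpow τ β₁ / x₁ / (qpow τ β₂ / x₂) * (qpow τ γ)⁻¹⁻¹ ^ (n - k)) else 0) *
      (if (s : ℕ) ≤ k then connB (qpow τ γ)⁻¹ (1 / x₂ / (qpow τ β₂ / x₂) * (qpow τ γ)⁻¹ ^ (s : ℕ))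
        (qpow τ β₁ / x₁ / (qpow τ β₂ / x₂) * (qpow τ γ)⁻¹ ^ (s : ℕ)) (n - s) (k - s) else 0))]
  · refine sum_congr rfl fun r _ => ?_
    congr 1
    rw [Matrix.mul_apply, ← Fin.sum_univ_eq_sum_range (fun k =>
      (if (r : ℕ) ≤ k then connA (qpow τ γ)⁻¹ (1 / x₁ / (qpow τ β₂ / x₂)) k r
        (qpow τ β₁ / x₁ / (qpow τ β₂ / x₂) * (qpow τ γ)⁻¹⁻¹ ^ (n - k)) else 0) *
      (if (s : ℕ) ≤ k then connB (qpow τ γ)⁻¹ (1 / x₂ / (qpow τ β₂ / x₂) * (qpow τ γ)⁻¹ ^ (s : ℕ))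
        (qpow τ β₁ / x₁ / (qpow τ β₂ / x₂) * (qpow τ γ)⁻¹ ^ (s : ℕ)) (n - s) (k - s) else 0))]
    refine sum_congr rfl fun k _ => ?_
    rw [DR, diag, Matrix.mul_diagonal, ea, ed, eb, inv_inv]
    simp only [UR, LR, upper, lower, Matrix.of_apply, Fin.le_def]
    split_ifs with hr hs'
    · obtain ⟨j, hj⟩ := Nat.exists_eq_add_of_le hr
      obtain ⟨j', hj'⟩ := Nat.exists_eq_add_of_le hs'
      have hk := k.2
      have hn : n = k + (n - k) := by omega
      have hα := poch_alpha_ne_zero hden (m := k) (by omega)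
      have hδ := poch_delta_ne_zero hden hn
      have e₁ := uR_eq (n := n) (β₁ := β₁) (i := n - k) (r := r) (j := j) hden.1 hx (by omega)
        (by rw [← hj]; exact hα) (by rw [← hj]; exact hδ)
      have e₂ := dR_mul_lR_eq (n := n) (β₁ := β₁) (i := n - k) (s := s) (j := j') hden.1 hx
        (by omega) (by rw [← hj']; exact hα) (by rw [← hj']; exact hδ)
      rw [← hj] at e₁
      rw [← hj'] at e₂
      rw [show n - (s : ℕ) = n - k + j' by omega, show (k : ℕ) - s = j' by omega, ← e₂, e₁]
      ring
    · simp
    · simp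
    · simp
  · intro i j hij e
    rw [ed] at e
    refine hden.2.2.1 ((i : ℤ) - s - j) (by rw [abs_lt]; omega) ?_
    rw [qpow_add, qpow_sub, qpow_int_mul, zpow_sub₀ hg, zpow_sub₀ hg, zpow_natCast, zpow_natCast,
      zpow_natCast]
    have := pow_ne_zero i hg
    have := pow_ne_zero j hg
    have := pow_ne_zero (s : ℕ) hg
    simp only [inv_pow] at e
    field_simp at e ⊢
    linear_combination -e

/-- `psiPoly_eq_sum` for the base q^γ after reversal of the factors; the roles of c and d go to
multiples of 1/x₁ and 1/x₂, whence the denominators in x alone. Both summation indices are reflected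
to undo the reversal. -/
theorem psiPoly_eq_sum_LRDRUR (hx₁ : x₁ ≠ 0) (hx₂ : x₂ ≠ 0)
    (hden : DenominatorsNonzero n τ β₁ β₂ γ x₁ x₂) (s : Fin (n + 1)) (z : ℂ) :
    psiPoly (qpow τ γ)⁻¹ (1 / x₂) (qpow τ β₁ / x₁) n s z =
      ∑ r : Fin (n + 1), phiPoly (qpow τ γ)⁻¹ (1 / x₁) (qpow τ β₂ / x₂) n r z *
        (LR' n τ β₂ γ x₁ x₂ * DR' n τ β₁ β₂ γ x₁ x₂ * UR' n τ β₁ γ x₁ x₂) r s := by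
  have hg := qpow_ne_zero τ γ
  have hgn := pow_ne_zero n hg
  have hb₁ := qpow_ne_zero τ β₁
  have hb₂ := qpow_ne_zero τ β₂
  have hx : x₂ / x₁ ≠ 0 := div_ne_zero hx₂ hx₁
  have ea : qpow τ β₂ / x₂ * qpow τ γ / qpow τ γ ^ n / (1 / x₁ * qpow τ γ / qpow τ γ ^ n) =
      qpow τ β₂ / (x₂ / x₁) := by field_simp
  have ed : 1 / x₂ * qpow τ γ / qpow τ γ ^ n / (1 / x₁ * qpow τ γ / qpow τ γ ^ n) =
      1 / (x₂ / x₁) := by field_simp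
  have eb : qpow τ β₁ / x₁ * qpow τ γ / qpow τ γ ^ n / (1 / x₁ * qpow τ γ / qpow τ γ ^ n) =
      qpow τ β₁ := by field_simp
  have ed' : ∀ k : ℕ, 1 / (x₂ / x₁) * (qpow τ γ)⁻¹ ^ k = (qpow τ γ)⁻¹ ^ k / (x₂ / x₁) := by
    intro k; ring
  have ed'' : ∀ k : ℕ, 1 / (x₂ / x₁) * (qpow τ γ) ^ k = (qpow τ γ) ^ k / (x₂ / x₁) := by
    intro k; ring
  have hs := s.2
  rw [psiPoly_inv hg (by omega), psiPoly_eq_sum (a := qpow τ β₂ / x₂ * qpow τ γ / qpow τ γ ^ n)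
    (c := 1 / x₁ * qpow τ γ / qpow τ γ ^ n) hg
    (div_ne_zero (mul_ne_zero (div_ne_zero hb₂ hx₂) hg) hgn)
    (div_ne_zero (mul_ne_zero (div_ne_zero hb₁ hx₁) hg) hgn)
    (div_ne_zero (mul_ne_zero (div_ne_zero one_ne_zero hx₁) hg) hgn)
    (by rw [ea]; exact poch_alpha_inv_ne_zero hden hx₁ hx₂ le_rfl) ?_ (by omega) z,
    ← sum_range_reflect, ea, ed, eb]
  · simp only [Nat.add_sub_cancel]
    rw [← Fin.sum_univ_eq_sum_range (fun r => phiPoly (qpow τ γ)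
        (qpow τ β₂ / x₂ * qpow τ γ / qpow τ γ ^ n) (1 / x₁ * qpow τ γ / qpow τ γ ^ n) n (n - r) z *
        ∑ k ∈ range (n + 1),
        (if n - r ≤ k then connA (qpow τ γ) (qpow τ β₂ / (x₂ / x₁)) k (n - r)
          (1 / (x₂ / x₁) * (qpow τ γ)⁻¹ ^ (n - k)) else 0) *
        (if n - (s : ℕ) ≤ k then connB (qpow τ γ) (qpow τ β₁ * qpow τ γ ^ (n - (s : ℕ)))
          (1 / (x₂ / x₁) * qpow τ γ ^ (n - (s : ℕ))) (n - (n - s)) (k - (n - s)) else 0))]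
    refine sum_congr rfl fun r _ => ?_
    have hr := r.2
    rw [← phiPoly_inv hg (by omega)]
    congr 1
    rw [← sum_range_reflect]
    simp only [Nat.add_sub_cancel]
    rw [Matrix.mul_apply, ← Fin.sum_univ_eq_sum_range (fun k =>
        (if n - r ≤ n - k then connA (qpow τ γ) (qpow τ β₂ / (x₂ / x₁)) (n - k) (n - r)
          (1 / (x₂ / x₁) * (qpow τ γ)⁻¹ ^ (n - (n - k))) else 0) *
        (if n - (s : ℕ) ≤ n - k then connB (qpow τ γ) (qpow τ β₁ * qpow τ γ ^ (n - (s : ℕ)))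
          (1 / (x₂ / x₁) * qpow τ γ ^ (n - (s : ℕ))) (n - (n - s)) (n - k - (n - s)) else 0))]
    refine sum_congr rfl fun k _ => ?_
    have hk := k.2
    rw [DR', diag, Matrix.mul_diagonal, ed', ed'']
    simp only [UR', LR', upper, lower, Matrix.of_apply, Fin.le_def]
    by_cases hkr : (k : ℕ) ≤ r
    · by_cases hks : (k : ℕ) ≤ s
      · rw [if_pos (by omega), if_pos (by omega), if_pos hkr, if_pos hks]
        obtain ⟨j, hj⟩ := Nat.exists_eq_add_of_le hkr
        obtain ⟨j', hj'⟩ := Nat.exists_eq_add_of_le hks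
        have hn : n = k + (n - k) := by omega
        have hα := poch_alpha_inv_ne_zero hden hx₁ hx₂ (m := n - k) (by omega)
        have hδ := poch_delta_inv_ne_zero hden hx₁ hx₂ hn
        have i₁ : n - r + j = n - k := by omega
        have i₂ : n - s + j' = n - k := by omega
        have e₁ := lR'_eq (n := n) (β₂ := β₂) (i := n - r) (k := k) (j := j) hden.1 hx (by omega)
          (by rw [i₁]; exact hα) (by rw [i₁]; exact hδ)
        have e₂ := dR'_mul_uR'_eq (n := n) (β₁ := β₁) (i := n - s) (k := k) (j := j') hden.1 hx
          (by omega) (by rw [i₂]; exact hα) (by rw [i₂]; exact hδ)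
        rw [i₁, ← hj] at e₁
        rw [i₂, ← hj'] at e₂
        rw [show n - (n - (k : ℕ)) = k by omega, show n - (n - (s : ℕ)) = s by omega,
          show n - (k : ℕ) - (n - s) = j' by omega, ← e₂, e₁]
        ring
      · rw [if_neg (show ¬ n - (s : ℕ) ≤ n - k by omega), if_neg hks]
        simp
    · rw [if_neg (show ¬ n - (r : ℕ) ≤ n - k by omega), if_neg hkr]
      simp
  · intro i j hij e
    rw [ed] at e
    refine hden.2.2.2 ((i : ℤ) - (n - s : ℕ) - j) (by rw [abs_lt]; omega) ?_
    rw [qpow_int_mul, zpow_sub₀ hg, zpow_sub₀ hg, zpow_natCast, zpow_natCast, zpow_natCast]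
    have := pow_ne_zero i hg
    have := pow_ne_zero j hg
    have := pow_ne_zero (n - s : ℕ) hg
    field_simp at e ⊢
    linear_combination e

theorem URDRLR_eq_LRDRUR (hx₁ : x₁ ≠ 0) (hx₂ : x₂ ≠ 0)
    (hden : DenominatorsNonzero n τ β₁ β₂ γ x₁ x₂) :
    UR n τ β₁ β₂ γ x₁ x₂ * DR n τ β₁ β₂ γ x₁ x₂ * LR n τ β₁ β₂ γ x₁ x₂ =
      LR' n τ β₂ γ x₁ x₂ * DR' n τ β₁ β₂ γ x₁ x₂ * UR' n τ β₁ γ x₁ x₂ := by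
  have hg := qpow_ne_zero τ γ
  have hb₂ := qpow_ne_zero τ β₂
  ext r s
  have h₁ := psiPoly_eq_sum_URDRLR hx₁ hx₂ hden s
  have h₂ := psiPoly_eq_sum_LRDRUR hx₁ hx₂ hden s
  generalize UR n τ β₁ β₂ γ x₁ x₂ * DR n τ β₁ β₂ γ x₁ x₂ * LR n τ β₁ β₂ γ x₁ x₂ = K at *
  generalize LR' n τ β₂ γ x₁ x₂ * DR' n τ β₁ β₂ γ x₁ x₂ * UR' n τ β₁ γ x₁ x₂ = K' at *
  have ea : 1 / x₁ / (qpow τ β₂ / x₂) = x₂ / x₁ / qpow τ β₂ := by field_simp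
  have hr := r.2
  have key := phiPoly_linearIndependent (p := (qpow τ γ)⁻¹) (a := 1 / x₁) (c := qpow τ β₂ / x₂)
    (n := n) (inv_ne_zero hg) (fun k h₁ h₂ e => hden.1 k h₁ h₂ (by
      rw [qpow_nat_mul]; rwa [inv_pow, inv_eq_one] at e)) (div_ne_zero hb₂ hx₂)
    (by rw [ea]; exact poch_alpha_ne_zero hden le_rfl)
    (fun r => if h : r < n + 1 then K ⟨r, h⟩ s - K' ⟨r, h⟩ s else 0) (fun z => by
      rw [← Fin.sum_univ_eq_sum_range (fun r => phiPoly (qpow τ γ)⁻¹ (1 / x₁) (qpow τ β₂ / x₂) n r z *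
        if h : r < n + 1 then K ⟨r, h⟩ s - K' ⟨r, h⟩ s else 0)]
      simp only [Fin.is_lt, dite_true, Fin.eta, mul_sub, sum_sub_distrib]
      rw [← h₁, ← h₂, sub_self]) (n - r) (by omega)
  rw [Nat.sub_sub_self (by omega), dif_pos hr] at key
  exact sub_eq_zero.1 key

end decomposition

/-! ### Alternating sums against the deformed Vandermonde product -/

section altSum

variable {n : ℕ} {τ γ : ℂ}

/-- The terms of σ and of σ composed with the transposition cancel. -/
theorem altSum_eq_zero {f : (Fin n → ℂ) → ℂ} {i j : Fin n} (hij : i ≠ j)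
    (h : ∀ u, f (fun k => u (Equiv.swap i j k)) = f u) (t : Fin n → ℂ) : altSum f t = 0 := by
  have e : altSum f t = - altSum f t := by
    conv_lhs => unfold altSum
    rw [← Equiv.sum_comp (Equiv.mulRight (Equiv.swap i j)), altSum, ← sum_neg_distrib]
    refine sum_congr rfl fun σ _ => ?_
    simp only [Equiv.coe_mulRight, Equiv.Perm.sign_mul, Equiv.Perm.sign_swap hij,
      Equiv.Perm.mul_apply]
    rw [h fun k => t (σ k)]
    simp
  have : (2 : ℂ) * altSum f t = 0 := by linear_combination e
  simpa using this

theorem altSum_add (f g : (Fin n → ℂ) → ℂ) (t : Fin n → ℂ) :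
    altSum (fun u => f u + g u) t = altSum f t + altSum g t := by
  simp [altSum, mul_add, sum_add_distrib]

theorem altSum_sum {ι : Type*} (s : Finset ι) (f : ι → (Fin n → ℂ) → ℂ) (t : Fin n → ℂ) :
    altSum (fun u => ∑ i ∈ s, f i u) t = ∑ i ∈ s, altSum (f i) t := by
  simp only [altSum, mul_sum]
  exact sum_comm

theorem altSum_const_mul (c : ℂ) (f : (Fin n → ℂ) → ℂ) (t : Fin n → ℂ) :
    altSum (fun u => c * f u) t = c * altSum f t := by
  simp only [altSum, mul_sum]
  exact sum_congr rfl fun σ _ => by ring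

theorem prod_Ioi_eq (f : Fin n → Fin n → ℂ) :
    ∏ i, ∏ j ∈ Ioi i, f i j = ∏ x : Fin n × Fin n, if x.1 < x.2 then f x.1 x.2 else 1 := by
  rw [Fintype.prod_prod_type]
  refine prod_congr rfl fun i _ => ?_
  rw [← prod_filter]
  congr 1
  ext j
  simp

theorem swap_lt_swap_iff {i j : Fin n} (hij : (j : ℕ) = i + 1) (a b : Fin n)
    (h : ¬ (a = i ∧ b = j)) (h' : ¬ (a = j ∧ b = i)) :
    Equiv.swap i j a < Equiv.swap i j b ↔ a < b := by
  rw [Equiv.swap_apply_def, Equiv.swap_apply_def]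
  simp only [Fin.ext_iff, Fin.lt_def] at *
  split_ifs <;> omega

/-- A transposition of neighbours preserves the order of every pair except (i, j), so a single
factor changes. The identity is multiplied out because that factor may vanish. -/
theorem deltaGamma_swap {i j : Fin n} (hij : (j : ℕ) = i + 1) (t : Fin n → ℂ) :
    deltaGamma τ γ (fun k => t (Equiv.swap i j k)) * (t i - qpow τ (-γ) * t j) =
      deltaGamma τ γ t * (t j - qpow τ (-γ) * t i) := by
  have hlt : i < j := by rw [Fin.lt_def]; omega
  unfold deltaGamma
  rw [prod_Ioi_eq, prod_Ioi_eq,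
    ← Equiv.prod_comp ((Equiv.swap i j).prodCongr (Equiv.swap i j))]
  simp only [Equiv.prodCongr_apply, Prod.map_fst, Prod.map_snd, Equiv.swap_apply_self]
  have e₁ : (t i - qpow τ (-γ) * t j) = ∏ x : Fin n × Fin n,
      if x = (i, j) then t i - qpow τ (-γ) * t j else 1 := by simp
  have e₂ : (t j - qpow τ (-γ) * t i) = ∏ x : Fin n × Fin n,
      if x = (j, i) then t j - qpow τ (-γ) * t i else 1 := by simp
  rw [e₁, e₂, ← prod_mul_distrib, ← prod_mul_distrib]
  refine prod_congr rfl fun x _ => ?_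
  obtain ⟨a, b⟩ := x
  by_cases h : a = i ∧ b = j
  · obtain ⟨rfl, rfl⟩ := h
    have : ¬ b < a := by omega
    simp [hlt, this, hlt.ne]
  by_cases h' : a = j ∧ b = i
  · obtain ⟨rfl, rfl⟩ := h'
    have : ¬ a < b := by omega
    simp [hlt, this, hlt.ne]
  simp only [swap_lt_swap_iff hij a b h h', Prod.mk.injEq, h, h', if_false]

/-- The alternating sum of a monomial times `deltaGamma`, normalized to be invariant under
permutations of the variables in the monomial. -/
def altMonomial (τ γ : ℂ) (t : Fin n → ℂ) (S : Finset (Fin n)) : ℂ :=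
  (qpow τ (-γ))⁻¹ ^ (∑ k ∈ S, (k : ℕ)) *
    altSum (fun u => (∏ k ∈ S, u k) * deltaGamma τ γ u) t

/-- With p = q^{-γ}, the product (p⁻¹u_j - u_i)(u_i - pu_j) is symmetric in u_i and u_j, so p⁻¹u_j -
u_i times the other factors of `deltaGamma` alternates to zero. Moving an element of S from i to i +
1 thus costs one power of p, which the normalization absorbs. -/
theorem altMonomial_swap_aux {i j : Fin n} (hij : (j : ℕ) = i + 1) (t : Fin n → ℂ)
    {S : Finset (Fin n)} (hi : i ∈ S) (hj : j ∉ S) :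
    altMonomial τ γ t (S.map (Equiv.swap i j).toEmbedding) = altMonomial τ γ t S := by
  have hne : i ≠ j := by rintro rfl; omega
  have hp := qpow_ne_zero τ (-γ)
  obtain ⟨T, hT, rfl⟩ : ∃ T, i ∉ T ∧ S = insert i T := ⟨S.erase i, by simp, by simp [hi]⟩
  have hjT : j ∉ T := fun h => hj (mem_insert_of_mem h)
  have hTs : ∀ k ∈ T, Equiv.swap i j k = k := fun k hk =>
    Equiv.swap_apply_of_ne_of_ne (fun h => hT (h ▸ hk)) (fun h => hjT (h ▸ hk))
  have hmap : (insert i T).map (Equiv.swap i j).toEmbedding = insert j T := by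
    rw [map_insert]
    congr 1
    · simp
    · ext k
      simp only [mem_map, Equiv.coe_toEmbedding]
      refine ⟨?_, fun hk => ⟨k, hk, hTs k hk⟩⟩
      rintro ⟨l, hl, rfl⟩
      rwa [hTs l hl]
  rw [hmap, altMonomial, altMonomial]
  simp only [prod_insert hT, prod_insert hjT, sum_insert hT, sum_insert hjT]
  have key : altSum (fun u : Fin n → ℂ => (qpow τ (-γ))⁻¹ * (u j * (∏ k ∈ T, u k) *
      deltaGamma τ γ u) + (-1) * (u i * (∏ k ∈ T, u k) * deltaGamma τ γ u)) t = 0 := by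
    refine altSum_eq_zero hne (fun u => ?_) t
    have e := deltaGamma_swap (τ := τ) (γ := γ) hij u
    have hprod : ∏ k ∈ T, u (Equiv.swap i j k) = ∏ k ∈ T, u k :=
      prod_congr rfl fun k hk => by rw [hTs k hk]
    simp only [Equiv.swap_apply_left, Equiv.swap_apply_right, hprod]
    field_simp
    linear_combination (∏ k ∈ T, u k) * e
  rw [altSum_add, altSum_const_mul, altSum_const_mul] at key
  rw [hij, add_right_comm, pow_succ]
  linear_combination (qpow τ (-γ))⁻¹ ^ ((i : ℕ) + ∑ k ∈ T, (k : ℕ)) * key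

theorem altMonomial_swap {i j : Fin n} (hij : (j : ℕ) = i + 1) (t : Fin n → ℂ)
    (S : Finset (Fin n)) :
    altMonomial τ γ t (S.map (Equiv.swap i j).toEmbedding) = altMonomial τ γ t S := by
  have hmm : (S.map (Equiv.swap i j).toEmbedding).map (Equiv.swap i j).toEmbedding = S := by
    ext k; simp
  have hmem : ∀ k, k ∈ S.map (Equiv.swap i j).toEmbedding ↔ Equiv.swap i j k ∈ S := by
    intro k
    simp only [mem_map, Equiv.coe_toEmbedding]
    refine ⟨?_, fun h => ⟨_, h, by simp⟩⟩
    rintro ⟨l, hl, rfl⟩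
    simpa using hl
  by_cases hi : i ∈ S <;> by_cases hj : j ∈ S
  · congr 1
    ext k
    rw [hmem, Equiv.swap_apply_def]
    split_ifs <;> simp_all
  · exact altMonomial_swap_aux hij t hi hj
  · have := altMonomial_swap_aux (τ := τ) (γ := γ) hij t
      (S := S.map (Equiv.swap i j).toEmbedding) (by rw [hmem]; simpa using hj)
      (by rw [hmem]; simpa using hi)
    rw [hmm] at this
    exact this.symm
  · congr 1
    ext k
    rw [hmem, Equiv.swap_apply_def]
    split_ifs <;> simp_all

/-- Transpositions of neighbours generate the symmetric group. -/
theorem altMonomial_map (t : Fin n → ℂ) (π : Equiv.Perm (Fin n)) :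
    ∀ S : Finset (Fin n), altMonomial τ γ t (S.map π.toEmbedding) = altMonomial τ γ t S := by
  rcases n with _ | n
  · intro S
    congr 1
    exact Subsingleton.elim _ _
  have hπ : π ∈ Submonoid.closure
      (Set.range fun i : Fin n ↦ Equiv.swap i.castSucc i.succ) := by
    rw [Equiv.Perm.mclosure_swap_castSucc_succ]; trivial
  induction hπ using Submonoid.closure_induction with
  | mem x hx =>
    obtain ⟨i, rfl⟩ := hx
    exact fun S => altMonomial_swap (by simp) t S
  | one => intro S; congr 1; ext k; simp; rfl
  | mul x y _ _ hx hy =>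
    intro S
    rw [← hy S, ← hx (S.map y.toEmbedding), Finset.map_map]
    rfl

theorem altMonomial_eq_of_card (t : Fin n → ℂ) {S S' : Finset (Fin n)} (h : #S = #S') :
    altMonomial τ γ t S = altMonomial τ γ t S' := by
  let e : {x // x ∈ S} ≃ {x // x ∈ S'} := Finset.equivOfCardEq h
  rw [← altMonomial_map t e.extendSubtype S]
  congr 1
  refine eq_of_subset_of_card_le (fun k hk => ?_) (by rw [card_map, h])
  obtain ⟨l, hl, rfl⟩ := mem_map.1 hk
  exact e.extendSubtype_mem l hl

theorem exists_altMonomial_eq (τ γ : ℂ) (t : Fin n → ℂ) :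
    ∃ F : ℕ → ℂ, ∀ S : Finset (Fin n), altMonomial τ γ t S = F #S := by
  classical
  refine ⟨fun m => if h : ∃ S : Finset (Fin n), #S = m then altMonomial τ γ t h.choose else 0,
    fun S => ?_⟩
  have h : ∃ S' : Finset (Fin n), #S' = #S := ⟨S, rfl⟩
  simp only [dif_pos h]
  exact altMonomial_eq_of_card t h.choose_spec.symm

/-- Linear relations between the polynomials `∏_k (1 - y_k z)` carry over to the alternating sums
of the products `∏_k (1 - p^(-k) y_k t_k)` times `deltaGamma`. -/
theorem altSum_of_linear_relation {ι : Type*} [Fintype ι] (τ γ : ℂ) (t : Fin n → ℂ)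
    (y : Fin n → ℂ) (w : ι → Fin n → ℂ) (K : ι → ℂ)
    (h : ∀ z : ℂ, ∏ k, (1 - y k * qpow τ (-γ) ^ (k : ℕ) * z) =
      ∑ r, (∏ k, (1 - w r k * qpow τ (-γ) ^ (k : ℕ) * z)) * K r) :
    altSum (fun u => (∏ k, (1 - y k * u k)) * deltaGamma τ γ u) t =
      ∑ r, altSum (fun u => (∏ k, (1 - w r k * u k)) * deltaGamma τ γ u) t * K r := by
  classical
  have hp := qpow_ne_zero τ (-γ)
  obtain ⟨F, hF⟩ := exists_altMonomial_eq τ γ t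
  -- The linear functional sending X^m to the common value of the normalized alternating sums over
  -- sets of size m.
  let L : Polynomial ℂ → ℂ := fun P => ∑ m ∈ range (n + 1), P.coeff m * F m
  have hL : ∀ v : Fin n → ℂ,
      altSum (fun u => (∏ k, (1 - v k * u k)) * deltaGamma τ γ u) t =
        L (∏ k, (1 + Polynomial.C (-(v k * qpow τ (-γ) ^ (k : ℕ))) * Polynomial.X)) := by
    intro v
    have e : ∀ u : Fin n → ℂ, (∏ k, (1 - v k * u k)) * deltaGamma τ γ u =
        ∑ S ∈ univ.powerset, (∏ k ∈ S, -(v k)) * ((∏ k ∈ S, u k) * deltaGamma τ γ u) := by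
      intro u
      have := prod_one_add (f := fun k => -(v k * u k)) (univ : Finset (Fin n))
      simp only [← sub_eq_add_neg] at this
      rw [this, sum_mul]
      refine sum_congr rfl fun S _ => ?_
      rw [← mul_assoc, ← prod_mul_distrib]
      simp
    simp only [e]
    rw [altSum_sum]
    simp only [altSum_const_mul, L, prod_one_add, Polynomial.finsetSum_coeff, sum_mul]
    rw [sum_comm]
    refine sum_congr rfl fun S _ => ?_
    have hc : #S < n + 1 := by
      have := card_le_univ S
      simp at this
      omega
    have e₂ : ∏ k ∈ S, Polynomial.C (-(v k * qpow τ (-γ) ^ (k : ℕ))) * Polynomial.X =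
        Polynomial.C (∏ k ∈ S, -(v k * qpow τ (-γ) ^ (k : ℕ))) * Polynomial.X ^ #S := by
      rw [prod_mul_distrib, prod_const, map_prod]
    rw [e₂]
    simp only [Polynomial.coeff_C_mul_X_pow, ite_mul, zero_mul]
    rw [sum_ite_eq' (range (n + 1)) #S, if_pos (mem_range.2 hc), ← hF S, altMonomial,
      inv_pow, ← prod_pow_eq_pow_sum]
    have : ∏ k ∈ S, -(v k * qpow τ (-γ) ^ (k : ℕ)) =
        (∏ k ∈ S, -(v k)) * ∏ k ∈ S, qpow τ (-γ) ^ (k : ℕ) := by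
      rw [← prod_mul_distrib]
      simp
    rw [this]
    have h0 : ∏ k ∈ S, qpow τ (-γ) ^ (k : ℕ) ≠ 0 :=
      prod_ne_zero_iff.2 fun k _ => pow_ne_zero _ hp
    field_simp
  have hpoly : (∏ k, (1 + Polynomial.C (-(y k * qpow τ (-γ) ^ (k : ℕ))) * Polynomial.X)) =
      ∑ r, (∏ k, (1 + Polynomial.C (-(w r k * qpow τ (-γ) ^ (k : ℕ))) * Polynomial.X)) *
        Polynomial.C (K r) := by
    -- The functional reads coefficients, whereas `h` compares values; over an infinite field the
    -- two agree.
    refine Polynomial.funext fun z => ?_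
    have := h z
    simp only [Polynomial.eval_prod, Polynomial.eval_finsetSum, Polynomial.eval_mul,
      Polynomial.eval_add, Polynomial.eval_one, Polynomial.eval_C, Polynomial.eval_X, neg_mul,
      ← sub_eq_add_neg]
    exact this
  rw [hL, hpoly]
  simp only [hL, L, Polynomial.finsetSum_coeff, Polynomial.coeff_mul_C, sum_mul]
  rw [sum_comm]
  exact sum_congr rfl fun r _ => sum_congr rfl fun m _ => by ring

end altSum

/-! ### Invariance of the Jackson sum and cyclic rotation of the variables -/

section rotation

variable {n : ℕ} {τ α γ : ℂ}

theorem point_ne_zero (τ : ℂ) (u : Fin n → ℂ) (k : Fin n) : point τ u k ≠ 0 := qpow_ne_zero _ _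

theorem prod_Ioi_ite_right (D : Fin n → ℂ) (a : Fin n) :
    ∏ i, ∏ j ∈ Ioi i, (if j = a then D i else 1) = ∏ i, if i < a then D i else 1 := by
  refine prod_congr rfl fun i _ => ?_
  rw [prod_ite_eq' (Ioi i) a (fun _ => D i)]
  simp

theorem prod_Ioi_ite_left (D : Fin n → ℂ) (a : Fin n) :
    ∏ i, ∏ j ∈ Ioi i, (if i = a then D j else 1) = ∏ j, if a < j then D j else 1 := by
  rw [prod_eq_single a]
  · simp only [if_true]
    rw [← prod_filter]
    congr 1
    ext j
    simp
  · intro i _ hi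
    simp [hi]
  · simp

theorem prod_Ioi_ite (D : Fin n → ℂ) (a : Fin n) :
    ∏ i, ∏ j ∈ Ioi i, ((if j = a then D i else 1) * (if i = a then D j else 1)) =
      ∏ j ∈ univ.erase a, D j := by
  simp only [prod_mul_distrib]
  rw [prod_Ioi_ite_right, prod_Ioi_ite_left, ← prod_mul_distrib]
  have : univ.erase a = univ.filter (fun j => j ≠ a) := by ext; simp
  rw [this, prod_filter]
  refine prod_congr rfl fun j _ => ?_
  rcases lt_trichotomy j a with h | h | h
  · simp [h, h.not_gt, h.ne]
  · simp [h]
  · simp [h, h.not_gt, h.ne']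

/-- Comparison of two products over pairs which differ only in the pairs containing `a`. -/
theorem prod_Ioi_mul_prod_erase (a : Fin n) {f f' : Fin n → Fin n → ℂ} {D N : Fin n → ℂ} {E : ℂ}
    (h : ∀ i j, i ≠ a → j ≠ a → f' i j = f i j) (hl : ∀ j, j < a → f' j a * D j = f j a * N j)
    (hr : ∀ j, a < j → f' a j * D j = f a j * N j * E) :
    (∏ i, ∏ j ∈ Ioi i, f' i j) * ∏ j ∈ univ.erase a, D j =
      (∏ i, ∏ j ∈ Ioi i, f i j) * (∏ j ∈ univ.erase a, N j) * E ^ (n - 1 - (a : ℕ)) := by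
  have hE : E ^ (n - 1 - (a : ℕ)) = ∏ i, ∏ j ∈ Ioi i, (if i = a then E else 1) := by
    rw [prod_Ioi_ite_left (fun _ => E), ← prod_filter, prod_const]
    have : univ.filter (fun j => a < j) = Ioi a := by ext; simp
    rw [this, Fin.card_Ioi]
  rw [← prod_Ioi_ite D, ← prod_Ioi_ite N, hE]
  simp only [← prod_mul_distrib]
  refine prod_congr rfl fun i _ => prod_congr rfl fun j hj => ?_
  have hij : i < j := by simpa using hj
  by_cases hja : j = a
  · subst hja
    simpa [hij.ne] using hl i hij
  · by_cases hia : i = a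
    · subst hia
      simpa [hja] using hr j hij
    · simp [hja, hia, h i j hia hja]

/-- The factor of `pairPart` belonging to one pair. -/
def pairFactor (τ γ r : ℂ) : ℂ :=
  pochInf (qpow τ (1 - γ) * r) (qpow τ 1) / pochInf (qpow τ γ * r) (qpow τ 1)

/-- One factor is split off each infinite product. The denominator must not acquire a zero, but the
numerator may, so the other side is left undivided. -/
theorem pairFactor_step (hτ : 0 < τ.im) {r : ℂ} (hr : qpow τ γ * r ≠ 1) :
    pairFactor τ γ (qpow τ 1 * r) * (1 - qpow τ (1 - γ) * r) =
      pairFactor τ γ r * (1 - qpow τ γ * r) := by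
  have h : 1 - qpow τ γ * r ≠ 0 := sub_ne_zero.2 hr.symm
  rw [pairFactor, pairFactor, pochInf_step (qpow τ (1 - γ) * r) _ (norm_qpow_one_lt τ hτ),
    pochInf_step (qpow τ γ * r) _ (norm_qpow_one_lt τ hτ),
    mul_left_comm (qpow τ 1) (qpow τ (1 - γ)), mul_left_comm (qpow τ 1) (qpow τ γ)]
  generalize 1 - qpow τ γ * r = d at *
  generalize pochInf (qpow τ γ * (qpow τ 1 * r)) (qpow τ 1) = C
  field_simp

theorem pairPart_eq (t : Fin n → ℂ) :
    pairPart τ γ t = ∏ i, ∏ j ∈ Ioi i, pairFactor τ γ (t j / t i) := by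
  simp only [pairPart, pairFactor, mul_div_assoc]

/-- The lattice avoids the poles of `pairPart`. -/
def AvoidsPairPoles (τ γ : ℂ) (t : Fin n → ℂ) : Prop :=
  ∀ i j, i < j → ∀ m : ℤ, qpow τ γ * t j / t i ≠ qpow τ m

theorem point_add_single (u : Fin n → ℂ) (a k : Fin n) :
    point τ (u + Pi.single a 1) k = if k = a then qpow τ 1 * point τ u a else point τ u k := by
  by_cases h : k = a
  · subst h
    simp [point, qpow_add, mul_comm]
  · simp [point, h]

theorem powerPart_add_single (u : Fin n → ℂ) (a : Fin n) :
    powerPart τ α γ (u + Pi.single a 1) = powerPart τ α γ u * qpow τ (expo α γ a) := by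
  unfold powerPart
  have : ∀ k, qpow τ (expo α γ k * (u + Pi.single a 1 : Fin n → ℂ) k) =
      qpow τ (expo α γ k * u k) * if k = a then qpow τ (expo α γ a) else 1 := by
    intro k
    by_cases h : k = a
    · subst h
      simp [mul_add, qpow_add]
    · simp [h]
  simp only [this, prod_mul_distrib]
  simp

/-- Pairs (j, a) and pairs (a, j) contribute the same quotient of linear factors, except for a
constant q^{1-2γ} for each j > a. The exponents of `powerPart` compensate these constants, so that
the total factor does not depend on a. -/
theorem power_mul_pairPart_shift (hτ : 0 < τ.im) (u : Fin n → ℂ)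
    (h : AvoidsPairPoles τ γ (point τ u)) (a : Fin n) :
    powerPart τ α γ (u + Pi.single a 1) * pairPart τ γ (point τ (u + Pi.single a 1)) *
        ∏ j ∈ univ.erase a, (point τ u j - qpow τ (1 - γ) * point τ u a) =
      qpow τ (α - 2 * (n - 1) * γ) * (powerPart τ α γ u * pairPart τ γ (point τ u) *
        ∏ j ∈ univ.erase a, (point τ u j - qpow τ γ * point τ u a)) := by
  have key := prod_Ioi_mul_prod_erase a
    (f := fun i j => pairFactor τ γ (point τ u j / point τ u i))
    (f' := fun i j => pairFactor τ γ
      (point τ (u + Pi.single a 1) j / point τ (u + Pi.single a 1) i))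
    (D := fun j => point τ u j - qpow τ (1 - γ) * point τ u a)
    (N := fun j => point τ u j - qpow τ γ * point τ u a) (E := qpow τ (1 - 2 * γ))
    (fun i j hi hj => by simp only [point_add_single, hi, hj, if_false])
    (fun j hj => by
      simp only [point_add_single, hj.ne, if_false, if_true]
      have hz := point_ne_zero τ u j
      have e := pairFactor_step (γ := γ) (r := point τ u a / point τ u j) hτ (by
        have := h j a hj 0
        simpa [qpow_zero, mul_div_assoc] using this)
      rw [← mul_div_assoc] at e
      generalize pairFactor τ γ (qpow τ 1 * point τ u a / point τ u j) = P at *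
      generalize pairFactor τ γ (point τ u a / point τ u j) = P' at *
      field_simp at e
      linear_combination e)
    (fun j hj => by
      simp only [point_add_single, hj.ne', if_false, if_true]
      have hz := point_ne_zero τ u a
      have hq := qpow_ne_zero τ 1
      have hg := qpow_ne_zero τ γ
      -- When t_a is the denominator of the ratio, the shift divides by q, so the functional
      -- equation is read backwards and the pole to avoid is q rather than 1.
      have e := pairFactor_step (γ := γ) (r := point τ u j / (qpow τ 1 * point τ u a)) hτ (by
        have := h a j hj 1
        simp only [Int.cast_one] at this
        intro e
        apply this
        field_simp at e ⊢
        exact e)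
      rw [show qpow τ 1 * (point τ u j / (qpow τ 1 * point τ u a)) = point τ u j / point τ u a by
        field_simp] at e
      have e₁ : qpow τ (1 - 2 * γ) = qpow τ 1 / (qpow τ γ * qpow τ γ) := by
        rw [two_mul, qpow_sub, qpow_add]
      have e₂ : qpow τ (1 - γ) = qpow τ 1 / qpow τ γ := qpow_sub _ _ _
      rw [e₂] at e
      rw [e₁, e₂]
      generalize pairFactor τ γ (point τ u j / (qpow τ 1 * point τ u a)) = P at *
      generalize pairFactor τ γ (point τ u j / point τ u a) = P' at *
      field_simp at e ⊢
      linear_combination e)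
  rw [← pairPart_eq, ← pairPart_eq] at key
  rw [powerPart_add_single, mul_assoc, key]
  -- Here the form of α_j matters: α_{a+1} + (n - 1 - a)(1 - 2γ) = α - 2(n - 1)γ for every
  -- zero-based a.
  have hc : qpow τ (expo α γ a) * qpow τ (1 - 2 * γ) ^ (n - 1 - (a : ℕ)) =
      qpow τ (α - 2 * (n - 1) * γ) := by
    rw [← qpow_nat_mul, ← qpow_add]
    congr 1
    have := a.2
    rw [Nat.sub_sub, Nat.cast_sub (by omega)]
    push_cast
    unfold expo
    ring
  rw [← hc]
  ring

theorem deltaGamma_snoc {m : ℕ} (v : Fin (m + 1) → ℂ) :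
    deltaGamma τ γ v = deltaGamma τ γ (fun k : Fin m => v k.castSucc) *
      ∏ i : Fin m, (v i.castSucc - qpow τ (-γ) * v (Fin.last m)) := by
  unfold deltaGamma
  rw [prod_Ioi_eq, prod_Ioi_eq, Fintype.prod_prod_type, Fintype.prod_prod_type,
    Fin.prod_univ_castSucc]
  simp only [Fin.prod_univ_castSucc, Fin.castSucc_lt_castSucc_iff, Fin.castSucc_lt_last, if_true,
    prod_mul_distrib]
  have : ∀ i : Fin m, ¬ Fin.last m < i.castSucc := fun i => (Fin.le_last _).not_gt
  simp [this]

theorem deltaGamma_cons {m : ℕ} (v : Fin (m + 1) → ℂ) :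
    deltaGamma τ γ v = (∏ i : Fin m, (v 0 - qpow τ (-γ) * v i.succ)) *
      deltaGamma τ γ (fun k : Fin m => v k.succ) := by
  unfold deltaGamma
  simp [Fin.prod_univ_succ, Fin.prod_Ioi_succ]

/-- The summand belonging to the permutation `σ` of the Jackson integral of
`∏_k f_k(t_k) · deltaGamma` against `powerPart · pairPart`. -/
def sigmaTerm (τ α γ : ℂ) (f : Fin n → ℂ → ℂ) (σ : Equiv.Perm (Fin n)) (u : Fin n → ℂ) : ℂ :=
  powerPart τ α γ u * pairPart τ γ (point τ u) *
    ((∏ k, f k (point τ u (σ k))) * deltaGamma τ γ fun k => point τ u (σ k))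

/-- The factors q^{1-γ} in the shift formula form the last column of Δ at the shifted point. They
are exchanged for factors which, up to -q^γ each, form the first row of Δ with the same variable
moved to the front. The constants combine to (-q^γ)^m q^{α-2mγ}. -/
theorem sigmaTerm_rotate (hτ : 0 < τ.im) {m : ℕ} {f f' : Fin (m + 1) → ℂ → ℂ}
    (h₀ : ∀ t, f' 0 t = f (Fin.last m) (qpow τ 1 * t))
    (hf : ∀ (k : Fin m) (t : ℂ), f' k.succ t = f k.castSucc t) (σ : Equiv.Perm (Fin (m + 1)))
    (u : Fin (m + 1) → ℂ) (h : AvoidsPairPoles τ γ (point τ u)) :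
    sigmaTerm τ α γ f σ (u + Pi.single (σ (Fin.last m)) 1) =
      (-1) ^ m * qpow τ (α - m * γ) * sigmaTerm τ α γ f' (σ * (finRotate (m + 1))⁻¹) u := by
  have key := power_mul_pairPart_shift (α := α) hτ u h (σ (Fin.last m))
  have herase : ∀ g : Fin (m + 1) → ℂ, ∏ j ∈ univ.erase (σ (Fin.last m)), g j =
      ∏ i : Fin m, g (σ i.castSucc) := by
    intro g
    have e : univ.erase (σ (Fin.last m)) =
        (univ : Finset (Fin m)).map (Fin.castSuccEmb.trans σ.toEmbedding) := by
      ext j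
      simp only [mem_erase, mem_univ, and_true, mem_map, true_and, Function.Embedding.trans_apply,
        Equiv.coe_toEmbedding]
      constructor
      · intro hj
        refine ⟨(σ⁻¹ j).castPred ?_, ?_⟩
        · intro e; apply hj; rw [← e]; simp
        · simp
      · rintro ⟨i, rfl⟩ e
        exact (Fin.castSucc_lt_last i).ne (σ.injective e)
    rw [e, prod_map]
    rfl
  rw [herase, herase] at key
  have hr₀ : (finRotate (m + 1))⁻¹ 0 = Fin.last m := by
    rw [Equiv.Perm.inv_eq_iff_eq]; simp
  have hrs : ∀ k : Fin m, (finRotate (m + 1))⁻¹ k.succ = k.castSucc := by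
    intro k
    rw [Equiv.Perm.inv_eq_iff_eq]
    simp
  have hne : ∀ k : Fin m, σ k.castSucc ≠ σ (Fin.last m) := fun k e =>
    (Fin.castSucc_lt_last k).ne (σ.injective e)
  unfold sigmaTerm
  rw [deltaGamma_snoc, deltaGamma_cons, Fin.prod_univ_castSucc, Fin.prod_univ_succ]
  simp only [Equiv.Perm.mul_apply, hr₀, hrs, h₀, hf, point_add_single, hne, if_false, if_true]
  generalize powerPart τ α γ (u + Pi.single (σ (Fin.last m)) 1) *
    pairPart τ γ (point τ (u + Pi.single (σ (Fin.last m)) 1)) = Q' at *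
  generalize powerPart τ α γ u * pairPart τ γ (point τ u) = Q at *
  have hg := qpow_ne_zero τ γ
  have e₁ : ∀ i : Fin m, point τ u (σ i.castSucc) - qpow τ (-γ) *
      (qpow τ 1 * point τ u (σ (Fin.last m))) =
      point τ u (σ i.castSucc) - qpow τ (1 - γ) * point τ u (σ (Fin.last m)) := by
    intro i
    rw [sub_eq_add_neg 1 γ, qpow_add]
    ring
  have e₂ : ∏ i : Fin m, (point τ u (σ i.castSucc) - qpow τ γ * point τ u (σ (Fin.last m))) =
      (-qpow τ γ) ^ m * ∏ i : Fin m, (point τ u (σ (Fin.last m)) -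
        qpow τ (-γ) * point τ u (σ i.castSucc)) := by
    rw [← Fin.prod_const, ← prod_mul_distrib]
    refine prod_congr rfl fun i _ => ?_
    rw [qpow_neg]
    field_simp
    ring
  have e₃ : qpow τ (α - 2 * (((m + 1 : ℕ) : ℂ) - 1) * γ) * (-qpow τ γ) ^ m =
      (-1) ^ m * qpow τ (α - m * γ) := by
    rw [neg_pow, ← qpow_nat_mul, mul_left_comm, ← qpow_add]
    congr 2
    push_cast
    ring
  rw [e₂] at key
  rw [prod_congr rfl fun i _ => e₁ i, ← e₃]
  linear_combination (∏ k : Fin m, f k.castSucc (point τ u (σ k.castSucc))) *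
    f (Fin.last m) (qpow τ 1 * point τ u (σ (Fin.last m))) *
    deltaGamma τ γ (fun k : Fin m => point τ u (σ k.castSucc)) * key

/-- The point `u + ν` of the lattice through `u`. -/
def latticePoint (u : Fin n → ℂ) (ν : Fin n → ℤ) : Fin n → ℂ := fun k => u k + (ν k : ℂ)

theorem point_latticePoint (u : Fin n → ℂ) (ν : Fin n → ℤ) (k : Fin n) :
    point τ (latticePoint u ν) k = qpow τ (ν k) * point τ u k := by
  simp [point, latticePoint, qpow_add, mul_comm]

theorem AvoidsPairPoles.latticePoint {u : Fin n → ℂ} (h : AvoidsPairPoles τ γ (point τ u))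
    (ν : Fin n → ℤ) : AvoidsPairPoles τ γ (point τ (latticePoint u ν)) := by
  intro i j hij m e
  apply h i j hij (m - ν j + ν i)
  rw [point_latticePoint, point_latticePoint] at e
  have h₁ := qpow_ne_zero τ (ν i)
  have h₂ := qpow_ne_zero τ (ν j)
  have h₃ := point_ne_zero τ u i
  push_cast
  rw [qpow_add, qpow_sub]
  field_simp at e ⊢
  linear_combination e

theorem latticePoint_add_single (u : Fin n → ℂ) (ν : Fin n → ℤ) (a : Fin n) :
    latticePoint u (ν + Pi.single a 1) = latticePoint u ν + Pi.single a 1 := by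
  funext k
  by_cases h : k = a
  · subst h; simp [latticePoint, add_assoc]
  · simp [latticePoint, h]

theorem sigmaTerm_comp_addRight (hτ : 0 < τ.im) {m : ℕ} {f f' : Fin (m + 1) → ℂ → ℂ}
    (h₀ : ∀ t, f' 0 t = f (Fin.last m) (qpow τ 1 * t))
    (hf : ∀ (k : Fin m) (t : ℂ), f' k.succ t = f k.castSucc t) (σ : Equiv.Perm (Fin (m + 1)))
    (u : Fin (m + 1) → ℂ) (h : AvoidsPairPoles τ γ (point τ u)) :
    (fun ν => sigmaTerm τ α γ f σ (latticePoint u ν)) ∘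
        (Equiv.addRight (Pi.single (σ (Fin.last m)) 1)) =
      fun ν => (-1) ^ m * qpow τ (α - m * γ) *
        sigmaTerm τ α γ f' (σ * (finRotate (m + 1))⁻¹) (latticePoint u ν) := by
  funext ν
  rw [Function.comp_apply, Equiv.coe_addRight, latticePoint_add_single,
    sigmaTerm_rotate hτ h₀ hf σ _ (h.latticePoint ν)]

/-- Convergence is carried along the rotations so that the final integral may be split into the
integrals of the φ_r. -/
theorem summable_sigmaTerm_rotate (hτ : 0 < τ.im) {m : ℕ} {f f' : Fin (m + 1) → ℂ → ℂ}
    (h₀ : ∀ t, f' 0 t = f (Fin.last m) (qpow τ 1 * t))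
    (hf : ∀ (k : Fin m) (t : ℂ), f' k.succ t = f k.castSucc t)
    (u : Fin (m + 1) → ℂ) (h : AvoidsPairPoles τ γ (point τ u))
    (hs : ∀ σ, Summable fun ν => sigmaTerm τ α γ f σ (latticePoint u ν))
    (σ : Equiv.Perm (Fin (m + 1))) :
    Summable fun ν => sigmaTerm τ α γ f' σ (latticePoint u ν) := by
  have e := hs (σ * finRotate (m + 1))
  rw [← Equiv.summable_iff (Equiv.addRight (Pi.single ((σ * finRotate (m + 1)) (Fin.last m)) 1)),
    sigmaTerm_comp_addRight hτ h₀ hf _ u h, summable_mul_left_iff, mul_inv_cancel_right] at e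
  · exact e
  · exact mul_ne_zero (pow_ne_zero _ (by norm_num)) (qpow_ne_zero _ _)

/-- The Jackson integral of the alternating sum, up to the factor `(1 - q)^n`, summed term by
term. -/
def altJackson (τ α γ : ℂ) (f : Fin n → ℂ → ℂ) (u : Fin n → ℂ) : ℂ :=
  ∑ σ : Equiv.Perm (Fin n), ((Equiv.Perm.sign σ : ℤ) : ℂ) *
    ∑' ν : Fin n → ℤ, sigmaTerm τ α γ f σ (latticePoint u ν)

/-- Each inner sum is translated by one lattice step, and the sign (-1)^m of `sigmaTerm_rotate` is
the sign of the cycle of length m + 1. Neither translation nor multiplication by a constant needs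
convergence. -/
theorem altJackson_rotate (hτ : 0 < τ.im) {m : ℕ} {f f' : Fin (m + 1) → ℂ → ℂ}
    (h₀ : ∀ t, f' 0 t = f (Fin.last m) (qpow τ 1 * t))
    (hf : ∀ (k : Fin m) (t : ℂ), f' k.succ t = f k.castSucc t)
    (u : Fin (m + 1) → ℂ) (h : AvoidsPairPoles τ γ (point τ u)) :
    altJackson τ α γ f u = qpow τ (α - m * γ) * altJackson τ α γ f' u := by
  unfold altJackson
  conv_rhs => rw [← Equiv.sum_comp (Equiv.mulRight (finRotate (m + 1))⁻¹)]
  rw [mul_sum]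
  refine sum_congr rfl fun σ _ => ?_
  rw [← Equiv.tsum_eq (Equiv.addRight (Pi.single (σ (Fin.last m)) 1))
    (fun ν => sigmaTerm τ α γ f σ (latticePoint u ν))]
  have e := sigmaTerm_comp_addRight (α := α) hτ h₀ hf σ u h
  have e' : ∑' ν : Fin (m + 1) → ℤ, sigmaTerm τ α γ f σ
      (latticePoint u ((Equiv.addRight (Pi.single (σ (Fin.last m)) 1)) ν)) =
      ∑' ν, (-1) ^ m * qpow τ (α - m * γ) *
        sigmaTerm τ α γ f' (σ * (finRotate (m + 1))⁻¹) (latticePoint u ν) :=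
    congrArg tsum e
  rw [e', tsum_mul_left, Equiv.coe_mulRight, Equiv.Perm.sign_mul, Equiv.Perm.sign_inv,
    sign_finRotate]
  push_cast
  ring

end rotation

/-! ### The q-difference system -/

section system

variable {n : ℕ} {τ α β₁ β₂ γ x₁ x₂ : ℂ}

/-- The factor of `PhiReg` belonging to one variable. -/
def varFactor (τ β₁ β₂ x₁ x₂ t : ℂ) : ℂ :=
  pochInf (qpow τ 1 * (t / x₁)) (qpow τ 1) / pochInf (t * qpow τ β₁ / x₁) (qpow τ 1) *
    (pochInf (qpow τ 1 * (t / x₂)) (qpow τ 1) / pochInf (t * qpow τ β₂ / x₂) (qpow τ 1))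

theorem PhiReg_eq (u : Fin n → ℂ) (σ : Equiv.Perm (Fin n)) :
    PhiReg τ α β₁ β₂ γ x₁ x₂ u = powerPart τ α γ u * pairPart τ γ (point τ u) *
      ∏ k, varFactor τ β₁ β₂ x₁ x₂ (point τ u (σ k)) := by
  rw [Equiv.prod_comp σ (fun k => varFactor τ β₁ β₂ x₁ x₂ (point τ u k)), PhiReg]
  simp only [varFactor]
  ring

/-- The linear factor at the position `k` of `numTerm`. -/
def numFactor (n : ℕ) (τ β₂ x₁ x₂ : ℂ) (s k : ℕ) (t : ℂ) : ℂ :=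
  if k < n - s then 1 - qpow τ β₂ * t / x₂ else 1 - t / x₁

/-- The summand of the alternating sum into which the shift of `x₂` and the rotations turn
`numTerm`. -/
def psiTerm (τ β₁ γ x₁ x₂ : ℂ) (s : ℕ) (t : Fin n → ℂ) : ℂ :=
  (∏ k : Fin n, if (k : ℕ) < s then 1 - qpow τ β₁ / x₁ * t k else 1 - 1 / x₂ * t k) *
    deltaGamma τ γ t

theorem sigmaTerm_congr {f f' : Fin n → ℂ → ℂ} (σ : Equiv.Perm (Fin n)) (u : Fin n → ℂ)
    (h : ∀ k l, f k (point τ u l) = f' k (point τ u l)) :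
    sigmaTerm τ α γ f σ u = sigmaTerm τ α γ f' σ u := by
  simp only [sigmaTerm, h]

theorem PhiReg_mul_numTerm (s : Fin (n + 1)) (σ : Equiv.Perm (Fin n)) (u : Fin n → ℂ) :
    PhiReg τ α β₁ β₂ γ x₁ x₂ u * numTerm τ β₂ γ x₁ x₂ s (fun k => point τ u (σ k)) =
      sigmaTerm τ α γ (fun k t => varFactor τ β₁ β₂ x₁ x₂ t * numFactor n τ β₂ x₁ x₂ s k t) σ u := by
  rw [PhiReg_eq u σ, sigmaTerm, numTerm, prod_mul_distrib]
  simp only [numFactor]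
  ring

theorem PhiReg_mul_psiTerm (s : ℕ) (σ : Equiv.Perm (Fin n)) (u : Fin n → ℂ) :
    PhiReg τ α β₁ β₂ γ x₁ x₂ u * psiTerm τ β₁ γ x₁ x₂ s (fun k => point τ u (σ k)) =
      sigmaTerm τ α γ (fun k t => varFactor τ β₁ β₂ x₁ x₂ t *
        if (k : ℕ) < s then 1 - qpow τ β₁ / x₁ * t else 1 - 1 / x₂ * t) σ u := by
  rw [PhiReg_eq u σ, sigmaTerm, psiTerm, prod_mul_distrib]
  ring

/-- The factors obtained from those of `numTerm` by `j` rotations. -/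
def rotatedFactor (n : ℕ) (τ β₁ β₂ x₁ x₂ : ℂ) (s j : ℕ) (k : Fin n) (t : ℂ) : ℂ :=
  if (k : ℕ) < j then varFactor τ β₁ β₂ x₁ x₂ (qpow τ 1 * t) * (1 - qpow τ 1 * t / x₁)
  else if (k : ℕ) < n - s + j then varFactor τ β₁ β₂ x₁ x₂ t * (1 - qpow τ β₂ * t / x₂)
  else varFactor τ β₁ β₂ x₁ x₂ t * (1 - t / x₁)

/-- One rotation at a time: as long as j < s, the last place carries a factor of the type 1 - t/x₁.
-/
theorem altJackson_rotatedFactor (hτ : 0 < τ.im) (u : Fin n → ℂ)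
    (h : AvoidsPairPoles τ γ (point τ u)) (s : ℕ) (hs : s ≤ n)
    (hsum : ∀ σ, Summable fun ν =>
      sigmaTerm τ α γ (rotatedFactor n τ β₁ β₂ x₁ x₂ s 0) σ (latticePoint u ν)) :
    ∀ j ≤ s, altJackson τ α γ (rotatedFactor n τ β₁ β₂ x₁ x₂ s 0) u =
      qpow τ (α - (n - 1) * γ) ^ j * altJackson τ α γ (rotatedFactor n τ β₁ β₂ x₁ x₂ s j) u ∧
      ∀ σ, Summable fun ν =>
        sigmaTerm τ α γ (rotatedFactor n τ β₁ β₂ x₁ x₂ s j) σ (latticePoint u ν) := by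
  intro j
  induction j with
  | zero => intro _; simpa using hsum
  | succ j ih =>
    intro hj
    obtain ⟨e, hsj⟩ := ih (by omega)
    rcases n with _ | m
    · omega
    have h₀ : ∀ t, rotatedFactor (m + 1) τ β₁ β₂ x₁ x₂ s (j + 1) 0 t =
        rotatedFactor (m + 1) τ β₁ β₂ x₁ x₂ s j (Fin.last m) (qpow τ 1 * t) := by
      intro t
      -- The last of the m + 1 places has index m, and m + 1 - s + j ≤ m because j < s.
      have h₁ : ¬ (m < j) := by omega
      have h₂ : ¬ (m < m + 1 - s + j) := by omega
      simp [rotatedFactor, h₁, h₂]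
    have hf : ∀ (k : Fin m) (t : ℂ), rotatedFactor (m + 1) τ β₁ β₂ x₁ x₂ s (j + 1) k.succ t =
        rotatedFactor (m + 1) τ β₁ β₂ x₁ x₂ s j k.castSucc t := by
      intro k t
      simp [rotatedFactor, ← add_assoc]
    refine ⟨?_, summable_sigmaTerm_rotate hτ h₀ hf u h hsj⟩
    rw [e, altJackson_rotate hτ h₀ hf u h, pow_succ, mul_assoc]
    congr 3
    push_cast
    ring

/-- The given linear factor cancels the new first factor of the denominator, and the numerator gains
1 - t/x₂. -/
theorem varFactor_shift_mul (hτ : 0 < τ.im) {t : ℂ} (h : qpow τ β₂ * t / x₂ ≠ qpow τ 1) :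
    varFactor τ β₁ β₂ x₁ (qpow τ 1 * x₂) t * (1 - qpow τ β₂ * t / (qpow τ 1 * x₂)) =
      varFactor τ β₁ β₂ x₁ x₂ t * (1 - 1 / x₂ * t) := by
  have hq := qpow_ne_zero τ 1
  have hnorm := norm_qpow_one_lt τ hτ
  have h₁ : t * qpow τ β₂ / (qpow τ 1 * x₂) = qpow τ β₂ * t / (qpow τ 1 * x₂) := by ring
  have h₂ : qpow τ 1 * (qpow τ β₂ * t / (qpow τ 1 * x₂)) = t * qpow τ β₂ / x₂ := by field_simp
  have h₃ : qpow τ 1 * (t / (qpow τ 1 * x₂)) = t / x₂ := by field_simp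
  have h₄ : 1 - qpow τ β₂ * t / (qpow τ 1 * x₂) ≠ 0 := by
    intro e
    apply h
    have : qpow τ β₂ * t / (qpow τ 1 * x₂) = qpow τ β₂ * t / x₂ / qpow τ 1 := by field_simp
    rw [this] at e
    field_simp at e ⊢
    linear_combination -e
  rw [varFactor, varFactor, h₁, h₃, pochInf_step (t / x₂) _ hnorm,
    pochInf_step (qpow τ β₂ * t / (qpow τ 1 * x₂)) _ hnorm, h₂]
  generalize 1 - qpow τ β₂ * t / (qpow τ 1 * x₂) = d at *
  generalize pochInf (t * qpow τ β₂ / x₂) (qpow τ 1) = C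
  rw [show 1 - 1 / x₂ * t = 1 - t / x₂ by ring]
  field_simp

/-- The quotient t/x₂ is unaffected when both are multiplied by q, so only the part with x₁ changes.
-/
theorem varFactor_shift_qmul (hτ : 0 < τ.im) {t : ℂ} (h : qpow τ β₁ * t / x₁ ≠ 1) :
    varFactor τ β₁ β₂ x₁ (qpow τ 1 * x₂) (qpow τ 1 * t) * (1 - qpow τ 1 * t / x₁) =
      varFactor τ β₁ β₂ x₁ x₂ t * (1 - qpow τ β₁ / x₁ * t) := by
  have hq := qpow_ne_zero τ 1
  have hnorm := norm_qpow_one_lt τ hτ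
  have h₁ : qpow τ 1 * t * qpow τ β₁ / x₁ = qpow τ 1 * (t * qpow τ β₁ / x₁) := by ring
  have h₂ : qpow τ 1 * t * qpow τ β₂ / (qpow τ 1 * x₂) = t * qpow τ β₂ / x₂ := by field_simp
  have h₃ : qpow τ 1 * (qpow τ 1 * t / (qpow τ 1 * x₂)) = qpow τ 1 * (t / x₂) := by field_simp
  have h₄ : 1 - t * qpow τ β₁ / x₁ ≠ 0 := by
    rw [mul_comm]; exact sub_ne_zero.2 h.symm
  rw [varFactor, varFactor, h₁, h₂, h₃, show qpow τ 1 * (t / x₁) = qpow τ 1 * t / x₁ by ring,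
    pochInf_step (qpow τ 1 * t / x₁) _ hnorm, pochInf_step (t * qpow τ β₁ / x₁) _ hnorm,
    show 1 - qpow τ β₁ / x₁ * t = 1 - t * qpow τ β₁ / x₁ by ring]
  generalize 1 - t * qpow τ β₁ / x₁ = d at *
  generalize pochInf (qpow τ 1 * (t * qpow τ β₁ / x₁)) (qpow τ 1) = C
  field_simp

theorem prod_ite_eq_poch_mul {p a c : ℂ} {m : ℕ} (hm : m ≤ n) (z : ℂ) :
    ∏ k : Fin n, (1 - (if (k : ℕ) < m then c else a) * p ^ (k : ℕ) * z) =
      poch (c * z) p m * poch (a * p ^ m * z) p (n - m) := by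
  obtain ⟨l, rfl⟩ := Nat.exists_eq_add_of_le hm
  rw [Fin.prod_univ_eq_prod_range (fun k => 1 - (if k < m then c else a) * p ^ k * z),
    prod_range_add, Nat.add_sub_cancel_left]
  unfold poch
  congr 1
  · refine prod_congr rfl fun k hk => ?_
    rw [if_pos (mem_range.1 hk)]
    ring
  · refine prod_congr rfl fun k _ => ?_
    rw [if_neg (by omega), pow_add]
    ring

/-- Attaching p^k to the place k turns `psiTerm` into `psiPoly` and `numTerm` into `phiPoly`, so the
one-variable expansion transfers. -/
theorem altSum_psiTerm (hx₁ : x₁ ≠ 0) (hx₂ : x₂ ≠ 0)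
    (hden : DenominatorsNonzero n τ β₁ β₂ γ x₁ x₂) (s : Fin (n + 1)) (t : Fin n → ℂ) :
    altSum (psiTerm τ β₁ γ x₁ x₂ s) t = ∑ r, altSum (numTerm τ β₂ γ x₁ x₂ r) t *
      (UR n τ β₁ β₂ γ x₁ x₂ * DR n τ β₁ β₂ γ x₁ x₂ * LR n τ β₁ β₂ γ x₁ x₂) r s := by
  have key := altSum_of_linear_relation τ γ t
    (fun k : Fin n => if (k : ℕ) < s then qpow τ β₁ / x₁ else 1 / x₂)
    (fun (r : Fin (n + 1)) (k : Fin n) =>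
      if (k : ℕ) < n - r then qpow τ β₂ / x₂ else 1 / x₁)
    (fun r => (UR n τ β₁ β₂ γ x₁ x₂ * DR n τ β₁ β₂ γ x₁ x₂ * LR n τ β₁ β₂ γ x₁ x₂) r s)
    (fun z => by
      have h := psiPoly_eq_sum_URDRLR hx₁ hx₂ hden s z
      have hs := s.2
      rw [qpow_neg, prod_ite_eq_poch_mul (by omega)]
      refine h.trans (sum_congr rfl fun r _ => ?_)
      have hr := r.2
      rw [prod_ite_eq_poch_mul (by omega), Nat.sub_sub_self (by omega)]
      rfl)
  have e₁ : ∀ u : Fin n → ℂ, psiTerm τ β₁ γ x₁ x₂ s u =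
      (∏ k : Fin n, (1 - (if (k : ℕ) < s then qpow τ β₁ / x₁ else 1 / x₂) * u k)) *
        deltaGamma τ γ u := by
    intro u
    unfold psiTerm
    congr 1
    refine prod_congr rfl fun k _ => ?_
    split_ifs <;> rfl
  have e₂ : ∀ (r : Fin (n + 1)) (u : Fin n → ℂ), numTerm τ β₂ γ x₁ x₂ r u =
      (∏ k : Fin n, (1 - (if (k : ℕ) < n - r then qpow τ β₂ / x₂ else 1 / x₁) * u k)) *
        deltaGamma τ γ u := by
    intro r u
    unfold numTerm
    congr 1
    refine prod_congr rfl fun k _ => ?_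
    split_ifs <;> ring
  rw [funext e₁, key]
  refine sum_congr rfl fun r _ => ?_
  rw [funext (e₂ r)]

/-- Termwise convergence allows exchanging the n! terms with the lattice sum; the rotations act on
the terms one by one. -/
theorem tsum_PhiReg_mul_altSum {g : (Fin n → ℂ) → ℂ} (u : Fin n → ℂ)
    (h : ∀ σ : Equiv.Perm (Fin n), Summable fun ν => PhiReg τ α β₁ β₂ γ x₁ x₂ (latticePoint u ν) *
      g (fun k => point τ (latticePoint u ν) (σ k))) :
    HasSum (fun ν => PhiReg τ α β₁ β₂ γ x₁ x₂ (latticePoint u ν) *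
        altSum g (point τ (latticePoint u ν)))
      (∑ σ : Equiv.Perm (Fin n), ((Equiv.Perm.sign σ : ℤ) : ℂ) *
        ∑' ν, PhiReg τ α β₁ β₂ γ x₁ x₂ (latticePoint u ν) *
          g (fun k => point τ (latticePoint u ν) (σ k))) := by
  have := hasSum_sum (s := univ) (fun (σ : Equiv.Perm (Fin n)) _ =>
    (h σ).hasSum.mul_left ((Equiv.Perm.sign σ : ℤ) : ℂ))
  refine this.congr_fun ?_
  intro ν
  simp only [altSum, mul_sum]
  exact sum_congr rfl fun σ _ => by ring

theorem isQKZMatrix_URDRLR (hτ : 0 < τ.im) (hx₁ : x₁ ≠ 0) (hx₂ : x₂ ≠ 0)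
    (hden : DenominatorsNonzero n τ β₁ β₂ γ x₁ x₂) :
    IsQKZMatrix τ α β₁ β₂ γ x₁ x₂
      (UR n τ β₁ β₂ γ x₁ x₂ * DR n τ β₁ β₂ γ x₁ x₂ * LR n τ β₁ β₂ γ x₁ x₂ *
        diagAlpha n τ α γ) := by
  rintro u ⟨⟨hav, hpair⟩, hc₁, hc₂⟩
  have hlat : ∀ ν, AvoidsPairPoles τ γ (point τ (latticePoint u ν)) :=
    fun ν => AvoidsPairPoles.latticePoint hpair ν
  funext s
  have hs := s.2
  have hσ : ∀ σ, Summable fun ν =>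
      sigmaTerm τ α γ (rotatedFactor n τ β₁ β₂ x₁ (qpow τ 1 * x₂) s 0) σ (latticePoint u ν) := by
    intro σ
    refine (hc₂ s σ).congr fun ν => ?_
    have := PhiReg_mul_numTerm (τ := τ) (α := α) (β₁ := β₁) (β₂ := β₂) (γ := γ) (x₁ := x₁)
      (x₂ := qpow τ 1 * x₂) s σ (latticePoint u ν)
    refine this.trans ?_
    refine sigmaTerm_congr σ _ fun k l => ?_
    simp only [rotatedFactor, numFactor, Nat.not_lt_zero, if_false, add_zero]
    split_ifs <;> rfl
  obtain ⟨e, hsum⟩ := altJackson_rotatedFactor hτ u hpair s (by omega) hσ s le_rfl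
  -- After s rotations n - s + s = n, so no place of the third type is left, and each remaining type
  -- is rewritten with Φ at the unshifted x₂.
  have hpsi : ∀ σ ν, sigmaTerm τ α γ (rotatedFactor n τ β₁ β₂ x₁ (qpow τ 1 * x₂) s s) σ
      (latticePoint u ν) = PhiReg τ α β₁ β₂ γ x₁ x₂ (latticePoint u ν) *
        psiTerm τ β₁ γ x₁ x₂ s (fun k => point τ (latticePoint u ν) (σ k)) := by
    intro σ ν
    rw [PhiReg_mul_psiTerm]
    refine sigmaTerm_congr σ _ fun k l => ?_
    have hk := k.2
    have h₁ : qpow τ β₁ * point τ (latticePoint u ν) l / x₁ ≠ 1 := by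
      intro e
      apply (hav l (-ν l)).1
      rw [point_latticePoint] at e
      have := qpow_ne_zero τ (ν l)
      push_cast
      rw [qpow_neg]
      field_simp at e ⊢
      linear_combination e
    have h₂ : qpow τ β₂ * point τ (latticePoint u ν) l / x₂ ≠ qpow τ 1 := by
      intro e
      apply (hav l (1 - ν l)).2
      rw [point_latticePoint] at e
      have := qpow_ne_zero τ (ν l)
      push_cast
      rw [qpow_sub]
      field_simp at e ⊢
      linear_combination e
    simp only [rotatedFactor]
    split_ifs with i₁ i₂
    · exact varFactor_shift_qmul hτ h₁
    · exact varFactor_shift_mul hτ h₂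
    · omega
  have hL : ∑' ν, integrand τ α β₁ β₂ γ x₁ (qpow τ 1 * x₂) s (latticePoint u ν) =
      altJackson τ α γ (rotatedFactor n τ β₁ β₂ x₁ (qpow τ 1 * x₂) s 0) u := by
    refine (tsum_PhiReg_mul_altSum u (hc₂ s)).tsum_eq.trans ?_
    unfold altJackson
    refine sum_congr rfl fun σ _ => ?_
    congr 1
    refine tsum_congr fun ν => ?_
    rw [PhiReg_mul_numTerm]
    refine sigmaTerm_congr σ _ fun k l => ?_
    simp only [rotatedFactor, numFactor, Nat.not_lt_zero, if_false, add_zero]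
    split_ifs <;> rfl
  have hR : altJackson τ α γ (rotatedFactor n τ β₁ β₂ x₁ (qpow τ 1 * x₂) s s) u =
      ∑ r, (∑' ν, integrand τ α β₁ β₂ γ x₁ x₂ r (latticePoint u ν)) *
        (UR n τ β₁ β₂ γ x₁ x₂ * DR n τ β₁ β₂ γ x₁ x₂ * LR n τ β₁ β₂ γ x₁ x₂) r s := by
    simp only [altJackson, hpsi]
    simp only [hpsi] at hsum
    rw [← (tsum_PhiReg_mul_altSum u hsum).tsum_eq]
    simp only [altSum_psiTerm hx₁ hx₂ hden, mul_sum]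
    rw [Summable.tsum_finsetSum]
    · refine sum_congr rfl fun r _ => ?_
      rw [← tsum_mul_right]
      exact tsum_congr fun ν => by rw [integrand]; ring
    · intro r _
      have := ((tsum_PhiReg_mul_altSum u (hc₁ r)).summable.mul_right
        ((UR n τ β₁ β₂ γ x₁ x₂ * DR n τ β₁ β₂ γ x₁ x₂ * LR n τ β₁ β₂ γ x₁ x₂) r s))
      exact this.congr fun ν => by ring
  have hphi : ∀ (x : ℂ) (r : Fin (n + 1)), phiTilde τ α β₁ β₂ γ u x₁ x r = (1 - qpow τ 1) ^ n *
      ∑' ν, integrand τ α β₁ β₂ γ x₁ x r (latticePoint u ν) := fun x r => rfl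
  rw [shiftTwo, hphi, hL, e, hR, vecMul, dotProduct]
  simp only [diagAlpha, diag, Matrix.mul_diagonal, hphi, mul_sum]
  refine sum_congr rfl fun r _ => ?_
  rw [qpow_mul_nat]
  ring

end system

/-! ### Growth of the integrand on a cone and power series in q^α -/

open Filter Topology

theorem norm_poch_le {c : ℂ} (hc : ‖c‖ < 1) (x : ℂ) (m : ℕ) :
    ‖poch x c m‖ ≤ Real.exp (‖x‖ / (1 - ‖c‖)) := by
  unfold poch
  rw [norm_prod]
  calc ∏ i ∈ range m, ‖1 - c ^ i * x‖ ≤ ∏ i ∈ range m, (1 + ‖c‖ ^ i * ‖x‖) := by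
        refine prod_le_prod (fun _ _ => norm_nonneg _) fun i _ => ?_
        refine (norm_sub_le _ _).trans ?_
        simp
    _ ≤ Real.exp (∑ i ∈ range m, ‖c‖ ^ i * ‖x‖) :=
        Real.prod_one_add_le_exp_sum _ fun i => by positivity
    _ ≤ Real.exp (‖x‖ / (1 - ‖c‖)) := by
        apply Real.exp_le_exp.2
        rw [← sum_mul, div_eq_inv_mul]
        refine mul_le_mul_of_nonneg_right ?_ (norm_nonneg _)
        rw [← tsum_geometric_of_lt_one (norm_nonneg c) hc]
        exact (summable_geometric_of_lt_one (norm_nonneg c) hc).sum_le_tsum _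
          fun i _ => by positivity

theorem norm_pochInf_le {c : ℂ} (hc : ‖c‖ < 1) (x : ℂ) :
    ‖pochInf x c‖ ≤ Real.exp (‖x‖ / (1 - ‖c‖)) :=
  le_of_tendsto (multipliable_pochInf x c hc).hasProd.tendsto_prod_nat.norm
    (Eventually.of_forall fun m => norm_poch_le hc x m)

theorem pochInf_ne_zero {c : ℂ} (hc : ‖c‖ < 1) {x : ℂ} (h : ∀ l : ℕ, c ^ l * x ≠ 1) :
    pochInf x c ≠ 0 := by
  have := tprod_one_add_ne_zero_of_summable (f := fun ν : ℕ => -(c ^ ν * x))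
    (fun ν e => h ν (by linear_combination -e))
    (by
      simp only [norm_neg, norm_mul, norm_pow]
      exact (summable_geometric_of_lt_one (norm_nonneg c) hc).mul_right _)
  simpa only [pochInf, ← sub_eq_add_neg] using this

theorem pochInf_eq_zero {c : ℂ} (hc : ‖c‖ < 1) {x : ℂ} (l : ℕ) (h : c ^ l * x = 1) :
    pochInf x c = 0 := by
  rw [pochInf_eq_poch_mul x c hc (l + 1), poch_succ, h]
  simp

theorem norm_pow_mul_le_norm {c : ℂ} (hc : ‖c‖ < 1) (y : ℂ) (l : ℕ) : ‖c ^ l * y‖ ≤ ‖y‖ := by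
  rw [norm_mul, norm_pow]
  exact mul_le_of_le_one_left (norm_nonneg _) (pow_le_one₀ (norm_nonneg _) hc.le)

/-- Geometric growth of a quotient of infinite products along a `q`-lattice. -/
theorem exists_pochInf_ratio_bound {c : ℂ} (hc : ‖c‖ < 1) (hc₀ : c ≠ 0) (y : ℂ) {y' : ℂ}
    (hy' : y' ≠ 0) (h : ∀ m : ℤ, c ^ m * y' ≠ 1) :
    ∃ C M : ℝ, 1 ≤ M ∧ ∀ m : ℤ,
      ‖pochInf (c ^ m * y) c / pochInf (c ^ m * y') c‖ ≤ C * M ^ m.natAbs := by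
  have hne : pochInf y' c ≠ 0 := pochInf_ne_zero hc fun l => by simpa using h l
  -- For m = -l, the quotient of products contains l extra factors (c^j - y)/(c^j - y'), 1 ≤ j ≤ l.
  -- They converge as j → ∞, hence are bounded by some K, which gives growth at most max(1, K)^l.
  have hlim : Tendsto (fun j : ℕ => (c ^ j - y) / (c ^ j - y')) atTop (𝓝 ((0 - y) / (0 - y'))) := by
    have := tendsto_pow_atTop_nhds_zero_of_norm_lt_one hc
    exact (this.sub_const y).div (this.sub_const y') (by simpa using hy')
  obtain ⟨K, hK⟩ := (Metric.isBounded_range_of_tendsto _ hlim).exists_norm_le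
  -- For m = l ≥ 0 the quotient is bounded: 1/(c^l y';c)_∞ = (y';c)_l/(y';c)_∞, and finite products
  -- are bounded uniformly in l.
  let A := Real.exp (‖y‖ / (1 - ‖c‖)) * (Real.exp (‖y'‖ / (1 - ‖c‖)) / ‖pochInf y' c‖)
  have hA : 0 ≤ A := by positivity
  refine ⟨A + ‖pochInf y c / pochInf y' c‖, max 1 K, le_max_left _ _, fun m => ?_⟩
  have hM : (1 : ℝ) ≤ max 1 K ^ m.natAbs := one_le_pow₀ (le_max_left _ _)
  rcases Int.eq_nat_or_neg m with ⟨l, rfl | rfl⟩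
  · rw [zpow_natCast] at *
    have h₁ : ‖pochInf (c ^ l * y) c‖ ≤ Real.exp (‖y‖ / (1 - ‖c‖)) := by
      refine (norm_pochInf_le hc _).trans (Real.exp_le_exp.2 ?_)
      exact div_le_div_of_nonneg_right (norm_pow_mul_le_norm hc y l) (by linarith)
    have h₂ : ‖pochInf (c ^ l * y') c‖⁻¹ ≤ Real.exp (‖y'‖ / (1 - ‖c‖)) / ‖pochInf y' c‖ := by
      have e := pochInf_eq_poch_mul y' c hc l
      have hp : pochInf (c ^ l * y') c ≠ 0 := fun e' => hne (by rw [e, e', mul_zero])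
      have hq : poch y' c l ≠ 0 := fun e' => hne (by rw [e, e', zero_mul])
      rw [e, norm_mul, inv_eq_one_div, div_le_div_iff₀ (norm_pos_iff.2 hp)
        (mul_pos (norm_pos_iff.2 hq) (norm_pos_iff.2 hp)), one_mul]
      exact mul_le_mul_of_nonneg_right (norm_poch_le hc y' l) (norm_nonneg _)
    rw [norm_div, div_eq_mul_inv]
    calc _ ≤ A := mul_le_mul h₁ h₂ (by positivity) (by positivity)
      _ ≤ A + ‖pochInf y c / pochInf y' c‖ := by linarith [norm_nonneg (pochInf y c / pochInf y' c)]
      _ ≤ _ := le_mul_of_one_le_right (by positivity) hM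
  · have hcl := pow_ne_zero l hc₀
    have e : ∀ x : ℂ, pochInf (c ^ (-(l : ℤ)) * x) c =
        poch (c ^ (-(l : ℤ)) * x) c l * pochInf x c := by
      intro x
      rw [pochInf_eq_poch_mul _ c hc l, _root_.zpow_neg, zpow_natCast, mul_inv_cancel_left₀ hcl]
    rw [e, e, mul_div_mul_comm, norm_mul]
    have h₁ : ‖poch (c ^ (-(l : ℤ)) * y) c l / poch (c ^ (-(l : ℤ)) * y') c l‖ ≤ max 1 K ^ l := by
      unfold poch
      rw [← prod_div_distrib, norm_prod]
      calc _ ≤ ∏ _i ∈ range l, max 1 K := by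
            refine prod_le_prod (fun _ _ => norm_nonneg _) fun i hi => ?_
            have hi' := mem_range.1 hi
            have hci := pow_ne_zero (l - i) hc₀
            have hs : ∀ x : ℂ, 1 - c ^ i * (c ^ (-(l : ℤ)) * x) =
                (c ^ (l - i) - x) / c ^ (l - i) := by
              intro x
              have : c ^ l = c ^ i * c ^ (l - i) := by rw [← pow_add]; congr 1; omega
              rw [_root_.zpow_neg, zpow_natCast, this]
              have := pow_ne_zero i hc₀
              field_simp
            rw [hs, hs, div_div_div_cancel_right₀ hci]
            exact (hK _ ⟨l - i, rfl⟩).trans (le_max_right _ _)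
        _ = max 1 K ^ l := by simp
    rw [Int.natAbs_neg, Int.natAbs_natCast, mul_comm]
    refine mul_le_mul ?_ h₁ (norm_nonneg _) (by positivity)
    linarith

/-- At most geometric growth of a function on the cone `ℕ^n`. -/
def GeoBound {n : ℕ} (f : (Fin n → ℕ) → ℂ) : Prop :=
  ∃ C M : ℝ, 1 ≤ M ∧ ∀ ν, ‖f ν‖ ≤ C * M ^ ∑ k, ν k

namespace GeoBound

variable {n : ℕ} {f g : (Fin n → ℕ) → ℂ}

theorem of_norm_le (C : ℝ) (h : ∀ ν, ‖f ν‖ ≤ C) : GeoBound f :=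
  ⟨C, 1, le_rfl, by simpa using h⟩

theorem const (a : ℂ) : GeoBound fun _ : Fin n → ℕ => a := of_norm_le ‖a‖ fun _ => le_rfl

theorem mul (hf : GeoBound f) (hg : GeoBound g) : GeoBound fun ν => f ν * g ν := by
  obtain ⟨C, M, hM, h⟩ := hf
  obtain ⟨C', M', hM', h'⟩ := hg
  refine ⟨C * C', M * M', one_le_mul_of_one_le_of_one_le hM hM', fun ν => ?_⟩
  rw [norm_mul, mul_pow]
  calc _ ≤ (C * M ^ ∑ k, ν k) * (C' * M' ^ ∑ k, ν k) :=
        mul_le_mul (h ν) (h' ν) (norm_nonneg _) ((norm_nonneg _).trans (h ν))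
    _ = _ := by ring

theorem add (hf : GeoBound f) (hg : GeoBound g) : GeoBound fun ν => f ν + g ν := by
  obtain ⟨C, M, hM, h⟩ := hf
  obtain ⟨C', M', hM', h'⟩ := hg
  have hC : 0 ≤ C := by simpa using (norm_nonneg _).trans (h 0)
  have hC' : 0 ≤ C' := by simpa using (norm_nonneg _).trans (h' 0)
  refine ⟨C + C', max M M', hM.trans (le_max_left _ _), fun ν => ?_⟩
  refine (norm_add_le _ _).trans ?_
  rw [add_mul]
  refine add_le_add ((h ν).trans ?_) ((h' ν).trans ?_)
  · exact mul_le_mul_of_nonneg_left (pow_le_pow_left₀ (by linarith) (le_max_left _ _) _) hC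
  · exact mul_le_mul_of_nonneg_left (pow_le_pow_left₀ (by linarith) (le_max_right _ _) _) hC'

theorem prod {ι : Type*} (s : Finset ι) {F : ι → (Fin n → ℕ) → ℂ}
    (h : ∀ i ∈ s, GeoBound (F i)) : GeoBound fun ν => ∏ i ∈ s, F i ν := by
  classical
  induction s using Finset.induction_on with
  | empty => simpa using const 1
  | insert i s hi ih =>
    simp only [prod_insert hi]
    exact (h i (mem_insert_self _ _)).mul (ih fun j hj => h j (mem_insert_of_mem hj))

theorem sum {ι : Type*} (s : Finset ι) {F : ι → (Fin n → ℕ) → ℂ}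
    (h : ∀ i ∈ s, GeoBound (F i)) : GeoBound fun ν => ∑ i ∈ s, F i ν := by
  classical
  induction s using Finset.induction_on with
  | empty => simpa using const 0
  | insert i s hi ih =>
    simp only [sum_insert hi]
    exact (h i (mem_insert_self _ _)).add (ih fun j hj => h j (mem_insert_of_mem hj))

theorem sub (hf : GeoBound f) (hg : GeoBound g) : GeoBound fun ν => f ν - g ν := by
  have := hf.add ((const (-1)).mul hg)
  simpa [sub_eq_add_neg] using this

theorem pow_apply (w : ℂ) (k : Fin n) : GeoBound fun ν => w ^ ν k := by
  refine ⟨1, max 1 ‖w‖, le_max_left _ _, fun ν => ?_⟩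
  rw [norm_pow, one_mul]
  calc ‖w‖ ^ ν k ≤ max 1 ‖w‖ ^ ν k := pow_le_pow_left₀ (norm_nonneg _) (le_max_right _ _) _
    _ ≤ _ := pow_le_pow_right₀ (le_max_left _ _)
      (single_le_sum (f := ν) (fun _ _ => Nat.zero_le _) (mem_univ k))

theorem pochInf_ratio {c : ℂ} (hc : ‖c‖ < 1) (hc₀ : c ≠ 0) (y : ℂ) {y' : ℂ} (hy' : y' ≠ 0)
    (h : ∀ m : ℤ, c ^ m * y' ≠ 1) (m : (Fin n → ℕ) → ℤ) (hm : ∀ ν, (m ν).natAbs ≤ ∑ k, ν k) :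
    GeoBound fun ν => pochInf (c ^ m ν * y) c / pochInf (c ^ m ν * y') c := by
  obtain ⟨C, M, hM, hb⟩ := exists_pochInf_ratio_bound hc hc₀ y hy' h
  have hC : 0 ≤ C := by simpa using (norm_nonneg _).trans (hb 0)
  exact ⟨C, M, hM, fun ν => (hb _).trans
    (mul_le_mul_of_nonneg_left (pow_le_pow_right₀ hM (hm ν)) hC)⟩

theorem summable_pow_sum {c : ℝ} (h₀ : 0 ≤ c) (h₁ : c < 1) :
    ∀ n : ℕ, Summable fun ν : Fin n → ℕ => c ^ ∑ k, ν k
  | 0 => by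
    refine Summable.of_finite
  | n + 1 => by
    have h := (summable_geometric_of_lt_one h₀ h₁).mul_of_nonneg (summable_pow_sum h₀ h₁ n)
      (fun _ => by positivity) (fun _ => by positivity)
    rw [← (Fin.consEquiv fun _ : Fin (n + 1) => ℕ).summable_iff]
    refine h.congr fun x => ?_
    simp [Fin.consEquiv, Fin.sum_univ_succ, pow_add]

/-- For |z| ≤ 1/(2M) the growth M^{|ν|} is beaten by a factor 2^{-|ν|}, uniformly in z; this is the
dominating series below. -/
theorem eventually_bound (hf : GeoBound f) : ∃ C : ℝ, ∀ᶠ z in 𝓝 (0 : ℂ), ∀ ν,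
    ‖z ^ (∑ k, ν k) * f ν‖ ≤ C * (1 / 2) ^ ∑ k, ν k := by
  obtain ⟨C, M, hM, h⟩ := hf
  refine ⟨C, ?_⟩
  have hM' : 0 < M := by linarith
  filter_upwards [Metric.ball_mem_nhds (0 : ℂ) (show 0 < 1 / (2 * M) by positivity)] with z hz ν
  have hz' : ‖z‖ ≤ 1 / (2 * M) := by simpa using (mem_ball_zero_iff.1 hz).le
  rw [norm_mul, norm_pow]
  calc _ ≤ (1 / (2 * M)) ^ (∑ k, ν k) * (C * M ^ ∑ k, ν k) :=
        mul_le_mul (pow_le_pow_left₀ (norm_nonneg _) hz' _) (h ν) (norm_nonneg _) (by positivity)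
    _ = C * (1 / (2 * M) * M) ^ (∑ k, ν k) := by rw [mul_pow]; ring
    _ = _ := by congr 2; field_simp

theorem eventually_summable (hf : GeoBound f) :
    ∀ᶠ z in 𝓝 (0 : ℂ), Summable fun ν => z ^ (∑ k, ν k) * f ν := by
  obtain ⟨C, h⟩ := hf.eventually_bound
  filter_upwards [h] with z hz
  exact Summable.of_norm_bounded
    ((summable_pow_sum (by norm_num) (by norm_num) n).mul_left C) hz

/-- Dominated convergence; at z = 0 only the vertex ν = 0 of the cone contributes. -/
theorem tendsto_tsum (hf : GeoBound f) :
    Tendsto (fun z : ℂ => ∑' ν, z ^ (∑ k, ν k) * f ν) (𝓝 0) (𝓝 (f 0)) := by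
  obtain ⟨C, h⟩ := hf.eventually_bound
  have key := tendsto_tsum_of_dominated_convergence (𝓕 := 𝓝 (0 : ℂ))
    (f := fun z (ν : Fin n → ℕ) => z ^ (∑ k, ν k) * f ν)
    (g := fun ν => (0 : ℂ) ^ (∑ k, ν k) * f ν)
    ((summable_pow_sum (c := 1 / 2) (by norm_num) (by norm_num) n).mul_left C)
    (fun ν => ((continuous_pow _).tendsto 0).mul_const _) h
  rw [tsum_eq_single 0] at key
  · simpa using key
  · intro ν hν
    have : ∑ k, ν k ≠ 0 := by
      intro e
      apply hν
      funext k
      exact (sum_eq_zero_iff.1 e) k (mem_univ k)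
    rw [zero_pow this, zero_mul]

end GeoBound

section growth

variable {n : ℕ} {τ α β₁ β₂ γ x₁ x₂ : ℂ}

/-- The point of `ℤ^n` with the coordinates of a point of `ℕ^n`. -/
def natLattice (ν : Fin n → ℕ) : Fin n → ℤ := fun k => (ν k : ℤ)

theorem natLattice_injective : Function.Injective (natLattice (n := n)) := fun ν μ h => by
  funext k
  exact Nat.cast_injective (R := ℤ) (congrFun h k)

theorem qpow_intCast (τ : ℂ) (m : ℤ) : qpow τ m = qpow τ 1 ^ m := by
  rw [← qpow_int_mul, mul_one]

/-- The parameter α enters Φ only through ∏_k t_k^α, so the sum over the cone is a power series in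
q^α with coefficients taken at α = 0. -/
theorem PhiReg_latticePoint (u : Fin n → ℂ) (ν : Fin n → ℕ) :
    PhiReg τ α β₁ β₂ γ x₁ x₂ (latticePoint u (natLattice ν)) =
      qpow τ (α * ∑ k, u k) * (qpow τ α ^ (∑ k, ν k) *
        PhiReg τ 0 β₁ β₂ γ x₁ x₂ (latticePoint u (natLattice ν))) := by
  have e : powerPart τ α γ (latticePoint u (natLattice ν)) =
      qpow τ (α * ∑ k, u k) * qpow τ α ^ (∑ k, ν k) *
        powerPart τ 0 γ (latticePoint u (natLattice ν)) := by
    have hs : qpow τ (α * ∑ k, u k) * qpow τ α ^ (∑ k, ν k) =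
        ∏ k, qpow τ (α * (u k + ν k)) := by
      rw [← prod_pow_eq_pow_sum, mul_sum]
      have : ∀ s : Finset (Fin n), qpow τ (∑ k ∈ s, α * u k) = ∏ k ∈ s, qpow τ (α * u k) := by
        intro s
        induction s using Finset.induction_on with
        | empty => simp [qpow_zero]
        | insert i s hi ih => rw [sum_insert hi, prod_insert hi, qpow_add, ih]
      rw [this, ← prod_mul_distrib]
      refine prod_congr rfl fun k _ => ?_
      rw [mul_add, qpow_add, qpow_mul_nat]
    rw [hs, powerPart, powerPart, ← prod_mul_distrib]
    refine prod_congr rfl fun k _ => ?_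
    rw [← qpow_add]
    congr 1
    simp only [expo, latticePoint, natLattice]
    push_cast
    ring
  unfold PhiReg
  rw [e]
  ring

theorem geoBound_point (hτ : 0 < τ.im) (u : Fin n → ℂ) (k : Fin n) :
    GeoBound fun ν => point τ (latticePoint u (natLattice ν)) k :=
  GeoBound.of_norm_le ‖point τ u k‖ fun ν => by
    rw [point_latticePoint, qpow_intCast, natLattice, zpow_natCast]
    exact norm_pow_mul_le_norm (norm_qpow_one_lt τ hτ) _ _

theorem geoBound_numTerm (hτ : 0 < τ.im) (u : Fin n → ℂ) (s : Fin (n + 1))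
    (σ : Equiv.Perm (Fin n)) :
    GeoBound fun ν => numTerm τ β₂ γ x₁ x₂ s
      (fun k => point τ (latticePoint u (natLattice ν)) (σ k)) := by
  refine GeoBound.mul (GeoBound.prod _ fun k _ => ?_) (GeoBound.prod _ fun i _ =>
    GeoBound.prod _ fun j _ => ?_)
  · have h := geoBound_point hτ u (σ k)
    split_ifs
    · simpa only [div_eq_mul_inv] using
        (GeoBound.const 1).sub (((GeoBound.const (qpow τ β₂)).mul h).mul (GeoBound.const x₂⁻¹))
    · simpa only [div_eq_mul_inv] using (GeoBound.const 1).sub (h.mul (GeoBound.const x₁⁻¹))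
  · exact (geoBound_point hτ u _).sub ((GeoBound.const _).mul (geoBound_point hτ u _))

theorem geoBound_altSum_numTerm (hτ : 0 < τ.im) (u : Fin n → ℂ) (s : Fin (n + 1)) :
    GeoBound fun ν => altSum (numTerm τ β₂ γ x₁ x₂ s)
      (point τ (latticePoint u (natLattice ν))) :=
  GeoBound.sum _ fun σ _ => (GeoBound.const _).mul (geoBound_numTerm hτ u s σ)

theorem geoBound_PhiReg (hτ : 0 < τ.im) (hx₁ : x₁ ≠ 0) (hx₂ : x₂ ≠ 0) (u : Fin n → ℂ)
    (h : AvoidsPoles τ β₁ β₂ γ x₁ x₂ (point τ u)) :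
    GeoBound fun ν => PhiReg τ 0 β₁ β₂ γ x₁ x₂ (latticePoint u (natLattice ν)) := by
  have hq := norm_qpow_one_lt τ hτ
  have hq₀ := qpow_ne_zero τ 1
  have avoid : ∀ {y : ℂ}, (∀ m : ℤ, y ≠ qpow τ m) → ∀ m : ℤ, qpow τ 1 ^ m * y ≠ 1 := by
    intro y hy m e
    apply hy (-m)
    rw [qpow_intCast, _root_.zpow_neg]
    exact eq_inv_of_mul_eq_one_right e
  have hν : ∀ (ν : Fin n → ℕ) k, ν k ≤ ∑ k, ν k := fun ν k =>
    single_le_sum (f := ν) (fun _ _ => Nat.zero_le _) (mem_univ k)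
  have hvar : ∀ {x β : ℂ} (k : Fin n), x ≠ 0 → (∀ m : ℤ, qpow τ β * point τ u k / x ≠ qpow τ m) →
      GeoBound fun ν : Fin n → ℕ =>
        pochInf (qpow τ 1 * (point τ (latticePoint u (natLattice ν)) k / x)) (qpow τ 1) /
        pochInf (point τ (latticePoint u (natLattice ν)) k * qpow τ β / x) (qpow τ 1) := by
    intro x β k hx hk
    have := GeoBound.pochInf_ratio hq hq₀ (qpow τ 1 * (point τ u k / x))
      (y' := point τ u k * qpow τ β / x)
      (div_ne_zero (mul_ne_zero (point_ne_zero _ _ _) (qpow_ne_zero _ _)) hx)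
      (avoid fun m => by rw [mul_comm (point τ u k)]; exact hk m) (fun ν => natLattice ν k)
      (fun ν => by simpa [natLattice] using hν ν k)
    have e₁ : ∀ ν : Fin n → ℕ, qpow τ 1 * (point τ (latticePoint u (natLattice ν)) k / x) =
        qpow τ 1 ^ natLattice ν k * (qpow τ 1 * (point τ u k / x)) := fun ν => by
      rw [point_latticePoint, qpow_intCast]; ring
    have e₂ : ∀ ν : Fin n → ℕ, point τ (latticePoint u (natLattice ν)) k * qpow τ β / x =
        qpow τ 1 ^ natLattice ν k * (point τ u k * qpow τ β / x) := fun ν => by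
      rw [point_latticePoint, qpow_intCast]; ring
    simpa only [e₁, e₂] using this
  refine GeoBound.mul (GeoBound.mul (GeoBound.prod _ fun k _ => ?_) (GeoBound.prod _ fun k _ =>
    GeoBound.mul (hvar k hx₁ fun m => (h.1 k m).1) (hvar k hx₂ fun m => (h.1 k m).2)))
    (GeoBound.prod _ fun i _ => GeoBound.prod _ fun j hj => ?_)
  · have := (GeoBound.const (qpow τ (expo 0 γ k * u k))).mul
      (GeoBound.pow_apply (qpow τ (expo 0 γ k)) k)
    convert this using 2 with ν
    rw [← qpow_mul_nat, ← qpow_add]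
    congr 1
    simp only [latticePoint, natLattice]
    push_cast
    ring
  · have hij : i < j := by simpa using hj
    have := GeoBound.pochInf_ratio hq hq₀ (qpow τ (1 - γ) * point τ u j / point τ u i)
      (y' := qpow τ γ * point τ u j / point τ u i)
      (div_ne_zero (mul_ne_zero (qpow_ne_zero _ _) (point_ne_zero _ _ _)) (point_ne_zero _ _ _))
      (avoid (h.2 i j hij)) (fun ν => natLattice ν j - natLattice ν i)
      (fun ν => by
        have h₁ := hν ν i
        have h₂ := hν ν j
        simp only [natLattice]
        omega)
    have hz := point_ne_zero τ u i
    have e : ∀ (a : ℂ) (ν : Fin n → ℕ), a * point τ (latticePoint u (natLattice ν)) j /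
        point τ (latticePoint u (natLattice ν)) i =
        qpow τ 1 ^ (natLattice ν j - natLattice ν i) * (a * point τ u j / point τ u i) := by
      intro a ν
      rw [point_latticePoint, point_latticePoint, qpow_intCast, qpow_intCast, zpow_sub₀ hq₀]
      have := zpow_ne_zero (natLattice ν i) hq₀
      field_simp
    simpa only [e] using this

end growth

/-! ### The special lattices and the support of the integrand -/

section uniqueness

variable {n : ℕ} {τ α β₁ β₂ γ x₁ x₂ y₁ y₂ : ℂ}

theorem exists_qpow_eq (hτ : 0 < τ.im) {x : ℂ} (hx : x ≠ 0) : ∃ y, qpow τ y = x := by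
  have hτ₀ : τ ≠ 0 := by rintro rfl; simp at hτ
  have hπ : (2 * (Real.pi : ℂ) * Complex.I * τ) ≠ 0 := by
    simp [Real.pi_ne_zero, hτ₀]
  refine ⟨Complex.log x / (2 * (Real.pi : ℂ) * Complex.I * τ), ?_⟩
  rw [qpow, mul_div_cancel₀ _ hπ, Complex.exp_log hx]

/-- `q ^ a` is not an integral power of `q`. -/
def NotLattice (τ a : ℂ) : Prop := ∀ m : ℤ, qpow τ (a + m) ≠ 1

theorem notLattice_iff {a : ℂ} : NotLattice τ a ↔ ∀ m : ℤ, qpow τ a ≠ qpow τ m := by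
  constructor
  · intro h m e
    apply h (-m)
    rw [qpow_add, e, ← qpow_add]
    push_cast
    rw [add_neg_cancel, qpow_zero]
  · intro h m e
    apply h (-m)
    rw [qpow_add] at e
    push_cast
    rw [qpow_neg]
    exact eq_inv_of_mul_eq_one_left e

theorem NotLattice.neg {a : ℂ} (h : NotLattice τ a) : NotLattice τ (-a) := by
  intro m e
  apply h (-m)
  have : a + ((-m : ℤ) : ℂ) = -(-a + m) := by push_cast; ring
  rw [this, qpow_neg, e, inv_one]

theorem qpow_natCast_succ_ne_one (hτ : 0 < τ.im) (l : ℕ) : qpow τ ((l : ℂ) + 1) ≠ 1 := by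
  intro e
  have h : ‖qpow τ 1 ^ (l + 1)‖ < 1 := by
    rw [norm_pow]
    exact pow_lt_one₀ (norm_nonneg _) (norm_qpow_one_lt τ hτ) (Nat.succ_ne_zero l)
  rw [← qpow_nat_mul] at h
  push_cast at h
  rw [mul_one, e, norm_one] at h
  exact lt_irrefl _ h

theorem pochInf_qpow_ne_zero (hτ : 0 < τ.im) {a : ℂ} (h : NotLattice τ a) :
    pochInf (qpow τ a) (qpow τ 1) ≠ 0 := by
  refine pochInf_ne_zero (norm_qpow_one_lt τ hτ) fun l e => h l ?_
  rwa [← qpow_nat_mul, ← qpow_add, mul_one, add_comm] at e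

theorem pochInf_qpow_one_ne_zero (hτ : 0 < τ.im) :
    pochInf (qpow τ 1) (qpow τ 1) ≠ 0 := by
  refine pochInf_ne_zero (norm_qpow_one_lt τ hτ) fun l e => qpow_natCast_succ_ne_one hτ l ?_
  rwa [← qpow_nat_mul, ← qpow_add, mul_one] at e

theorem pochInf_qpow_eq_zero (hτ : 0 < τ.im) {m : ℤ} (hm : m ≤ 0) :
    pochInf (qpow τ m) (qpow τ 1) = 0 := by
  obtain ⟨l, rfl⟩ := Int.exists_eq_neg_ofNat hm
  refine pochInf_eq_zero (norm_qpow_one_lt τ hτ) l ?_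
  rw [← qpow_nat_mul, ← qpow_add]
  push_cast
  rw [mul_one, add_neg_cancel, qpow_zero]

/-- Generic position in terms of logarithmic coordinates `y₁`, `y₂` of `x₁`, `x₂`. -/
structure LogGeneric (n : ℕ) (τ β₁ β₂ γ y₁ y₂ : ℂ) : Prop where
  gamma : ∀ k : ℤ, k ≠ 0 → |k| ≤ n → NotLattice τ (k * γ)
  beta₁ : ∀ k : ℤ, |k| ≤ n → NotLattice τ (β₁ + k * γ)
  beta₂ : ∀ k : ℤ, |k| ≤ n → NotLattice τ (β₂ + k * γ)
  diff : ∀ k : ℤ, |k| ≤ n → NotLattice τ (y₂ - y₁ + k * γ)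
  diff_beta₁ : ∀ k : ℤ, |k| ≤ n → NotLattice τ (y₂ - y₁ + β₁ + k * γ)
  diff_beta₂ : ∀ k : ℤ, |k| ≤ n → NotLattice τ (y₂ - y₁ - β₂ + k * γ)

theorem IsGeneric.logGeneric (h : IsGeneric n τ β₁ β₂ γ (qpow τ y₁) (qpow τ y₂)) :
    LogGeneric n τ β₁ β₂ γ y₁ y₂ where
  gamma k hk hkn := by
    rcases Int.eq_nat_or_neg k with ⟨l, rfl | rfl⟩
    · exact notLattice_iff.2 (by simpa using h.1 l (by omega) (by simpa using hkn))
    · have := (notLattice_iff.2 (h.1 l (by omega) (by simpa using hkn))).neg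
      simpa using this
  beta₁ k hk := notLattice_iff.2 fun m => (h.2 k hk m).1
  beta₂ k hk := notLattice_iff.2 fun m => (h.2 k hk m).2.1
  diff k hk := notLattice_iff.2 fun m => by
    have := (h.2 k hk m).2.2.1
    rwa [← qpow_sub, ← qpow_add] at this
  diff_beta₁ k hk := notLattice_iff.2 fun m => by
    have := (h.2 k hk m).2.2.2.1
    rwa [← qpow_sub, ← qpow_add, ← add_assoc] at this
  diff_beta₂ k hk := notLattice_iff.2 fun m => by
    have := (h.2 k hk m).2.2.2.2
    rwa [← qpow_sub, ← qpow_add, ← add_assoc, ← sub_eq_add_neg] at this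

/-- Logarithmic coordinates of
`(x₁, x₁ q ^ γ, …, x₁ q ^ ((r - 1) γ), x₂, x₂ q ^ γ, …, x₂ q ^ ((n - r - 1) γ))`. -/
def cycleBase (n : ℕ) (γ y₁ y₂ : ℂ) (r : ℕ) : Fin n → ℂ := fun k =>
  if (k : ℕ) < r then y₁ + (k : ℕ) * γ else y₂ + ((k : ℕ) - r : ℂ) * γ

theorem abs_le_of_bounds {k : ℤ} (h₁ : -(n : ℤ) ≤ k) (h₂ : k ≤ n) : |k| ≤ n := abs_le.2 ⟨h₁, h₂⟩

theorem avoidsPoles_cycleBase (h : LogGeneric n τ β₁ β₂ γ y₁ y₂) (r : ℕ) :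
    AvoidsPoles τ β₁ β₂ γ (qpow τ y₁) (qpow τ y₂) (point τ (cycleBase n γ y₁ y₂ r)) := by
  refine ⟨fun k m => ⟨?_, ?_⟩, fun i j hij m => ?_⟩
  · revert m
    simp only [point]
    rw [← qpow_add, ← qpow_sub, ← notLattice_iff, cycleBase]
    have := k.2
    split_ifs
    · convert h.beta₁ (k : ℕ) (abs_le_of_bounds (by omega) (by omega)) using 1
      push_cast; ring
    · convert h.diff_beta₁ ((k : ℕ) - r : ℤ) (abs_le_of_bounds (by omega) (by omega)) using 1
      push_cast; ring
  · revert m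
    simp only [point]
    rw [← qpow_add, ← qpow_sub, ← notLattice_iff, cycleBase]
    have := k.2
    split_ifs
    · convert (h.diff_beta₂ (-(k : ℕ)) (abs_le_of_bounds (by omega) (by omega))).neg using 1
      push_cast; ring
    · convert h.beta₂ ((k : ℕ) - r : ℤ) (abs_le_of_bounds (by omega) (by omega)) using 1
      push_cast; ring
  · revert m
    simp only [point]
    rw [← qpow_add, ← qpow_sub, ← notLattice_iff, cycleBase, cycleBase]
    have := j.2
    have hij' : (i : ℕ) < j := hij
    split_ifs
    · convert h.gamma (1 + (j : ℕ) - (i : ℕ) : ℤ) (by omega)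
        (abs_le_of_bounds (by omega) (by omega)) using 1
      push_cast; ring
    · omega
    · convert h.diff (1 + (j : ℕ) - r - (i : ℕ) : ℤ)
        (abs_le_of_bounds (by omega) (by omega)) using 1
      push_cast; ring
    · convert h.gamma (1 + (j : ℕ) - (i : ℕ) : ℤ) (by omega)
        (abs_le_of_bounds (by omega) (by omega)) using 1
      push_cast; ring

theorem AvoidsPoles.shift {t : Fin n → ℂ} (h : AvoidsPoles τ β₁ β₂ γ x₁ x₂ t) :
    AvoidsPoles τ β₁ β₂ γ x₁ (qpow τ 1 * x₂) t := by
  refine ⟨fun k m => ⟨(h.1 k m).1, fun e => (h.1 k (m + 1)).2 ?_⟩, h.2⟩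
  push_cast
  rw [qpow_add, ← e]
  have := qpow_ne_zero τ 1
  rw [mul_comm (qpow τ 1) x₂, ← div_div, div_mul_cancel₀ _ this]

theorem PhiReg_ne_zero_iff (u : Fin n → ℂ) : PhiReg τ α β₁ β₂ γ x₁ x₂ u ≠ 0 ↔
    (∀ k, (pochInf (qpow τ 1 * (point τ u k / x₁)) (qpow τ 1) ≠ 0 ∧
      pochInf (point τ u k * qpow τ β₁ / x₁) (qpow τ 1) ≠ 0) ∧
      pochInf (qpow τ 1 * (point τ u k / x₂)) (qpow τ 1) ≠ 0 ∧
      pochInf (point τ u k * qpow τ β₂ / x₂) (qpow τ 1) ≠ 0) ∧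
    ∀ i j, i < j →
      pochInf (qpow τ (1 - γ) * point τ u j / point τ u i) (qpow τ 1) ≠ 0 ∧
      pochInf (qpow τ γ * point τ u j / point τ u i) (qpow τ 1) ≠ 0 := by
  have hp : powerPart τ α γ u ≠ 0 := prod_ne_zero_iff.2 fun _ _ => qpow_ne_zero _ _
  simp only [PhiReg, pairPart, mul_ne_zero_iff, prod_ne_zero_iff, div_ne_zero_iff, mem_univ,
    forall_true_left, mem_Ioi, hp, ne_eq, not_false_eq_true, true_and]

theorem pochInf_ne_zero_of_avoids (hτ : 0 < τ.im) {x : ℂ} (h : ∀ m : ℤ, x ≠ qpow τ m) :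
    pochInf x (qpow τ 1) ≠ 0 := by
  refine pochInf_ne_zero (norm_qpow_one_lt τ hτ) fun l e => h (-l) ?_
  push_cast
  rw [qpow_neg, ← mul_one (l : ℂ), qpow_nat_mul]
  exact eq_inv_of_mul_eq_one_right e

/-- The arguments of the numerators are q^{1+kγ} inside a block and generic across blocks. At the
start of a block and for neighbours inside one, k = 0 and the value is (q;q)_∞ ≠ 0. -/
theorem PhiReg_cycleBase_ne_zero (hτ : 0 < τ.im) (h : LogGeneric n τ β₁ β₂ γ y₁ y₂) (r : ℕ) :
    PhiReg τ α β₁ β₂ γ (qpow τ y₁) (qpow τ y₂) (cycleBase n γ y₁ y₂ r) ≠ 0 := by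
  have ha := avoidsPoles_cycleBase h r
  have hshift : ∀ {a : ℂ}, NotLattice τ a → pochInf (qpow τ (1 + a)) (qpow τ 1) ≠ 0 := by
    intro a hNL
    refine pochInf_qpow_ne_zero hτ fun m => ?_
    convert hNL (1 + m) using 2
    push_cast; ring
  have hγ : ∀ k : ℤ, |k| ≤ n → pochInf (qpow τ (1 + k * γ)) (qpow τ 1) ≠ 0 := by
    intro k hk
    rcases eq_or_ne k 0 with rfl | hk₀
    · simpa using pochInf_qpow_one_ne_zero hτ
    · exact hshift (h.gamma k hk₀ hk)
  refine (PhiReg_ne_zero_iff _).2 ⟨fun k => ⟨⟨?_, ?_⟩, ?_, ?_⟩, fun i j hij => ⟨?_, ?_⟩⟩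
  · have := k.2
    simp only [point]
    rw [← qpow_sub, ← qpow_add, cycleBase]
    split_ifs
    · convert hγ (k : ℕ) (abs_le_of_bounds (by omega) (by omega)) using 3
      push_cast; ring
    · convert hshift (h.diff ((k : ℕ) - r : ℤ) (abs_le_of_bounds (by omega) (by omega))) using 3
      push_cast; ring
  · exact pochInf_ne_zero_of_avoids hτ fun m => by
      rw [mul_comm (point _ _ _)]; exact (ha.1 k m).1
  · have := k.2
    simp only [point]
    rw [← qpow_sub, ← qpow_add, cycleBase]
    split_ifs
    · convert hshift (h.diff (-(k : ℕ)) (abs_le_of_bounds (by omega) (by omega))).neg using 3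
      push_cast; ring
    · convert hγ ((k : ℕ) - r : ℤ) (abs_le_of_bounds (by omega) (by omega)) using 3
      push_cast; ring
  · exact pochInf_ne_zero_of_avoids hτ fun m => by
      rw [mul_comm (point _ _ _)]; exact (ha.1 k m).2
  · have := j.2
    have hij' : (i : ℕ) < j := hij
    simp only [point]
    rw [← qpow_add, ← qpow_sub, cycleBase, cycleBase]
    split_ifs
    · convert hγ ((j : ℕ) - (i : ℕ) - 1 : ℤ) (abs_le_of_bounds (by omega) (by omega)) using 3
      push_cast; ring
    · omega
    · convert hshift (h.diff ((j : ℕ) - r - (i : ℕ) - 1 : ℤ)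
        (abs_le_of_bounds (by omega) (by omega))) using 3
      push_cast; ring
    · convert hγ ((j : ℕ) - (i : ℕ) - 1 : ℤ) (abs_le_of_bounds (by omega) (by omega)) using 3
      push_cast; ring
  · exact pochInf_ne_zero_of_avoids hτ (ha.2 i j hij)

/-- At the start of a block (qt/x)_∞ vanishes for ν < 0; inside a block (q^{1-γ}t_{k+1}/t_k)_∞
vanishes as soon as ν_{k+1} < ν_k. The parameter e covers the shift x₂ ↦ q^e x₂, which only moves
the zeros to larger ν. -/
theorem nonneg_of_PhiReg_ne_zero (hτ : 0 < τ.im) {e : ℕ} (r : ℕ) (ν : Fin n → ℤ)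
    (h : PhiReg τ α β₁ β₂ γ (qpow τ y₁) (qpow τ (y₂ + e))
      (latticePoint (cycleBase n γ y₁ y₂ r) ν) ≠ 0) : ∀ (k : ℕ) (hk : k < n), 0 ≤ ν ⟨k, hk⟩ := by
  obtain ⟨h₁, h₂⟩ := (PhiReg_ne_zero_iff _).1 h
  intro k
  induction k with
  | zero =>
    intro hk
    by_contra! hneg
    rcases Nat.eq_zero_or_pos r with rfl | hr
    · apply (h₁ ⟨0, hk⟩).2.1
      rw [← pochInf_qpow_eq_zero hτ (m := 1 + ν ⟨0, hk⟩ - e) (by omega)]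
      simp only [point]
      rw [← qpow_sub, ← qpow_add, latticePoint, cycleBase, if_neg (by simp)]
      congr 2
      push_cast; ring
    · apply (h₁ ⟨0, hk⟩).1.1
      rw [← pochInf_qpow_eq_zero hτ (m := 1 + ν ⟨0, hk⟩) (by omega)]
      simp only [point]
      rw [← qpow_sub, ← qpow_add, latticePoint, cycleBase, if_pos hr]
      congr 2
      push_cast; ring
  | succ k ih =>
    intro hk
    have ih' := ih (by omega)
    by_contra! hneg
    rcases eq_or_ne (k + 1) r with rfl | hr
    · apply (h₁ ⟨k + 1, hk⟩).2.1
      rw [← pochInf_qpow_eq_zero hτ (m := 1 + ν ⟨k + 1, hk⟩ - e) (by omega)]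
      simp only [point]
      rw [← qpow_sub, ← qpow_add, latticePoint, cycleBase, if_neg (by simp)]
      congr 2
      push_cast; ring
    · apply (h₂ ⟨k, by omega⟩ ⟨k + 1, hk⟩ (by simp [Fin.lt_def])).1
      rw [← pochInf_qpow_eq_zero hτ (m := 1 + ν ⟨k + 1, hk⟩ - ν ⟨k, by omega⟩) (by omega)]
      simp only [point]
      rw [← qpow_add, ← qpow_sub, latticePoint, latticePoint, cycleBase, cycleBase]
      congr 2
      dsimp only
      split_ifs
      · push_cast; ring
      · omega
      · omega
      · push_cast; ring

theorem PhiReg_eq_zero_of_notMem_range (hτ : 0 < τ.im) (e : ℕ) (r : ℕ) (ν : Fin n → ℤ)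
    (hν : ν ∉ Set.range (natLattice (n := n))) :
    PhiReg τ α β₁ β₂ γ (qpow τ y₁) (qpow τ (y₂ + e))
      (latticePoint (cycleBase n γ y₁ y₂ r) ν) = 0 := by
  by_contra h
  have := nonneg_of_PhiReg_ne_zero hτ r ν h
  exact hν ⟨fun k => (ν k).toNat, funext fun k => Int.toNat_of_nonneg (this k k.2)⟩

/-- The neighbourhood is one of z = q^α, uniformly in the choice of α: the branch enters only
through the prefactor q^{α Σ u_k}. -/
theorem eventually_absConverges (hτ : 0 < τ.im) (hx₁ : x₁ ≠ 0) (hx₂ : x₂ ≠ 0) {u : Fin n → ℂ}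
    (h : AvoidsPoles τ β₁ β₂ γ x₁ x₂ (point τ u))
    (hsupp : ∀ α, ∀ ν ∉ Set.range (natLattice (n := n)),
      PhiReg τ α β₁ β₂ γ x₁ x₂ (latticePoint u ν) = 0) :
    ∀ᶠ z in 𝓝 (0 : ℂ), ∀ α, qpow τ α = z → AbsConverges τ α β₁ β₂ γ x₁ x₂ u := by
  have hev : ∀ᶠ z in 𝓝 (0 : ℂ), ∀ (s : Fin (n + 1)) (σ : Equiv.Perm (Fin n)),
      Summable fun ν : Fin n → ℕ => z ^ (∑ k, ν k) *
        (PhiReg τ 0 β₁ β₂ γ x₁ x₂ (latticePoint u (natLattice ν)) *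
          numTerm τ β₂ γ x₁ x₂ s (fun k => point τ (latticePoint u (natLattice ν)) (σ k))) :=
    eventually_all.2 fun s => eventually_all.2 fun σ =>
      ((geoBound_PhiReg hτ hx₁ hx₂ u h).mul (geoBound_numTerm hτ u s σ)).eventually_summable
  filter_upwards [hev] with z hz α hα s σ
  refine (natLattice_injective.summable_iff fun ν hν => ?_).1 ?_
  · exact mul_eq_zero_of_left (hsupp α ν hν) _
  · refine ((hz s σ).mul_left (qpow τ (α * ∑ k, u k))).congr fun ν => ?_
    have := PhiReg_latticePoint (τ := τ) (α := α) (β₁ := β₁) (β₂ := β₂) (γ := γ) (x₁ := x₁)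
      (x₂ := x₂) u ν
    rw [hα] at this
    change _ = PhiReg τ α β₁ β₂ γ x₁ x₂ (latticePoint u (natLattice ν)) *
      numTerm τ β₂ γ x₁ x₂ s (fun k => point τ (latticePoint u (natLattice ν)) (σ k))
    rw [this]
    ring

/-- The power series in `q ^ α` given by the Jackson integral over a cone. -/
def coneSeries (τ β₁ β₂ γ x₁ x₂ : ℂ) (u : Fin n → ℂ) (s : Fin (n + 1)) (z : ℂ) : ℂ :=
  ∑' ν : Fin n → ℕ, z ^ (∑ k, ν k) *
    (PhiReg τ 0 β₁ β₂ γ x₁ x₂ (latticePoint u (natLattice ν)) *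
      altSum (numTerm τ β₂ γ x₁ x₂ s) (point τ (latticePoint u (natLattice ν))))

theorem phiTilde_eq_coneSeries {u : Fin n → ℂ} (s : Fin (n + 1))
    (hsupp : ∀ ν ∉ Set.range (natLattice (n := n)),
      PhiReg τ α β₁ β₂ γ x₁ x₂ (latticePoint u ν) = 0) :
    phiTilde τ α β₁ β₂ γ u x₁ x₂ s = (1 - qpow τ 1) ^ n * qpow τ (α * ∑ k, u k) *
      coneSeries τ β₁ β₂ γ x₁ x₂ u s (qpow τ α) := by
  have hs : Function.support (fun ν : Fin n → ℤ =>
      integrand τ α β₁ β₂ γ x₁ x₂ s (latticePoint u ν)) ⊆ Set.range (natLattice (n := n)) := by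
    intro ν hν
    by_contra h
    exact hν (mul_eq_zero_of_left (hsupp ν h) _)
  change (1 - qpow τ 1) ^ n * ∑' ν : Fin n → ℤ,
    integrand τ α β₁ β₂ γ x₁ x₂ s (latticePoint u ν) = _
  rw [← natLattice_injective.tsum_eq hs, mul_assoc, coneSeries]
  congr 1
  rw [← tsum_mul_left]
  refine tsum_congr fun ν => ?_
  rw [integrand, PhiReg_latticePoint]
  ring

theorem tendsto_coneSeries (hτ : 0 < τ.im) (hx₁ : x₁ ≠ 0) (hx₂ : x₂ ≠ 0) {u : Fin n → ℂ}
    (h : AvoidsPoles τ β₁ β₂ γ x₁ x₂ (point τ u)) (s : Fin (n + 1)) :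
    Tendsto (coneSeries τ β₁ β₂ γ x₁ x₂ u s) (𝓝 0)
      (𝓝 (PhiReg τ 0 β₁ β₂ γ x₁ x₂ u * altSum (numTerm τ β₂ γ x₁ x₂ s) (point τ u))) := by
  have := ((geoBound_PhiReg hτ hx₁ hx₂ u h).mul
    (geoBound_altSum_numTerm (β₂ := β₂) (γ := γ) (x₁ := x₁) (x₂ := x₂) hτ u s)).tendsto_tsum
  have e : latticePoint u (natLattice (0 : Fin n → ℕ)) = u := by
    funext k
    simp [latticePoint, natLattice]
  rw [e] at this
  exact this

end uniqueness

/-! ### Leading terms, nonvanishing of the determinant, and uniqueness -/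

section leading

variable {n : ℕ} {τ α β₁ β₂ γ y₁ y₂ : ℂ}

/-- Reversal of the first `r` and of the last `n - r` indices. -/
def blockRev (r : ℕ) (hr : r ≤ n) : Equiv.Perm (Fin n) :=
  Function.Involutive.toPerm
    (fun k => ⟨if (k : ℕ) < r then r - 1 - k else n - 1 + r - k, by
      have := k.2
      split_ifs <;> omega⟩)
    (fun k => by
      have := k.2
      apply Fin.ext
      dsimp only
      split_ifs <;> omega)

theorem blockRev_apply (r : ℕ) (hr : r ≤ n) (k : Fin n) :
    (blockRev r hr k : ℕ) = if (k : ℕ) < r then r - 1 - k else n - 1 + r - k := rfl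

theorem blockRev_symm (r : ℕ) (hr : r ≤ n) : (blockRev r hr).symm = blockRev r hr := rfl

theorem sub_qpow_mul_ne_zero {a b c : ℂ} (h : NotLattice τ (b - a + c)) :
    qpow τ a - qpow τ c * qpow τ b ≠ 0 := by
  intro e
  apply h 0
  have : b - a + c + ((0 : ℤ) : ℂ) = c + b - a := by push_cast; ring
  rw [this, qpow_sub, qpow_add, ← sub_eq_zero.1 e, div_self (qpow_ne_zero _ _)]

theorem one_sub_qpow_mul_div_ne_zero {a b c : ℂ} (h : NotLattice τ (c + a - b)) :
    1 - qpow τ c * qpow τ a / qpow τ b ≠ 0 := by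
  intro e
  apply h 0
  rw [Int.cast_zero, add_zero, qpow_sub, qpow_add, ← sub_eq_zero.1 e]

theorem numTerm_ne_zero_iff {x₁ x₂ : ℂ} (s : Fin (n + 1)) (t : Fin n → ℂ) :
    numTerm τ β₂ γ x₁ x₂ s t ≠ 0 ↔
      (∀ k : Fin n, if (k : ℕ) < n - (s : ℕ) then 1 - qpow τ β₂ * t k / x₂ ≠ 0
        else 1 - t k / x₁ ≠ 0) ∧
      ∀ i j, i < j → t i - qpow τ (-γ) * t j ≠ 0 := by
  simp only [numTerm, deltaGamma, mul_ne_zero_iff, prod_ne_zero_iff, mem_univ,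
    forall_true_left, mem_Ioi]
  refine and_congr (forall_congr' fun k => ?_) Iff.rfl
  split_ifs <;> rfl

/-- Reversal inside the blocks puts t_b before t_a whenever a < b lie in the same block, so the
factor t_b - q^{-γ}t_a never meets a coincidence t_b = q^γ t_a; genericity handles the rest. -/
theorem numTerm_blockRev_ne_zero (h : LogGeneric n τ β₁ β₂ γ y₁ y₂) {r : ℕ} (hr : r ≤ n)
    (s : Fin (n + 1)) (hs : r + s = n) :
    numTerm τ β₂ γ (qpow τ y₁) (qpow τ y₂) s
      (fun k => point τ (cycleBase n γ y₁ y₂ r) (blockRev r hr k)) ≠ 0 := by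
  refine (numTerm_ne_zero_iff _ _).2 ⟨fun k => ?_, fun i j hij => ?_⟩
  · have hk := k.2
    have hb := blockRev_apply r hr k
    rw [show n - (s : ℕ) = r by omega]
    split_ifs with hkr
    · rw [if_pos hkr] at hb
      refine one_sub_qpow_mul_div_ne_zero ?_
      rw [cycleBase, if_pos (by omega)]
      convert (h.diff_beta₂ (-(blockRev r hr k : ℕ))
        (abs_le_of_bounds (by omega) (by omega))).neg using 1
      push_cast; ring
    · rw [if_neg hkr] at hb
      suffices hNL : NotLattice τ (0 + cycleBase n γ y₁ y₂ r (blockRev r hr k) - y₁) by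
        simpa [qpow_zero, point] using one_sub_qpow_mul_div_ne_zero hNL
      rw [cycleBase, if_neg (by omega)]
      convert h.diff ((blockRev r hr k : ℕ) - r : ℤ)
        (abs_le_of_bounds (by omega) (by omega)) using 1
      push_cast; ring
  · have hi := blockRev_apply r hr i
    have hj := blockRev_apply r hr j
    have hij' : (i : ℕ) < j := hij
    have := j.2
    refine sub_qpow_mul_ne_zero ?_
    rw [cycleBase, cycleBase]
    generalize (blockRev r hr i : ℕ) = a at *
    generalize (blockRev r hr j : ℕ) = b at *
    split_ifs at hi hj ⊢ <;> try omega
    · convert h.gamma (b - a - 1 : ℤ) (by omega) (abs_le_of_bounds (by omega) (by omega)) using 1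
      push_cast; ring
    · convert h.diff (b - r - a - 1 : ℤ) (abs_le_of_bounds (by omega) (by omega)) using 1
      push_cast; ring
    · convert h.gamma (b - a - 1 : ℤ) (by omega) (abs_le_of_bounds (by omega) (by omega)) using 1
      push_cast; ring

/-- The two vanishing conditions on a nonzero term: the position of `x₁`, and the order within
each of the two blocks. -/
theorem position_of_numTerm_ne_zero {r : ℕ} {s : Fin (n + 1)} {σ : Equiv.Perm (Fin n)}
    (h : numTerm τ β₂ γ (qpow τ y₁) (qpow τ y₂) s
      (fun k => point τ (cycleBase n γ y₁ y₂ r) (σ k)) ≠ 0) :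
    (∀ k : Fin n, (k : ℕ) = 0 → 0 < r → (σ.symm k : ℕ) < n - s) ∧
    ∀ a b : Fin n, (b : ℕ) = a + 1 → (b : ℕ) ≠ r → σ.symm b < σ.symm a := by
  obtain ⟨h₁, h₂⟩ := (numTerm_ne_zero_iff _ _).1 h
  refine ⟨fun k hk hr => ?_, fun a b hab hbr => ?_⟩
  · by_contra hlt
    have := h₁ (σ.symm k)
    rw [if_neg hlt, Equiv.apply_symm_apply, point, cycleBase, if_pos (by omega), hk] at this
    apply this
    rw [Nat.cast_zero, zero_mul, add_zero, div_self (qpow_ne_zero _ _), sub_self]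
  · by_contra hlt
    have hne : σ.symm a ≠ σ.symm b := fun e => by
      have := σ.symm.injective e
      subst this
      omega
    refine h₂ _ _ (lt_of_le_of_ne (not_lt.1 hlt) hne) ?_
    simp only [Equiv.apply_symm_apply, point]
    -- Neighbours in a block satisfy t_b = q^γ t_a, so Δ kills every arrangement in which t_a
    -- precedes t_b.
    rw [← qpow_add, cycleBase, cycleBase, sub_eq_zero]
    congr 1
    split_ifs <;> first | omega | (rw [hab]; push_cast; ring)

/-- The positions of the first block decrease strictly and start below n - s, so there is room only
for r ≤ n - s. -/
theorem le_of_position {r : ℕ} (hr : r ≤ n) {s : Fin (n + 1)} {p : Fin n → Fin n}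
    (h₁ : ∀ k : Fin n, (k : ℕ) = 0 → 0 < r → (p k : ℕ) < n - s)
    (h₂ : ∀ a b : Fin n, (b : ℕ) = a + 1 → (b : ℕ) ≠ r → p b < p a) :
    ∀ (a : ℕ) (ha : a < r), (p ⟨a, by omega⟩ : ℕ) + a + 1 ≤ n - s := by
  intro a
  induction a with
  | zero =>
    intro ha
    have := h₁ ⟨0, by omega⟩ rfl ha
    omega
  | succ a ih =>
    intro ha
    have := ih (by omega)
    have h := h₂ ⟨a, by omega⟩ ⟨a + 1, by omega⟩ rfl (by simp; omega)
    rw [Fin.lt_def] at h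
    omega

/-- For r = n - s there is no slack: the first block fills exactly the places below r in decreasing
order, which forces the second block likewise. -/
theorem eq_blockRev_of_position {r : ℕ} (hr : r ≤ n) {s : Fin (n + 1)} (hs : r + s = n)
    {p : Equiv.Perm (Fin n)}
    (h₁ : ∀ k : Fin n, (k : ℕ) = 0 → 0 < r → (p k : ℕ) < n - s)
    (h₂ : ∀ a b : Fin n, (b : ℕ) = a + 1 → (b : ℕ) ≠ r → p b < p a) :
    p = blockRev r hr := by
  have up := le_of_position hr h₁ h₂
  have low : ∀ (d a : ℕ) (ha : a < r), a + 1 + d = r → d ≤ (p ⟨a, by omega⟩ : ℕ) := by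
    intro d
    induction d with
    | zero => intros; omega
    | succ d ih =>
      intro a ha hd
      have := ih (a + 1) (by omega) (by omega)
      have h := h₂ ⟨a, by omega⟩ ⟨a + 1, by omega⟩ rfl (by simp; omega)
      rw [Fin.lt_def] at h
      omega
  have first : ∀ (a : ℕ) (ha : a < r), (p ⟨a, by omega⟩ : ℕ) = r - 1 - a := by
    intro a ha
    have := up a ha
    have := low (r - 1 - a) a ha (by omega)
    omega
  have out : ∀ (a : ℕ) (ha : a < n), r ≤ a → r ≤ (p ⟨a, ha⟩ : ℕ) := by
    intro a ha har
    by_contra hlt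
    have hf := first (r - 1 - (p ⟨a, ha⟩ : ℕ)) (by omega)
    have : p ⟨r - 1 - (p ⟨a, ha⟩ : ℕ), by omega⟩ = p ⟨a, ha⟩ := Fin.ext (by rw [hf]; omega)
    have := congrArg Fin.val (p.injective this)
    simp only at this
    omega
  have up' : ∀ (d : ℕ) (h : r + d < n), (p ⟨r + d, h⟩ : ℕ) + d + 1 ≤ n := by
    intro d
    induction d with
    | zero => intro h; have := (p ⟨r + 0, h⟩).2; omega
    | succ d ih =>
      intro h
      have := ih (by omega)
      have h := h₂ ⟨r + d, by omega⟩ ⟨r + (d + 1), h⟩ (by simp; omega) (by simp)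
      rw [Fin.lt_def] at h
      omega
  have low' : ∀ (d a : ℕ) (ha : a < n), r ≤ a → a + 1 + d = n → r + d ≤ (p ⟨a, ha⟩ : ℕ) := by
    intro d
    induction d with
    | zero => intro a ha har _; exact out a ha har
    | succ d ih =>
      intro a ha har hd
      have := ih (a + 1) (by omega) (by omega) (by omega)
      have h := h₂ ⟨a, by omega⟩ ⟨a + 1, by omega⟩ rfl (by simp; omega)
      rw [Fin.lt_def] at h
      omega
  ext k
  rw [blockRev_apply]
  have hk := k.2
  split_ifs with hkr
  · exact first k hkr
  · have a₁ := up' (k - r) (by omega)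
    have a₂ := low' (n - 1 - k) k hk (by omega) (by omega)
    have e : (⟨r + (k - r), by omega⟩ : Fin n) = k := Fin.ext (by simp; omega)
    rw [e] at a₁
    simp only [Fin.eta] at a₂
    omega

theorem altSum_numTerm_eq_zero {r : ℕ} (hr : r ≤ n) {s : Fin (n + 1)} (hs : n < r + s) :
    altSum (numTerm τ β₂ γ (qpow τ y₁) (qpow τ y₂) s) (point τ (cycleBase n γ y₁ y₂ r)) = 0 := by
  refine sum_eq_zero fun σ _ => mul_eq_zero_of_right _ ?_
  by_contra h
  obtain ⟨h₁, h₂⟩ := position_of_numTerm_ne_zero h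
  have hs' := s.2
  have := le_of_position hr h₁ h₂ (r - 1) (by omega)
  omega

theorem altSum_numTerm_ne_zero (h : LogGeneric n τ β₁ β₂ γ y₁ y₂) {r : ℕ} (hr : r ≤ n)
    {s : Fin (n + 1)} (hs : r + s = n) :
    altSum (numTerm τ β₂ γ (qpow τ y₁) (qpow τ y₂) s) (point τ (cycleBase n γ y₁ y₂ r)) ≠ 0 := by
  rw [altSum, sum_eq_single (blockRev r hr)]
  · refine mul_ne_zero ?_ (numTerm_blockRev_ne_zero h hr s hs)
    exact_mod_cast (Equiv.Perm.sign (blockRev r hr)).ne_zero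
  · intro σ _ hσ
    refine mul_eq_zero_of_right _ ?_
    by_contra hne
    obtain ⟨h₁, h₂⟩ := position_of_numTerm_ne_zero hne
    have e := eq_blockRev_of_position hr hs h₁ h₂
    exact hσ (by rw [← σ.symm_symm, e, blockRev_symm])
  · exact fun h => absurd (mem_univ _) h

/-- The matrix of cone series for the base points `cycleBase`. -/
def seriesMatrix (n : ℕ) (τ β₁ β₂ γ y₁ y₂ z : ℂ) : Matrix (Fin (n + 1)) (Fin (n + 1)) ℂ :=
  Matrix.of fun r s =>
    coneSeries τ β₁ β₂ γ (qpow τ y₁) (qpow τ y₂) (cycleBase n γ y₁ y₂ r) s z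

theorem eventually_det_seriesMatrix_ne_zero (hτ : 0 < τ.im)
    (h : LogGeneric n τ β₁ β₂ γ y₁ y₂) :
    ∀ᶠ z in 𝓝 (0 : ℂ), (seriesMatrix n τ β₁ β₂ γ y₁ y₂ z).det ≠ 0 := by
  let P : Matrix (Fin (n + 1)) (Fin (n + 1)) ℂ := Matrix.of fun r s =>
    PhiReg τ 0 β₁ β₂ γ (qpow τ y₁) (qpow τ y₂) (cycleBase n γ y₁ y₂ r) *
      altSum (numTerm τ β₂ γ (qpow τ y₁) (qpow τ y₂) s) (point τ (cycleBase n γ y₁ y₂ r))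
  have hlim : Tendsto (seriesMatrix n τ β₁ β₂ γ y₁ y₂) (𝓝 0) (𝓝 P) :=
    tendsto_pi_nhds.2 fun r => tendsto_pi_nhds.2 fun s =>
      tendsto_coneSeries hτ (qpow_ne_zero _ _) (qpow_ne_zero _ _) (avoidsPoles_cycleBase h r) s
  have hdet : P.det ≠ 0 := by
    intro e
    -- Leading terms vanish for r + s > n, so reversing the columns makes the matrix upper
    -- triangular, with the terms r + s = n on the diagonal.
    have hp : (P.submatrix id (Fin.revPerm : Equiv.Perm (Fin (n + 1)))).det = 0 := by
      rw [Matrix.det_permute', e, mul_zero]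
    rw [Matrix.det_of_isUpperTriangular] at hp
    · obtain ⟨r, -, hr⟩ := prod_eq_zero_iff.1 hp
      have hr' := r.2
      refine mul_ne_zero (PhiReg_cycleBase_ne_zero hτ h r)
        (altSum_numTerm_ne_zero h (by omega) ?_) hr
      simp [Fin.val_rev]
      omega
    · intro r s hsr
      have hr' := r.2
      have hsr' : (s : ℕ) < r := hsr
      refine mul_eq_zero_of_right _ (altSum_numTerm_eq_zero (by omega) ?_)
      simp [Fin.val_rev]
      omega
  exact ((continuous_id.matrix_det.tendsto P).comp hlim).eventually_ne hdet

theorem eventually_admissible_cycleBase (hτ : 0 < τ.im) (h : LogGeneric n τ β₁ β₂ γ y₁ y₂)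
    (r : ℕ) : ∀ᶠ z in 𝓝 (0 : ℂ), ∀ α, qpow τ α = z →
      Admissible τ α β₁ β₂ γ (qpow τ y₁) (qpow τ y₂) (cycleBase n γ y₁ y₂ r) := by
  have ha := avoidsPoles_cycleBase h r
  have hx₁ := qpow_ne_zero τ y₁
  have e₀ := eventually_absConverges hτ hx₁ (qpow_ne_zero τ y₂) ha fun α ν hν => by
    have := PhiReg_eq_zero_of_notMem_range (α := α) (β₁ := β₁) (β₂ := β₂) (γ := γ) (y₁ := y₁)
      (y₂ := y₂) hτ 0 r ν hν
    simpa using this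
  have e₁ := eventually_absConverges hτ hx₁ (mul_ne_zero (qpow_ne_zero τ 1) (qpow_ne_zero τ y₂))
    ha.shift fun α ν hν => by
      have := PhiReg_eq_zero_of_notMem_range (α := α) (β₁ := β₁) (β₂ := β₂) (γ := γ) (y₁ := y₁)
        (y₂ := y₂) hτ 1 r ν hν
      rwa [Nat.cast_one, add_comm, qpow_add] at this
  filter_upwards [e₀, e₁] with z h₀ h₁ α hα
  exact ⟨ha, h₀ α hα, h₁ α hα⟩

/-- The rows coming from the n + 1 special lattices all annihilate K - K', and together they form an
invertible matrix once q^α is small. -/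
theorem exists_unique_bound (hτ : 0 < τ.im) (h : LogGeneric n τ β₁ β₂ γ y₁ y₂) :
    ∃ ε : ℝ, 0 < ε ∧ ∀ α : ℂ, ‖qpow τ α‖ < ε →
      ∀ K K' : Matrix (Fin (n + 1)) (Fin (n + 1)) ℂ,
        IsQKZMatrix τ α β₁ β₂ γ (qpow τ y₁) (qpow τ y₂) K →
        IsQKZMatrix τ α β₁ β₂ γ (qpow τ y₁) (qpow τ y₂) K' → K = K' := by
  have hadm : ∀ᶠ z in 𝓝 (0 : ℂ), ∀ r : Fin (n + 1), ∀ α, qpow τ α = z →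
      Admissible τ α β₁ β₂ γ (qpow τ y₁) (qpow τ y₂) (cycleBase n γ y₁ y₂ r) :=
    eventually_all.2 fun r => eventually_admissible_cycleBase hτ h r
  obtain ⟨ε, hε, hball⟩ :=
    Metric.eventually_nhds_iff.1 (hadm.and (eventually_det_seriesMatrix_ne_zero hτ h))
  refine ⟨ε, hε, fun α hα K K' hK hK' => ?_⟩
  obtain ⟨hA, hD⟩ := hball (y := qpow τ α) (by simpa using hα)
  have hq : (1 - qpow τ 1) ^ n ≠ 0 := by
    refine pow_ne_zero _ (sub_ne_zero.2 fun e => ?_)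
    have := norm_qpow_one_lt τ hτ
    rw [← e, norm_one] at this
    exact lt_irrefl _ this
  have hrow : seriesMatrix n τ β₁ β₂ γ y₁ y₂ (qpow τ α) * (K - K') = 0 := by
    ext r s
    have key := (hK _ (hA r α rfl)).symm.trans (hK' _ (hA r α rfl))
    rw [← sub_eq_zero, ← Matrix.vecMul_sub] at key
    have hrs := congrFun key s
    have hphi : phiTilde τ α β₁ β₂ γ (cycleBase n γ y₁ y₂ r) (qpow τ y₁) (qpow τ y₂) =
        ((1 - qpow τ 1) ^ n * qpow τ (α * ∑ k, cycleBase n γ y₁ y₂ r k)) •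
          seriesMatrix n τ β₁ β₂ γ y₁ y₂ (qpow τ α) r := by
      funext s'
      refine phiTilde_eq_coneSeries s' fun ν hν => ?_
      have := PhiReg_eq_zero_of_notMem_range (α := α) (β₁ := β₁) (β₂ := β₂) (γ := γ) (y₁ := y₁)
        (y₂ := y₂) hτ 0 r ν hν
      simpa using this
    rw [hphi, Matrix.smul_vecMul, Pi.smul_apply, smul_eq_mul, Pi.zero_apply] at hrs
    exact (mul_eq_zero.1 hrs).resolve_left (mul_ne_zero hq (qpow_ne_zero _ _))
  have hu : IsUnit (seriesMatrix n τ β₁ β₂ γ y₁ y₂ (qpow τ α)).det := isUnit_iff_ne_zero.2 hD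
  have := congrArg ((seriesMatrix n τ β₁ β₂ γ y₁ y₂ (qpow τ α))⁻¹ * ·) hrow
  simp only [Matrix.nonsing_inv_mul_cancel_left _ _ hu, mul_zero] at this
  exact sub_eq_zero.1 this

end leading

end QKZ

end

/-- The matrix of the `q`-KZ system in terms of its two Gauss decompositions: the explicit matrices
represent the system, they coincide, and for generic parameters no other matrix represents the
system. -/
theorem corollary1p3p8 (n : ℕ) (τ : ℂ) (hτ : 0 < τ.im) (β₁ β₂ γ x₁ x₂ : ℂ)
    (hx₁ : x₁ ≠ 0) (hx₂ : x₂ ≠ 0) (hden : QKZ.DenominatorsNonzero n τ β₁ β₂ γ x₁ x₂) :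
    (∀ α : ℂ, QKZ.IsQKZMatrix τ α β₁ β₂ γ x₁ x₂
      (QKZ.UR n τ β₁ β₂ γ x₁ x₂ * QKZ.DR n τ β₁ β₂ γ x₁ x₂ * QKZ.LR n τ β₁ β₂ γ x₁ x₂ *
        QKZ.diagAlpha n τ α γ)) ∧
    (∀ α : ℂ,
      QKZ.UR n τ β₁ β₂ γ x₁ x₂ * QKZ.DR n τ β₁ β₂ γ x₁ x₂ * QKZ.LR n τ β₁ β₂ γ x₁ x₂ *
        QKZ.diagAlpha n τ α γ =
      QKZ.LR' n τ β₂ γ x₁ x₂ * QKZ.DR' n τ β₁ β₂ γ x₁ x₂ * QKZ.UR' n τ β₁ γ x₁ x₂ *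
        QKZ.diagAlpha n τ α γ) ∧
    (QKZ.IsGeneric n τ β₁ β₂ γ x₁ x₂ →
      ∃ ε : ℝ, 0 < ε ∧ ∀ α : ℂ, ‖QKZ.qpow τ α‖ < ε →
        ∀ K : Matrix (Fin (n + 1)) (Fin (n + 1)) ℂ,
          QKZ.IsQKZMatrix τ α β₁ β₂ γ x₁ x₂ K →
            K = QKZ.UR n τ β₁ β₂ γ x₁ x₂ * QKZ.DR n τ β₁ β₂ γ x₁ x₂ *
                  QKZ.LR n τ β₁ β₂ γ x₁ x₂ * QKZ.diagAlpha n τ α γ) := by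
  have hK : ∀ α : ℂ, QKZ.IsQKZMatrix τ α β₁ β₂ γ x₁ x₂
      (QKZ.UR n τ β₁ β₂ γ x₁ x₂ * QKZ.DR n τ β₁ β₂ γ x₁ x₂ * QKZ.LR n τ β₁ β₂ γ x₁ x₂ *
        QKZ.diagAlpha n τ α γ) := fun α => QKZ.isQKZMatrix_URDRLR hτ hx₁ hx₂ hden
  refine ⟨hK, fun α => by rw [QKZ.URDRLR_eq_LRDRUR hx₁ hx₂ hden], fun hgen => ?_⟩
  obtain ⟨y₁, rfl⟩ := QKZ.exists_qpow_eq hτ hx₁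
  obtain ⟨y₂, rfl⟩ := QKZ.exists_qpow_eq hτ hx₂
  obtain ⟨ε, hε, h⟩ := QKZ.exists_unique_bound hτ hgen.logGeneric
  exact ⟨ε, hε, fun α hα K h_K => h α hα K _ h_K (hK α)⟩
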